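/- **Setting.** Let $\mathfrak S_n$ be the symmetric group and $\mathbb Z\mathfrak S=\bigoplus_{n\ge 0}\mathbb Z\mathfrak S_n$. Write permutations and signed permutations as words $w(1)\cdots w(n)$. For a word $a=a_1\cdots a_n$ of integers let $a[i,j]=a_i\cdots a_j$, let $a|[i,j]$ be the subword of letters with absolute value in $[i,j]$, let $\mathrm{st}(a)\in\mathfrak S_n$ be the standardization (ties numbered from left to right), and let $\hat a$ be the word of the negated negative letters of $a$ read from right to left, followed by the other letters of $a$ from left to right. The two Malvenuto–Reutenauer graded Hopf algebras $(\mathbb Z\mathfrak S,\mathbin{\sqcup\!\sqcup} ,\Delta)$ and $(\mathbb Z\mathfrak S,\Cup,\Cap)$ are given, for $u\in\mathfrak S_m$, $v\in\mathfrak S_n$, by (sets denote the sums of their elements) $$u\mathbin{\sqcup\!\sqcup} v=\{w\in\mathfrak S_{m+n}: w|[1,m]=u,\ \mathrm{st}(w|[m+1,m+n])=v\},\quad \Delta u=\sum_{0\le i\le m}\mathrm{st}(u[1,i])\otimes\mathrm{st}(u[i+1,m]),$$ $$u\Cup v=\{w\in\mathfrak S_{m+n}: \mathrm{st}(w[1,m])=u,\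 \mathrm{st}(w[m+1,m+n])=v\},\quad \Cap u=\sum_{0\le i\le m}u|[1,i]\otimes\mathrm{st}(u|[i+1,m]),$$ with the empty permutation as unit and its coefficient as counit. Let $\mathfrak S^D_n$ be the group of signed permutations of $[n]$ with an even number of negative entries, and $\mathbb Z\mathfrak S^D=\bigoplus_{n\ge2}\mathbb Z\mathfrak S^D_n$. For a word $a$ let $\mathrm{st}^B(a)$ be the signed permutation with negative entries at the same positions as in $a$, whose absolute values number the letters of $a$ by increasing absolute value, ties being broken first from right to left among negative letters and then from left to right among the others. Let $s_0^B=[-1,2,\dots,n]$. Put ${}^D\mathrm{st}(a)=\mathrm{st}^D(a)=\mathrm{st}^B(a)$ if $\mathrm{st}^B(a)\in\mathfrak S^D_n$, and otherwise ${}^D\mathrm{st}(a)=s_0^B\,\mathrm{st}^B(a)$, $\mathrm{st}^D(a)=\mathrm{st}^B(a)\,s_0^B$. For $m\ge2$, $n\ge0$, $u\in\mathfrak S^D_m$, $v\in\mathfrak S_n$ define $$u\mathbin{\sqcup\!\sqcup}^D v=\{w\in\mathfrak S^D_{m+n}:\mathrm{st}^D(w|[1,m])=u,\ \mathrm{st}(\hat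 w|[m+1,m+n])=v\},\quad \Delta^D u=\sum_{2\le i\le m}{}^D\mathrm{st}(u[1,i])\otimes\mathrm{st}(u[i+1,m]),$$ $$u\Cup^Dv=\{w\in\mathfrak S^D_{m+n}:{}^D\mathrm{st}(w[1,m])=u,\ \mathrm{st}(w[m+1,m+n])=v\},\quad \Cap^Du=\sum_{2\le i\le m}\mathrm{st}^D(u|[1,i])\otimes\mathrm{st}(\hat u|[i+1,m]).$$ Descents are $D(w)=\{1\le i<n: w(i)>w(i+1)\}$ for $w\in\mathfrak S_n$ and $D(w)=\{0\le i<n:w(i)>w(i+1)\}$ with $w(0):=-w(2)$ for $w\in\mathfrak S^D_n$. For $X\in\{\mathfrak S,\mathfrak S^D\}$ let $\Sigma(X)\subseteq\mathbb ZX$ be the span of all descent classes $D_I(X_n)=\sum_{w\in X_n,\,D(w)=I}w$, let $\Sigma^*(X)$ be its graded dual, $\imath$ any inclusion, $\chi:\mathbb ZX\to\Sigma^*(X)$ the map dual to $\imath:\Sigma(X)\to\mathbb ZX$ under $\langle u,v\rangle=\delta_{u,v}$, $\chi'(w)=\chi(w^{-1})$, and $\Lambda(X)=\chi'(\Sigma(X))$.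 **Theorem.** 0. (Parabolic embedding.) Let $m\ge2$, $n\ge 0$, $u\in\mathfrak S^D_m$, $v\in\mathfrak S_n$, let $u\times v=[u(1),\dots,u(m),m+v(1),\dots,m+v(n)]\in\mathfrak S^D_{m+n}$, and let $Z=\{z\in\mathfrak S^D_{m+n}:D(z)\subseteq\{m\}\}$. Then, for $w\in\mathfrak S^D_{m+n}$: ${}^D\mathrm{st}(w[1,m])=u$ and $\mathrm{st}(w[m+1,m+n])=v$ if and only if $w=z(u\times v)$ for some $z\in Z$; and $\mathrm{st}^D(w|[1,m])=u$ and $\mathrm{st}(\hat w|[m+1,m+n])=v$ if and only if $w=(u\times v)z^{-1}$ for some $z\in Z$. 1. $(\mathbb Z\mathfrak S,\mathbin{\sqcup\!\sqcup} ,\Delta)$ and $(\mathbb Z\mathfrak S,\Cup,\Cap)$ are graded Hopf algebras; $(\mathbb Z\mathfrak S^D,\mathbin{\sqcup\!\sqcup}^D ,\Delta^D)$ is a graded right module and a graded right comodule over the first, and $(\mathbb Z\mathfrak S^D,\Cup^D,\Cap^D)$ is one over the second. 2. Via $\langle u,v\rangle=\delta_{u,v}$, the two Hopf algebras are dual to each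 other, and the two module–comodules over them are dual to each other (the action of each is the transpose of the coaction of the other). 3. The linear extension of $w\mapsto w^{-1}$ is an isomorphism from $(\mathbb Z\mathfrak S,\mathbin{\sqcup\!\sqcup} ,\Delta)$ to $(\mathbb Z\mathfrak S,\Cup,\Cap)$ and, along it, from $(\mathbb Z\mathfrak S^D,\mathbin{\sqcup\!\sqcup}^D ,\Delta^D)$ to $(\mathbb Z\mathfrak S^D,\Cup^D,\Cap^D)$. 4. There are graded Hopf algebra structures on $\Sigma(\mathfrak S),\Sigma^*(\mathfrak S),\Lambda(\mathfrak S)$ for which $$\Sigma(\mathfrak S)\xrightarrow{\ \imath\ }(\mathbb Z\mathfrak S,\Cup,\Cap)\xrightarrow{\ \chi'\ }\Sigma^*(\mathfrak S),\qquad \Sigma(\mathfrak S)\xrightarrow{\ \chi'\ }\Lambda(\mathfrak S)\xrightarrow{\ \imath\ }\Sigma^*(\mathfrak S)$$ are homomorphisms of graded Hopf algebras, and graded right module and comodule structures on $\Sigma(\mathfrak S^D),\Sigma^*(\mathfrak S^D),\Lambda(\mathfrak S^D)$ over $\Sigma(\mathfrak S),\Sigma^*(\mathfrak S),\Lambda(\mathfrak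 S)$ respectively, for which the four maps of the diamond $$\Sigma(\mathfrak S^D)\overset{\imath}{\hookrightarrow}(\mathbb Z\mathfrak S^D,\Cup^D,\Cap^D)\overset{\chi'}{\twoheadrightarrow}\Sigma^*(\mathfrak S^D),\qquad \Sigma(\mathfrak S^D)\overset{\chi'}{\twoheadrightarrow}\Lambda(\mathfrak S^D)\overset{\imath}{\hookrightarrow}\Sigma^*(\mathfrak S^D)$$ are homomorphisms of graded modules and comodules along the type A maps. The diamond commutes, its maps being injective and surjective as indicated. 5. Reflecting the diamond across the vertical line through $\mathbb Z\mathfrak S^D$ and $\Lambda(\mathfrak S^D)$ gives the dual diagram, for the structures of 4. Namely, there are well-defined symmetric nondegenerate forms on $\Lambda(X)$, $X\in\{\mathfrak S,\mathfrak S^D\}$, with $\langle\chi'(D_I(X_n)),\chi'(D_J(X_n))\rangle=\#\{w\in X_n:D(w^{-1})=I,\ D(w)=J\}$ and with different degrees orthogonal, such that: $\Sigma(X)$ and $\Sigma^*(X)$ are dual to each other via evaluation, $(\mathbb ZX$ with its $\Cup,\Cap$ structure$)$ is self-dual via $\langle u,v\rangle'=\delta_{u^{-1},v}$, and $\Lambda(X)$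 is self-dual via the above form, as Hopf algebras for $X=\mathfrak S$ and as modules and comodules for $X=\mathfrak S^D$; and in type D the maps $\imath:\Sigma\to\mathbb Z\mathfrak S^D$ and $\chi':\mathbb Z\mathfrak S^D\to\Sigma^*$ are dual to each other, and so are $\chi':\Sigma\to\Lambda$ and $\imath:\Lambda\to\Sigma^*$. -/

import Mathlib

open scoped TensorProduct

noncomputable section

/-! ### Graded Hopf algebras, graded right module-comodules, and duality -/

/-- The operations of a (candidate) Hopf algebra, except the antipode. -/
structure HopfOps (R A : Type) [CommRing R] [AddCommGroup A] [Module R A] where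
  mul : A →ₗ[R] A →ₗ[R] A
  one : A
  comul : A →ₗ[R] A ⊗[R] A
  counit : A →ₗ[R] R

/-- An action of `A` on `M` from the right and a coaction `M → M ⊗ A`. -/
structure ModComodOps (R A M : Type) [CommRing R] [AddCommGroup A] [Module R A]
    [AddCommGroup M] [Module R M] where
  act : M →ₗ[R] A →ₗ[R] M
  coact : M →ₗ[R] M ⊗[R] A

section Axioms

variable {R A B M N : Type} [CommRing R] [AddCommGroup A] [Module R A] [AddCommGroup B] [Module R B]
  [AddCommGroup M] [Module R M] [AddCommGroup N] [Module R N]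

/-- The degree `n` part of a tensor product of graded modules. -/
def tensorGr (ℳ : ℕ → Submodule R M) (𝒜 : ℕ → Submodule R A) (n : ℕ) :
    Submodule R (M ⊗[R] A) :=
  ⨆ p ∈ Finset.HasAntidiagonal.antidiagonal n,
    LinearMap.range (TensorProduct.map (ℳ p.1).subtype (𝒜 p.2).subtype)

/-- The operations `H` make `A = ⨁ 𝒜 n` a graded Hopf algebra. -/
structure IsGradedHopf (𝒜 : ℕ → Submodule R A) (H : HopfOps R A) : Prop where
  isInternal : DirectSum.IsInternal 𝒜
  mul_assoc : ∀ a b c, H.mul (H.mul a b) c = H.mul a (H.mul b c)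
  one_mul : ∀ a, H.mul H.one a = a
  mul_one : ∀ a, H.mul a H.one = a
  coassoc : ∀ a, TensorProduct.assoc R A A A (TensorProduct.map H.comul LinearMap.id (H.comul a))
    = TensorProduct.map LinearMap.id H.comul (H.comul a)
  counit_left : ∀ a,
    TensorProduct.lid R A (TensorProduct.map H.counit LinearMap.id (H.comul a)) = a
  counit_right : ∀ a,
    TensorProduct.rid R A (TensorProduct.map LinearMap.id H.counit (H.comul a)) = a
  comul_mul : ∀ a b, H.comul (H.mul a b)
    = TensorProduct.map₂ H.mul H.mul (H.comul a) (H.comul b)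
  comul_one : H.comul H.one = H.one ⊗ₜ[R] H.one
  counit_mul : ∀ a b, H.counit (H.mul a b) = H.counit a * H.counit b
  counit_one : H.counit H.one = 1
  mul_mem : ∀ i j, ∀ a ∈ 𝒜 i, ∀ b ∈ 𝒜 j, H.mul a b ∈ 𝒜 (i + j)
  one_mem : H.one ∈ 𝒜 0
  comul_mem : ∀ n, ∀ a ∈ 𝒜 n, H.comul a ∈ tensorGr 𝒜 𝒜 n
  counit_eq_zero : ∀ n, n ≠ 0 → ∀ a ∈ 𝒜 n, H.counit a = 0
  antipode : ∃ S : A →ₗ[R] A, (∀ n, ∀ a ∈ 𝒜 n, S a ∈ 𝒜 n) ∧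
    (∀ a, TensorProduct.lift H.mul (TensorProduct.map S LinearMap.id (H.comul a))
      = H.counit a • H.one) ∧
    (∀ a, TensorProduct.lift H.mul (TensorProduct.map LinearMap.id S (H.comul a))
      = H.counit a • H.one)

/-- The operations `X` make `M = ⨁ ℳ n` a graded right module over the algebra `H` and a graded
right comodule over the coalgebra `H`. -/
structure IsGradedModComod (𝒜 : ℕ → Submodule R A) (ℳ : ℕ → Submodule R M)
    (H : HopfOps R A) (X : ModComodOps R A M) : Prop where
  isInternal : DirectSum.IsInternal ℳ
  act_one : ∀ x, X.act x H.one = x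
  act_act : ∀ x a b, X.act (X.act x a) b = X.act x (H.mul a b)
  coassoc : ∀ x, TensorProduct.assoc R M A A (TensorProduct.map X.coact LinearMap.id (X.coact x))
    = TensorProduct.map LinearMap.id H.comul (X.coact x)
  counit : ∀ x, TensorProduct.rid R M (TensorProduct.map LinearMap.id H.counit (X.coact x)) = x
  act_mem : ∀ i j, ∀ x ∈ ℳ i, ∀ a ∈ 𝒜 j, X.act x a ∈ ℳ (i + j)
  coact_mem : ∀ n, ∀ x ∈ ℳ n, X.coact x ∈ tensorGr ℳ 𝒜 n

/-- `φ` is a homomorphism of graded Hopf algebras. -/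
structure IsHopfHom (𝒜 : ℕ → Submodule R A) (ℬ : ℕ → Submodule R B)
    (H : HopfOps R A) (K : HopfOps R B) (φ : A →ₗ[R] B) : Prop where
  map_mem : ∀ n, ∀ a ∈ 𝒜 n, φ a ∈ ℬ n
  map_mul : ∀ a b, φ (H.mul a b) = K.mul (φ a) (φ b)
  map_one : φ H.one = K.one
  map_comul : ∀ a, K.comul (φ a) = TensorProduct.map φ φ (H.comul a)
  map_counit : ∀ a, K.counit (φ a) = H.counit a

/-- `f` is a homomorphism of graded modules and comodules along `φ`. -/
structure IsModComodHom (ℳ : ℕ → Submodule R M) (𝒩 : ℕ → Submodule R N)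
    (X : ModComodOps R A M) (Y : ModComodOps R B N) (φ : A →ₗ[R] B) (f : M →ₗ[R] N) : Prop where
  map_mem : ∀ n, ∀ x ∈ ℳ n, f x ∈ 𝒩 n
  map_act : ∀ x a, f (X.act x a) = Y.act (f x) (φ a)
  map_coact : ∀ x, Y.coact (f x) = TensorProduct.map f φ (X.coact x)

/-- The pairing `⟨x ⊗ a, y ⊗ b⟩ = ⟨x, y⟩ ⟨a, b⟩`. -/
def tensorPairing (p : M →ₗ[R] N →ₗ[R] R) (q : A →ₗ[R] B →ₗ[R] R) :
    M ⊗[R] A →ₗ[R] N ⊗[R] B →ₗ[R] R :=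
  (TensorProduct.map₂ p q).compr₂ (TensorProduct.lid R R).toLinearMap

/-- A nondegenerate pairing for which parts of different degrees are orthogonal. -/
structure IsGradedPairing (ℳ : ℕ → Submodule R M) (𝒩 : ℕ → Submodule R N)
    (p : M →ₗ[R] N →ₗ[R] R) : Prop where
  nondegenerate : p.Nondegenerate
  orthogonal : ∀ i j, i ≠ j → ∀ x ∈ ℳ i, ∀ y ∈ 𝒩 j, p x y = 0

/-- `H` and `K` are dual to each other via the pairing `q`. -/
structure IsHopfDual (𝒜 : ℕ → Submodule R A) (ℬ : ℕ → Submodule R B)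
    (q : A →ₗ[R] B →ₗ[R] R) (H : HopfOps R A) (K : HopfOps R B) : Prop where
  pairing : IsGradedPairing 𝒜 ℬ q
  mul_comul : ∀ a a' b, q (H.mul a a') b = tensorPairing q q (a ⊗ₜ[R] a') (K.comul b)
  comul_mul : ∀ a b b', q a (K.mul b b') = tensorPairing q q (H.comul a) (b ⊗ₜ[R] b')
  one_counit : ∀ b, q H.one b = K.counit b
  counit_one : ∀ a, q a K.one = H.counit a

/-- `X` and `Y` are dual to each other via the pairing `p` of the modules and the pairing `q` of the
Hopf algebras: each action is the transpose of the other coaction. -/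
structure IsModComodDual (ℳ : ℕ → Submodule R M) (𝒩 : ℕ → Submodule R N)
    (p : M →ₗ[R] N →ₗ[R] R) (q : A →ₗ[R] B →ₗ[R] R)
    (X : ModComodOps R A M) (Y : ModComodOps R B N) : Prop where
  pairing : IsGradedPairing ℳ 𝒩 p
  act_coact : ∀ x a y, p (X.act x a) y = tensorPairing p q (x ⊗ₜ[R] a) (Y.coact y)
  coact_act : ∀ x y b, p x (Y.act y b) = tensorPairing p q (X.coact x) (y ⊗ₜ[R] b)

end Axioms

/-- The bilinear map with given values on the basis vectors. -/
def bilin {α β M : Type} [AddCommGroup M] [Module ℤ M] (f : α → β → M) :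
    (α →₀ ℤ) →ₗ[ℤ] (β →₀ ℤ) →ₗ[ℤ] M :=
  Finsupp.linearCombination ℤ (fun a => Finsupp.linearCombination ℤ (f a))

/-- The form `⟨u, v⟩ = δ_{u,v}`. -/
def kron (X : Type) : (X →₀ ℤ) →ₗ[ℤ] (X →₀ ℤ) →ₗ[ℤ] ℤ :=
  open Classical in bilin (fun u v => if u = v then 1 else 0)

theorem kron_single (X : Type) (x : X →₀ ℤ) (w : X) (c : ℤ) :
    kron X x (Finsupp.single w c) = c * x w := by
  classical
  induction x using Finsupp.induction_linear with
  | zero => simp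
  | add f g hf hg => rw [map_add, LinearMap.add_apply, hf, hg, Finsupp.add_apply, mul_add]
  | single v b =>
    simp [kron, bilin, Finsupp.linearCombination_single, Finsupp.single_apply, mul_comm]

/-! ### Permutations, signed permutations, words -/

/-- A signed permutation `w` of `[n]`, i.e. a bijection `w` of `{±1, …, ±n}` with
`w (-i) = -w i`, given by its absolute values and signs. Positions and values are shifted by one:
`w (i + 1) = sgn i * (perm i + 1)` for `i = 0, …, n - 1`. -/
@[ext] structure SignedPerm (n : ℕ) where
  perm : Equiv.Perm (Fin n)
  sgn : Fin n → ℤˣ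

namespace SignedPerm

/-- Composition: `(w * z) i = w (z i)`. -/
instance (n : ℕ) : Mul (SignedPerm n) :=
  ⟨fun w z => ⟨w.perm * z.perm, fun i => z.sgn i * w.sgn (z.perm i)⟩⟩

instance (n : ℕ) : One (SignedPerm n) := ⟨⟨1, 1⟩⟩

instance (n : ℕ) : Inv (SignedPerm n) := ⟨fun w => ⟨w.perm⁻¹, fun i => w.sgn (w.perm⁻¹ i)⟩⟩

/-- The hyperoctahedral group of rank `n`. -/
instance (n : ℕ) : Group (SignedPerm n) :=
  Group.ofLeftAxioms
    (fun a b c => SignedPerm.ext (mul_assoc a.perm b.perm c.perm)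
      (funext fun i => mul_assoc (c.sgn i) (b.sgn (c.perm i)) (a.sgn (b.perm (c.perm i))) |>.symm))
    (fun a => SignedPerm.ext (one_mul a.perm) (funext fun i => mul_one (a.sgn i)))
    (fun a => SignedPerm.ext (inv_mul_cancel a.perm) (funext fun i => by
      change a.sgn i * a.sgn (a.perm⁻¹ (a.perm i)) = 1
      rw [Equiv.Perm.inv_def, Equiv.symm_apply_apply]
      exact Int.units_mul_self _))

def equivProd (n : ℕ) : SignedPerm n ≃ Equiv.Perm (Fin n) × (Fin n → ℤˣ) where
  toFun w := (w.perm, w.sgn)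
  invFun p := ⟨p.1, p.2⟩
  left_inv _ := rfl
  right_inv _ := rfl

instance (n : ℕ) : Fintype (SignedPerm n) := Fintype.ofEquiv _ (equivProd n).symm

/-- The product of all signs. -/
def signHom (n : ℕ) : SignedPerm n →* ℤˣ where
  toFun w := ∏ i, w.sgn i
  map_one' := Finset.prod_const_one
  map_mul' w z := by
    change ∏ i, z.sgn i * w.sgn (z.perm i) = _
    rw [Finset.prod_mul_distrib, Equiv.prod_comp z.perm w.sgn, mul_comm]

/-- The window notation `w(1) ⋯ w(n)`. -/
def window {n : ℕ} (w : SignedPerm n) : List ℤ :=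
  List.ofFn (fun i => (w.sgn i : ℤ) * (((w.perm i : ℕ) : ℤ) + 1))

/-- The element `[-1, 2, …, n]` (for `n ≥ 1`). -/
def s0B (n : ℕ) : SignedPerm n := ⟨1, fun i => if (i : ℕ) = 0 then -1 else 1⟩

/-- The element `u × v = [u(1), …, u(m), m + v(1), …, m + v(n)]`. -/
def times {m n : ℕ} (u : SignedPerm m) (v : Equiv.Perm (Fin n)) : SignedPerm (m + n) :=
  ⟨finSumFinEquiv.permCongr (Equiv.sumCongr u.perm v), Fin.append u.sgn (fun _ => 1)⟩

/-- The type D descents: all `0 ≤ i < n` with `w(i) > w(i+1)`, where `w(0) = -w(2)`. -/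
def desD {n : ℕ} (w : SignedPerm n) : Finset ℕ :=
  (Finset.range n).filter fun i =>
    (-(w.window.getD 1 0) :: w.window).getD (i + 1) 0
      < (-(w.window.getD 1 0) :: w.window).getD i 0

end SignedPerm

/-- The group of type `D_n`: signed permutations with an even number of negative entries. -/
def groupD (n : ℕ) : Subgroup (SignedPerm n) := (SignedPerm.signHom n).ker

/-- The one-line notation `w(1) ⋯ w(n)`. -/
def oneLine {n : ℕ} (w : Equiv.Perm (Fin n)) : List ℤ :=
  List.ofFn (fun i => ((w i : ℕ) : ℤ) + 1)

/-- The type A descents: all `1 ≤ i < n` with `w(i) > w(i+1)`. -/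
def desA {n : ℕ} (w : Equiv.Perm (Fin n)) : Finset ℕ :=
  (Finset.Ico 1 n).filter fun i => (oneLine w).getD i 0 < (oneLine w).getD (i - 1) 0

/-- The subword of the letters with absolute value in `[i, j]`. -/
def subword (a : List ℤ) (i j : ℕ) : List ℤ :=
  a.filter fun x => decide (i ≤ x.natAbs ∧ x.natAbs ≤ j)

/-- The word `â`: the negated negative letters, read from right to left, then the others. -/
def hat (a : List ℤ) : List ℤ :=
  ((a.filter fun x => decide (x < 0)).reverse.map fun x => -x) ++
    a.filter fun x => decide (0 ≤ x)

/-- Basis elements in type A: permutations of `[n]` for all `n ≥ 0`. -/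
abbrev PermA : Type := Σ n : ℕ, Equiv.Perm (Fin n)

/-- All signed permutations. -/
abbrev PermB : Type := Σ n : ℕ, SignedPerm n

/-- Basis elements in type D: the elements of the groups of type `D_n` for all `n ≥ 2`. -/
abbrev PermD : Type := {w : PermB // 2 ≤ w.1 ∧ w.2 ∈ groupD w.1}

/-- Standardization: number the letters from smallest to largest, ties from left to right
(`Tuple.sort` is the stable sort, so that it lists the positions in this order). -/
def st (a : List ℤ) : PermA := ⟨a.length, (Tuple.sort a.get)⁻¹⟩

/-- Signed standardization: number the letters by increasing absolute value, breaking ties first from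
right to left among the negative letters and then from left to right among the others; keep the
positions of the negative signs. -/
def stB (a : List ℤ) : PermB :=
  ⟨a.length,
    ⟨(Tuple.sort fun i : Fin a.length =>
        toLex (|a.get i|, if a.get i < 0 then -((i : ℕ) : ℤ) - 1 else ((i : ℕ) : ℤ)))⁻¹,
      fun i => if a.get i < 0 then -1 else 1⟩⟩

/-- The type D standardization that corrects the parity by left multiplication with `s0B`. -/
def leftStD (a : List ℤ) : PermB :=
  open Classical in
  if (stB a).2 ∈ groupD (stB a).1 then stB a
  else ⟨(stB a).1, SignedPerm.s0B (stB a).1 * (stB a).2⟩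

/-- The type D standardization that corrects the parity by right multiplication with `s0B`. -/
def rightStD (a : List ℤ) : PermB :=
  open Classical in
  if (stB a).2 ∈ groupD (stB a).1 then stB a
  else ⟨(stB a).1, (stB a).2 * SignedPerm.s0B (stB a).1⟩

/-! ### The Malvenuto–Reutenauer algebra and its type D analogue -/

abbrev ZA : Type := PermA →₀ ℤ
abbrev ZD : Type := PermD →₀ ℤ

def basisA (w : PermA) : ZA := Finsupp.single w 1

/-- The basis vector of an element of a group of type `D_n` with `n ≥ 2`
(the value `0` for other signed permutations is never used). -/
def basisD (w : PermB) : ZD :=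
  open Classical in if h : 2 ≤ w.1 ∧ w.2 ∈ groupD w.1 then Finsupp.single ⟨w, h⟩ 1 else 0

def shuffleA (u v : PermA) : ZA :=
  open Classical in
  ∑ w : Equiv.Perm (Fin (u.1 + v.1)) with
    subword (oneLine w) 1 u.1 = oneLine u.2 ∧ st (subword (oneLine w) (u.1 + 1) (u.1 + v.1)) = v,
    basisA ⟨u.1 + v.1, w⟩

def unshuffleA (u : PermA) : ZA ⊗[ℤ] ZA :=
  ∑ i ∈ Finset.range (u.1 + 1),
    basisA (st ((oneLine u.2).take i)) ⊗ₜ[ℤ] basisA (st ((oneLine u.2).drop i))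

def cupA (u v : PermA) : ZA :=
  open Classical in
  ∑ w : Equiv.Perm (Fin (u.1 + v.1)) with
    st ((oneLine w).take u.1) = u ∧ st ((oneLine w).drop u.1) = v,
    basisA ⟨u.1 + v.1, w⟩

/-- The subword of `u` with letters `1, …, i` is already standard. -/
def capA (u : PermA) : ZA ⊗[ℤ] ZA :=
  ∑ i ∈ Finset.range (u.1 + 1),
    basisA (st (subword (oneLine u.2) 1 i)) ⊗ₜ[ℤ] basisA (st (subword (oneLine u.2) (i + 1) u.1))

def emptyPerm : ZA := basisA ⟨0, 1⟩

/-- The coefficient of the empty permutation. -/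
def counitA : ZA →ₗ[ℤ] ℤ := Finsupp.lapply ⟨0, 1⟩

def hopfShuffle : HopfOps ℤ ZA where
  mul := bilin shuffleA
  one := emptyPerm
  comul := Finsupp.linearCombination ℤ unshuffleA
  counit := counitA

def hopfCup : HopfOps ℤ ZA where
  mul := bilin cupA
  one := emptyPerm
  comul := Finsupp.linearCombination ℤ capA
  counit := counitA

def shuffleD (u : PermD) (v : PermA) : ZD :=
  open Classical in
  ∑ w : SignedPerm (u.1.1 + v.1) with w ∈ groupD (u.1.1 + v.1) ∧
    rightStD (subword w.window 1 u.1.1) = u.1 ∧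
    st (subword (hat w.window) (u.1.1 + 1) (u.1.1 + v.1)) = v,
    basisD ⟨u.1.1 + v.1, w⟩

def unshuffleD (u : PermD) : ZD ⊗[ℤ] ZA :=
  ∑ i ∈ Finset.Icc 2 u.1.1,
    basisD (leftStD (u.1.2.window.take i)) ⊗ₜ[ℤ] basisA (st (u.1.2.window.drop i))

def cupD (u : PermD) (v : PermA) : ZD :=
  open Classical in
  ∑ w : SignedPerm (u.1.1 + v.1) with w ∈ groupD (u.1.1 + v.1) ∧
    leftStD (w.window.take u.1.1) = u.1 ∧ st (w.window.drop u.1.1) = v,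
    basisD ⟨u.1.1 + v.1, w⟩

def capD (u : PermD) : ZD ⊗[ℤ] ZA :=
  ∑ i ∈ Finset.Icc 2 u.1.1,
    basisD (rightStD (subword u.1.2.window 1 i)) ⊗ₜ[ℤ]
      basisA (st (subword (hat u.1.2.window) (i + 1) u.1.1))

def modShuffle : ModComodOps ℤ ZA ZD where
  act := bilin shuffleD
  coact := Finsupp.linearCombination ℤ unshuffleD

def modCup : ModComodOps ℤ ZA ZD where
  act := bilin cupD
  coact := Finsupp.linearCombination ℤ capD

/-! ### Descent classes and the four corners of the diamond -/

/-- The data that the constructions below use, shared by types A and D. -/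
class DescentFamily (X : Type) where
  deg : X → ℕ
  invt : X → X
  des : X → Finset ℕ
  finite_deg : ∀ n, {x | deg x = n}.Finite

instance : DescentFamily PermA where
  deg w := w.1
  invt w := ⟨w.1, w.2⁻¹⟩
  des w := desA w.2
  finite_deg n := (Set.finite_range (Sigma.mk n)).subset (by
    rintro ⟨m, w⟩ rfl
    exact ⟨w, rfl⟩)

instance : DescentFamily PermD where
  deg w := w.1.1
  invt w := ⟨⟨w.1.1, w.1.2⁻¹⟩, w.2.1, inv_mem w.2.2⟩
  des w := w.1.2.desD
  finite_deg n := Set.Finite.of_finite_image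
    ((Set.finite_range (Sigma.mk (β := SignedPerm) n)).subset (by
      rintro _ ⟨⟨⟨m, w⟩, h⟩, rfl, rfl⟩
      exact ⟨w, rfl⟩)) Subtype.val_injective.injOn

section Diamond

open DescentFamily

variable (X : Type) [DescentFamily X]

/-- The degree `n` part of the free module on `X`. -/
def freeGr (n : ℕ) : Submodule ℤ (X →₀ ℤ) := Finsupp.supported ℤ ℤ {x | deg x = n}

/-- The linear extension of `w ↦ w⁻¹`. -/
def invLin : (X →₀ ℤ) →ₗ[ℤ] (X →₀ ℤ) := Finsupp.lmapDomain ℤ ℤ invt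

/-- The form `⟨u, v⟩' = ⟨u⁻¹, v⟩ = δ_{u⁻¹,v}`. -/
def kronInv : (X →₀ ℤ) →ₗ[ℤ] (X →₀ ℤ) →ₗ[ℤ] ℤ := (kron X).comp (invLin X)

/-- The sum of all `w` of degree `n` with descent set `I`. -/
def desClass (n : ℕ) (I : Finset ℕ) : X →₀ ℤ :=
  ∑ w ∈ (finite_deg (X := X) n).toFinset with des w = I, Finsupp.single w 1

/-- `Σ(X)`: the span of the descent classes. -/
def DesAlg : Submodule ℤ (X →₀ ℤ) :=
  Submodule.span ℤ (Set.range fun p : ℕ × Finset ℕ => desClass X p.1 p.2)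

def desGr (n : ℕ) : Submodule ℤ (DesAlg X) := (freeGr X n).comap (DesAlg X).subtype

/-- `Σ*(X)`: the graded dual of `Σ(X)`, i.e. the functionals that vanish in all large degrees. -/
def DesDual : Submodule ℤ (Module.Dual ℤ (DesAlg X)) where
  carrier := {φ | ∃ N, ∀ n, N ≤ n → ∀ x ∈ desGr X n, φ x = 0}
  zero_mem' := ⟨0, fun _ _ _ _ => rfl⟩
  add_mem' := by
    rintro φ ψ ⟨N, hN⟩ ⟨N', hN'⟩
    refine ⟨max N N', fun n hn x hx => ?_⟩
    rw [LinearMap.add_apply, hN n (le_of_max_le_left hn) x hx,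
      hN' n (le_of_max_le_right hn) x hx, add_zero]
  smul_mem' := by
    rintro c φ ⟨N, hN⟩
    refine ⟨N, fun n hn x hx => ?_⟩
    rw [LinearMap.smul_apply, hN n hn x hx, smul_zero]

/-- The degree `n` part of `Σ*(X)`: the functionals that vanish in all other degrees. -/
def dualGr (n : ℕ) : Submodule ℤ (DesDual X) where
  carrier := {φ | ∀ m, m ≠ n → ∀ x ∈ desGr X m, φ.1 x = 0}
  zero_mem' := fun _ _ _ _ => rfl
  add_mem' := by
    intro φ ψ hφ hψ m hm x hx
    change φ.1 x + ψ.1 x = 0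
    rw [hφ m hm x hx, hψ m hm x hx, add_zero]
  smul_mem' := by
    intro c φ hφ m hm x hx
    change c • φ.1 x = 0
    rw [hφ m hm x hx, smul_zero]

/-- The evaluation pairing between `Σ(X)` and `Σ*(X)`. -/
def evalPairing : DesAlg X →ₗ[ℤ] DesDual X →ₗ[ℤ] ℤ := (DesDual X).subtype.flip

/-- `χ(f) = (x ↦ ⟨x, f⟩)`, as a map to the full dual. -/
def chiFull : (X →₀ ℤ) →ₗ[ℤ] Module.Dual ℤ (DesAlg X) :=
  (LinearMap.lcomp ℤ ℤ (DesAlg X).subtype).comp (kron X).flip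

theorem chiFull_mem (f : X →₀ ℤ) : chiFull X f ∈ DesDual X := by
  induction f using Finsupp.induction_linear with
  | zero => rw [map_zero]; exact zero_mem _
  | add f g hf hg => rw [map_add]; exact add_mem hf hg
  | single w c =>
    refine ⟨deg w + 1, fun n hn x hx => ?_⟩
    change kron X x.1 (Finsupp.single w c) = 0
    rw [kron_single]
    have hx' : x.1 ∈ Finsupp.supported ℤ ℤ {x : X | deg x = n} := hx
    have : x.1 w = 0 := by
      by_contra h
      have hw : deg w = n := hx' (Finsupp.mem_support_iff.mpr h)
      omega
    rw [this, mul_zero]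

/-- The map `χ` to `Σ*(X)` that is dual to the inclusion of `Σ(X)`. It sends `w` to the functional
that maps a descent class to `1` if it contains `w` and to `0` otherwise. -/
def chi : (X →₀ ℤ) →ₗ[ℤ] DesDual X := (chiFull X).codRestrict (DesDual X) (chiFull_mem X)

/-- `χ'(w) = χ(w⁻¹)`. -/
def chi' : (X →₀ ℤ) →ₗ[ℤ] DesDual X := (chi X).comp (invLin X)

/-- `Λ(X) = χ'(Σ(X))`. -/
def Lam : Submodule ℤ (DesDual X) := (DesAlg X).map (chi' X)

def lamGr (n : ℕ) : Submodule ℤ (Lam X) := (dualGr X n).comap (Lam X).subtype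

/-- The map `χ'` from `Σ(X)` onto `Λ(X)`. -/
def chiLam : DesAlg X →ₗ[ℤ] Lam X := (chi' X).submoduleMap (DesAlg X)

/-- The element `χ'(D_I)` of `Λ(X)`, in degree `n`. -/
def lamElt (n : ℕ) (I : Finset ℕ) : Lam X :=
  chiLam X ⟨desClass X n I, Submodule.subset_span ⟨(n, I), rfl⟩⟩

/-- The form `b` on `Λ(X)` is symmetric and given by counting the `w` with
`D(w⁻¹) = I` and `D(w) = J`. -/
structure IsLamForm (b : Lam X →ₗ[ℤ] Lam X →ₗ[ℤ] ℤ) : Prop where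
  apply_same : ∀ n I J, b (lamElt X n I) (lamElt X n J)
    = (Set.ncard {w : X | deg w = n ∧ des (invt w) = I ∧ des w = J} : ℤ)
  apply_ne : ∀ m n I J, m ≠ n → b (lamElt X m I) (lamElt X n J) = 0
  symm : ∀ x y, b x y = b y x

end Diamond

end

/-! Everything rests on cutting a (signed) permutation at a position and standardizing both halves.
The cuts of `w` form a coproduct. The sum of all `w` that can be cut into `u` and `v` is a product,
namely the transpose of that coproduct. Associativity and coassociativity only use that nested cuts
can be made in either order. Cutting by values instead of positions is cutting the inverse, so
conjugation with `w ↦ w⁻¹` gives the remaining product and coproduct. Duality and the isomorphism of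
the two structures are then formal, because inversion is self-adjoint for the form `δ_{u,v}`. The
axioms `IsCut` record what is used; they hold for `cutA` and `cutD`.

Standardizations are controlled by order patterns, with signed permutations viewed as odd functions.
A permutation is determined by the comparisons of its letters. An element of the group of type D is
determined by the comparisons of `w(a)` and `w(b)` for signed positions with `|a| ≠ |b|`
(`SameD.eq`): these leave only a left factor `s0B` undetermined, which the parity excludes. Left
type D standardization picks the element of type D with the given comparisons.

The descents of the halves of a cut are determined by the descents of `w`. Hence `Σ` is closed under
gluing, and the coproduct passes to the quotient `Σ*`. That the coproduct preserves `Σ` requires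
more: the number of terms with a given descent set in the shuffle product of `u` and `v` must depend
only on the descents of `u` and `v`. Such a term is `(u × v) z⁻¹` with `z` increasing on both parts,
and it is exchanged for `(u' × v') z⁻¹`. Positions at which `z` takes neighbouring values are either
neighbours in one block, where the descents of the two factors decide, or are compared independently
of the factors (`IsMinRep.lt_iff`). The same factorization gives the parabolic embedding.

Antipodes come for free in connected graded bialgebras, by a geometric series. The one remaining
bialgebra axiom, compatibility of product and coproduct in type A, holds since cutting shuffles of
words is shuffling cuts (`shuffleSum_cutSum`). The corners of the diamond are a subobject `Σ`, a
quotient `Σ*` and the image `Λ` of the composite; axioms and dualities are transferred along the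
maps. The form on `Λ` is well defined because `⟨u⁻¹, v⟩` is symmetric. -/

open scoped TensorProduct
noncomputable section

/-! ### Graded modules, antipodes, transfer of structure, and duality. -/

section GradedAlgebra

variable {R A B M N A' B' M' N' : Type} [CommRing R]
  [AddCommGroup A] [Module R A] [AddCommGroup B] [Module R B]
  [AddCommGroup M] [Module R M] [AddCommGroup N] [Module R N]
  [AddCommGroup A'] [Module R A'] [AddCommGroup B'] [Module R B']
  [AddCommGroup M'] [Module R M'] [AddCommGroup N'] [Module R N']

/-! ### Tensor products of graded modules -/

theorem tmul_mem_tensorGr {ℳ : ℕ → Submodule R M} {𝒜 : ℕ → Submodule R A} {p q n : ℕ}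
    (h : p + q = n) {x : M} (hx : x ∈ ℳ p) {a : A} (ha : a ∈ 𝒜 q) :
    x ⊗ₜ[R] a ∈ tensorGr ℳ 𝒜 n :=
  Submodule.mem_iSup_of_mem (p, q) (Submodule.mem_iSup_of_mem
    (Finset.HasAntidiagonal.mem_antidiagonal.mpr h) ⟨(⟨x, hx⟩ : ℳ p) ⊗ₜ[R] (⟨a, ha⟩ : 𝒜 q), rfl⟩)

theorem tensorGr_le {ℳ : ℕ → Submodule R M} {𝒜 : ℕ → Submodule R A} {n : ℕ}
    {T : Submodule R (M ⊗[R] A)}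
    (h : ∀ p q, p + q = n → ∀ x ∈ ℳ p, ∀ a ∈ 𝒜 q, x ⊗ₜ[R] a ∈ T) : tensorGr ℳ 𝒜 n ≤ T := by
  refine iSup₂_le fun p hp => ?_
  rintro _ ⟨t, rfl⟩
  induction t using TensorProduct.induction_on with
  | zero => simp
  | tmul x a => exact h _ _ (Finset.HasAntidiagonal.mem_antidiagonal.mp hp) _ x.2 _ a.2
  | add s t hs ht => rw [map_add]; exact add_mem hs ht

theorem eq_on_tensorGr {ℳ : ℕ → Submodule R M} {𝒜 : ℕ → Submodule R A} {n : ℕ}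
    {F G : M ⊗[R] A →ₗ[R] N}
    (h : ∀ p q, p + q = n → ∀ x ∈ ℳ p, ∀ a ∈ 𝒜 q, F (x ⊗ₜ[R] a) = G (x ⊗ₜ[R] a))
    {t : M ⊗[R] A} (ht : t ∈ tensorGr ℳ 𝒜 n) : F t = G t :=
  tensorGr_le (T := LinearMap.eqLocus F G) h ht

theorem map_mem_tensorGr {ℳ : ℕ → Submodule R M} {𝒜 : ℕ → Submodule R A}
    {𝒩 : ℕ → Submodule R N} {ℬ : ℕ → Submodule R B} {f : M →ₗ[R] N} {φ : A →ₗ[R] B}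
    (hf : ∀ n, ∀ x ∈ ℳ n, f x ∈ 𝒩 n) (hφ : ∀ n, ∀ a ∈ 𝒜 n, φ a ∈ ℬ n) {n : ℕ}
    {t : M ⊗[R] A} (ht : t ∈ tensorGr ℳ 𝒜 n) : TensorProduct.map f φ t ∈ tensorGr 𝒩 ℬ n :=
  tensorGr_le (T := (tensorGr 𝒩 ℬ n).comap (TensorProduct.map f φ))
    (fun p q h x hx a ha => tmul_mem_tensorGr h (hf p x hx) (hφ q a ha)) ht

/-! ### Internal gradings -/

/-- An element of degree `n` that is also a sum of elements of other degrees is killed by `π n`,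
hence zero. The `π n` need not be projections, so evaluation on one degree can serve for dual
modules. -/
theorem isInternal_of_detect {ℳ : ℕ → Submodule R M} (htop : ⨆ n, ℳ n = ⊤)
    (π : ∀ n : ℕ, M →ₗ[R] N) (hinj : ∀ n, ∀ x ∈ ℳ n, π n x = 0 → x = 0)
    (hne : ∀ m n, m ≠ n → ∀ x ∈ ℳ m, π n x = 0) : DirectSum.IsInternal ℳ := by
  refine DirectSum.isInternal_submodule_of_iSupIndep_of_iSup_eq_top (fun n => ?_) htop
  rw [Submodule.disjoint_def]
  intro x hx hx'
  refine hinj n x hx ?_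
  have : ⨆ m, ⨆ (_ : m ≠ n), ℳ m ≤ LinearMap.ker (π n) :=
    iSup₂_le fun m hm y hy => hne m n hm y hy
  exact this hx'

/-- A preimage splits into its degree `n` component and a rest. The image of the rest lies both in
degree `n` and in the sum of the other degrees, so it vanishes and the component alone is a
preimage. -/
theorem exists_mem_of_map_mem {ℳ : ℕ → Submodule R M} {𝒩 : ℕ → Submodule R N}
    (hM : DirectSum.IsInternal ℳ) (hN : DirectSum.IsInternal 𝒩) {f : M →ₗ[R] N}
    (hf : ∀ n, ∀ x ∈ ℳ n, f x ∈ 𝒩 n) (hsurj : Function.Surjective f) (n : ℕ) :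
    ∀ y ∈ 𝒩 n, ∃ x ∈ ℳ n, f x = y := by
  intro y hy
  obtain ⟨x, rfl⟩ := hsurj y
  have hx : x ∈ ℳ n ⊔ ⨆ m, ⨆ (_ : m ≠ n), ℳ m := by
    rw [← iSup_split_single ℳ n, hM.submodule_iSup_eq_top]
    trivial
  obtain ⟨a, ha, b, hb, rfl⟩ := Submodule.mem_sup.mp hx
  refine ⟨a, ha, ?_⟩
  have hb' : f b ∈ ⨆ m, ⨆ (_ : m ≠ n), 𝒩 m := by
    have : ⨆ m, ⨆ (_ : m ≠ n), ℳ m ≤ (⨆ m, ⨆ (_ : m ≠ n), 𝒩 m).comap f :=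
      iSup₂_le fun m hm z hz => Submodule.mem_iSup_of_mem m
        (Submodule.mem_iSup_of_mem hm (hf m z hz))
    exact this hb
  have hb'' : f b ∈ 𝒩 n := by
    have := sub_mem hy (hf n a ha)
    rwa [map_add, add_sub_cancel_left] at this
  have h0 := Submodule.disjoint_def.mp (hN.submodule_iSupIndep n) _ hb'' hb'
  rw [map_add, h0, add_zero]

/-! ### Antipodes of connected graded bialgebras -/

/-- The action and the coaction of a Hopf algebra on itself. -/
def HopfOps.self (H : HopfOps R A) : ModComodOps R A A := ⟨H.mul, H.comul⟩

/-- Connected graded bialgebras. -/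
structure IsConnectedBialgebra (𝒜 : ℕ → Submodule R A) (H : HopfOps R A) : Prop where
  self : IsGradedModComod 𝒜 𝒜 H H.self
  one_mul : ∀ a, H.mul H.one a = a
  counit_left : ∀ a,
    TensorProduct.lid R A (TensorProduct.map H.counit LinearMap.id (H.comul a)) = a
  comul_mul : ∀ a b, H.comul (H.mul a b)
    = TensorProduct.map₂ H.mul H.mul (H.comul a) (H.comul b)
  comul_one : H.comul H.one = H.one ⊗ₜ[R] H.one
  counit_mul : ∀ a b, H.counit (H.mul a b) = H.counit a * H.counit b
  counit_one : H.counit H.one = 1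
  one_mem : H.one ∈ 𝒜 0
  counit_eq_zero : ∀ n, n ≠ 0 → ∀ a ∈ 𝒜 n, H.counit a = 0
  -- Replaces the antipode: connectedness passes readily to graded subobjects and quotients, and it
  -- forces an antipode by `exists_antipode`.
  connected : ∀ a ∈ 𝒜 0, a = H.counit a • H.one

namespace HopfOps

/-- The convolution product of endomorphisms. -/
def convolve (H : HopfOps R A) (f g : A →ₗ[R] A) : A →ₗ[R] A :=
  (TensorProduct.lift H.mul).comp ((TensorProduct.map f g).comp H.comul)

/-- The unit of the convolution product. -/
def convUnit (H : HopfOps R A) : A →ₗ[R] A := H.counit.smulRight H.one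

/-- The powers of `convUnit - id`. -/
def convPow (H : HopfOps R A) : ℕ → A →ₗ[R] A
  | 0 => H.convUnit
  | k + 1 => H.convolve (H.convUnit - LinearMap.id) (H.convPow k)

end HopfOps

namespace IsConnectedBialgebra

variable {𝒜 : ℕ → Submodule R A} {H : HopfOps R A}

/-- Both bracketings apply one triple product, after `f`, `g` and `k`, to the two sides of
coassociativity. -/
theorem convolve_assoc (h : IsConnectedBialgebra 𝒜 H) (f g k : A →ₗ[R] A) :
    H.convolve (H.convolve f g) k = H.convolve f (H.convolve g k) := by
  ext a
  let T : A ⊗[R] (A ⊗[R] A) →ₗ[R] A := (TensorProduct.lift H.mul).comp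
    (TensorProduct.map f ((TensorProduct.lift H.mul).comp (TensorProduct.map g k)))
  have h1 : ∀ t : A ⊗[R] A, TensorProduct.lift H.mul (TensorProduct.map (H.convolve f g) k t)
      = T (TensorProduct.assoc R A A A (TensorProduct.map H.comul LinearMap.id t)) := by
    intro t
    induction t using TensorProduct.induction_on with
    | zero => simp
    | add s t hs ht => simp only [map_add, hs, ht]
    | tmul x y =>
      simp only [TensorProduct.map_tmul, TensorProduct.lift.tmul, HopfOps.convolve,
        LinearMap.comp_apply, LinearMap.id_apply]
      generalize H.comul x = s
      induction s using TensorProduct.induction_on with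
      | zero => simp
      | add s t hs ht => simp only [map_add, LinearMap.add_apply, TensorProduct.add_tmul, hs, ht]
      | tmul x x' => exact h.self.act_act (f x) (g x') (k y)
  have h2 : ∀ t : A ⊗[R] A, TensorProduct.lift H.mul (TensorProduct.map f (H.convolve g k) t)
      = T (TensorProduct.map LinearMap.id H.comul t) := by
    intro t
    induction t using TensorProduct.induction_on with
    | zero => simp
    | add s t hs ht => simp only [map_add, hs, ht]
    | tmul x y => rfl
  change TensorProduct.lift H.mul (TensorProduct.map (H.convolve f g) k (H.comul a))
    = TensorProduct.lift H.mul (TensorProduct.map f (H.convolve g k) (H.comul a))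
  rw [h1, h2]
  exact congrArg T (h.self.coassoc a)

theorem convUnit_convolve (h : IsConnectedBialgebra 𝒜 H) (f : A →ₗ[R] A) :
    H.convolve H.convUnit f = f := by
  ext a
  have : ∀ t : A ⊗[R] A, TensorProduct.lift H.mul (TensorProduct.map H.convUnit f t)
      = f (TensorProduct.lid R A (TensorProduct.map H.counit LinearMap.id t)) := by
    intro t
    induction t using TensorProduct.induction_on with
    | zero => simp
    | add s t hs ht => simp only [map_add, hs, ht]
    | tmul x y => simp [HopfOps.convUnit, h.one_mul]
  exact (this _).trans (congrArg f (h.counit_left a))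

theorem convolve_convUnit (h : IsConnectedBialgebra 𝒜 H) (f : A →ₗ[R] A) :
    H.convolve f H.convUnit = f := by
  ext a
  have : ∀ t : A ⊗[R] A, TensorProduct.lift H.mul (TensorProduct.map f H.convUnit t)
      = f (TensorProduct.rid R A (TensorProduct.map LinearMap.id H.counit t)) := by
    intro t
    induction t using TensorProduct.induction_on with
    | zero => simp
    | add s t hs ht => simp only [map_add, hs, ht]
    | tmul x y =>
      have h1 := h.self.act_one (f x)
      change H.mul (f x) H.one = f x at h1
      simp [HopfOps.convUnit, h1]
  exact (this _).trans (congrArg f (h.self.counit a))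

theorem convPow_succ' (h : IsConnectedBialgebra 𝒜 H) (k : ℕ) :
    H.convPow (k + 1) = H.convolve (H.convPow k) (H.convUnit - LinearMap.id) := by
  induction k with
  | zero => exact (h.convolve_convUnit _).trans (h.convUnit_convolve _).symm
  | succ k ih =>
    change H.convolve _ (H.convPow (k + 1)) = H.convolve (H.convolve _ (H.convPow k)) _
    rw [h.convolve_assoc, ih]

theorem convUnit_sub_id_eq_zero (h : IsConnectedBialgebra 𝒜 H) {a : A} (ha : a ∈ 𝒜 0) :
    (H.convUnit - (LinearMap.id : A →ₗ[R] A)) a = 0 := by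
  change H.counit a • H.one - a = 0
  rw [← h.connected a ha, sub_self]

/-- `convUnit - id` vanishes in degree zero, so each of the `k` factors of a surviving term has
positive degree; these cannot add up to `n < k`. -/
theorem convPow_eq_zero (h : IsConnectedBialgebra 𝒜 H) (k : ℕ) :
    ∀ n, n < k → ∀ a ∈ 𝒜 n, H.convPow k a = 0 := by
  induction k with
  | zero => intro n hn; omega
  | succ k ih =>
    intro n hn a ha
    refine eq_on_tensorGr (F := (TensorProduct.lift H.mul).comp
      (TensorProduct.map (H.convUnit - LinearMap.id) (H.convPow k))) (G := 0) ?_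
      (h.self.coact_mem n a ha)
    intro p q hpq x hx y hy
    simp only [LinearMap.comp_apply, TensorProduct.map_tmul, TensorProduct.lift.tmul,
      LinearMap.zero_apply]
    rcases Nat.eq_zero_or_pos p with rfl | hp
    · rw [h.convUnit_sub_id_eq_zero hx, map_zero, LinearMap.zero_apply]
    · rw [ih q (by omega) y hy, map_zero]

theorem convPow_mem (h : IsConnectedBialgebra 𝒜 H) (k : ℕ) :
    ∀ n, ∀ a ∈ 𝒜 n, H.convPow k a ∈ 𝒜 n := by
  have h0 : ∀ n, ∀ a ∈ 𝒜 n, H.convUnit a ∈ 𝒜 n := by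
    intro n a ha
    change H.counit a • H.one ∈ 𝒜 n
    rcases Nat.eq_zero_or_pos n with rfl | hn
    · exact Submodule.smul_mem _ _ h.one_mem
    · rw [h.counit_eq_zero n hn.ne' a ha, zero_smul]; exact zero_mem _
  induction k with
  | zero => exact h0
  | succ k ih =>
    intro n a ha
    refine tensorGr_le (T := (𝒜 n).comap ((TensorProduct.lift H.mul).comp
      (TensorProduct.map (H.convUnit - LinearMap.id) (H.convPow k)))) ?_
      (h.self.coact_mem n a ha)
    rintro p q rfl x hx y hy
    exact h.self.act_mem p q _ (sub_mem (h0 p x hx) hx) _ (ih q y hy)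

/-- The antipode is the convolution inverse of the identity. Since `id = convUnit - (convUnit -
id)`, it is the geometric series of the powers `convPow k`, which is finite in each degree by
`convPow_eq_zero`. -/
theorem exists_antipode (h : IsConnectedBialgebra 𝒜 H) :
    ∃ S : A →ₗ[R] A, (∀ n, ∀ a ∈ 𝒜 n, S a ∈ 𝒜 n) ∧
    (∀ a, TensorProduct.lift H.mul (TensorProduct.map S LinearMap.id (H.comul a))
      = H.counit a • H.one) ∧
    (∀ a, TensorProduct.lift H.mul (TensorProduct.map LinearMap.id S (H.comul a))
      = H.counit a • H.one) := by
  let e := LinearEquiv.ofBijective (DirectSum.coeLinearMap 𝒜) h.self.isInternal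
  -- The partial sum `G n` already computes the whole series in degrees up to `n`, and `S` is
  -- assembled from the `G n` degree by degree.
  let G : ℕ → A →ₗ[R] A := fun n => ∑ k ∈ Finset.range (n + 1), H.convPow k
  let S : A →ₗ[R] A :=
    (DirectSum.toModule R ℕ A fun n => (G n).comp (𝒜 n).subtype).comp e.symm.toLinearMap
  have hG : ∀ m n, n ≤ m → ∀ a ∈ 𝒜 n, G m a = G n a := by
    intro m n hmn a ha
    simp only [G, LinearMap.sum_apply]
    refine (Finset.sum_subset (Finset.range_mono (by omega)) fun k _ hk => ?_).symm
    exact h.convPow_eq_zero k n (by simpa using hk) a ha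
  have hS : ∀ m n, n ≤ m → ∀ a ∈ 𝒜 n, S a = G m a := by
    intro m n hmn a ha
    have : e.symm a = DirectSum.lof R ℕ (fun n => 𝒜 n) n ⟨a, ha⟩ := by
      rw [LinearEquiv.symm_apply_eq]
      exact (DirectSum.coeLinearMap_lof 𝒜 n ⟨a, ha⟩).symm
    rw [hG m n hmn a ha]
    simp only [S, LinearMap.comp_apply, LinearEquiv.coe_coe, this, DirectSum.toModule_lof]
    rfl
  have hmem : ∀ n, ∀ a ∈ 𝒜 n, S a ∈ 𝒜 n := by
    intro n a ha
    rw [hS n n le_rfl a ha]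
    simp only [G, LinearMap.sum_apply]
    exact sum_mem fun k _ => h.convPow_mem k n a ha
  have hid : (LinearMap.id : A →ₗ[R] A) = H.convUnit - (H.convUnit - LinearMap.id) := by abel
  have hadd : ∀ f f' g : A →ₗ[R] A, H.convolve (f + f') g = H.convolve f g + H.convolve f' g :=
    fun f f' g => by
      ext a; simp [HopfOps.convolve, TensorProduct.map_add_left]
  have hadd' : ∀ f g g' : A →ₗ[R] A, H.convolve f (g + g') = H.convolve f g + H.convolve f g' :=
    fun f f' g => by
      ext a; simp [HopfOps.convolve, TensorProduct.map_add_right]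
  -- Telescoping: `convPow k` convolved with `id` is `convPow k - convPow (k + 1)`. The last term
  -- vanishes in degree `n`.
  have hl : ∀ n, H.convolve (G n) LinearMap.id = H.convUnit - H.convPow (n + 1) := by
    intro n
    have hk : ∀ k, H.convolve (H.convPow k) LinearMap.id = H.convPow k - H.convPow (k + 1) := by
      intro k
      rw [h.convPow_succ', eq_sub_iff_add_eq, ← hadd', add_sub_cancel, h.convolve_convUnit]
    induction n with
    | zero => simp [G, hk]; rfl
    | succ n ih =>
      have : G (n + 1) = G n + H.convPow (n + 1) := Finset.sum_range_succ _ _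
      rw [this, hadd, ih, hk]; abel
  have hr : ∀ n, H.convolve LinearMap.id (G n) = H.convUnit - H.convPow (n + 1) := by
    intro n
    have hk : ∀ k, H.convolve LinearMap.id (H.convPow k) = H.convPow k - H.convPow (k + 1) := by
      intro k
      rw [HopfOps.convPow, eq_sub_iff_add_eq, ← hadd, add_sub_cancel, h.convUnit_convolve]
    induction n with
    | zero => simp [G, hk]; rfl
    | succ n ih =>
      have : G (n + 1) = G n + H.convPow (n + 1) := Finset.sum_range_succ _ _
      rw [this, hadd', ih, hk]; abel
  have hl' : H.convolve S LinearMap.id = H.convUnit := by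
    refine LinearMap.ext_on (s := ⋃ n, (𝒜 n : Set A)) ?_ ?_
    · rw [Submodule.span_iUnion]
      simpa using h.self.isInternal.submodule_iSup_eq_top
    · intro a ha
      obtain ⟨n, ha⟩ := Set.mem_iUnion.mp ha
      have h1 : H.convolve S LinearMap.id a = H.convolve (G n) LinearMap.id a :=
        congrArg (TensorProduct.lift H.mul) (eq_on_tensorGr (F := TensorProduct.map S LinearMap.id)
          (G := TensorProduct.map (G n) LinearMap.id) (fun p q hpq x hx y hy => by
          simp only [TensorProduct.map_tmul, hS n p (by omega) x hx])
          (h.self.coact_mem n a ha))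
      rw [h1, hl, LinearMap.sub_apply, h.convPow_eq_zero (n + 1) n (by omega) a ha, sub_zero]
  have hr' : H.convolve LinearMap.id S = H.convUnit := by
    refine LinearMap.ext_on (s := ⋃ n, (𝒜 n : Set A)) ?_ ?_
    · rw [Submodule.span_iUnion]
      simpa using h.self.isInternal.submodule_iSup_eq_top
    · intro a ha
      obtain ⟨n, ha⟩ := Set.mem_iUnion.mp ha
      have h1 : H.convolve LinearMap.id S a = H.convolve LinearMap.id (G n) a :=
        congrArg (TensorProduct.lift H.mul) (eq_on_tensorGr (F := TensorProduct.map LinearMap.id S)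
          (G := TensorProduct.map LinearMap.id (G n)) (fun p q hpq x hx y hy => by
          simp only [TensorProduct.map_tmul, hS n q (by omega) y hy])
          (h.self.coact_mem n a ha))
      rw [h1, hr, LinearMap.sub_apply, h.convPow_eq_zero (n + 1) n (by omega) a ha, sub_zero]
  exact ⟨S, hmem, fun a => LinearMap.congr_fun hl' a, fun a => LinearMap.congr_fun hr' a⟩

theorem isGradedHopf (h : IsConnectedBialgebra 𝒜 H) : IsGradedHopf 𝒜 H where
  isInternal := h.self.isInternal
  mul_assoc := h.self.act_act
  one_mul := h.one_mul
  mul_one := h.self.act_one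
  coassoc := h.self.coassoc
  counit_left := h.counit_left
  counit_right := h.self.counit
  comul_mul := h.comul_mul
  comul_one := h.comul_one
  counit_mul := h.counit_mul
  counit_one := h.counit_one
  mul_mem := h.self.act_mem
  one_mem := h.one_mem
  comul_mem := h.self.coact_mem
  counit_eq_zero := h.counit_eq_zero
  antipode := h.exists_antipode

end IsConnectedBialgebra

/-! ### Transfer along homomorphisms -/

theorem IsHopfHom.self {𝒜 : ℕ → Submodule R A} {ℬ : ℕ → Submodule R B} {H : HopfOps R A}
    {K : HopfOps R B} {φ : A →ₗ[R] B} (h : IsHopfHom 𝒜 ℬ H K φ) :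
    IsModComodHom 𝒜 ℬ H.self K.self φ φ :=
  ⟨h.map_mem, h.map_mul, h.map_comul⟩

section Hom

variable {ℳ : ℕ → Submodule R M} {𝒩 : ℕ → Submodule R N} {𝒜 : ℕ → Submodule R A}
  {ℬ : ℕ → Submodule R B} {X : ModComodOps R A M} {Y : ModComodOps R B N}
  {H : HopfOps R A} {K : HopfOps R B} {φ : A →ₗ[R] B} {f : M →ₗ[R] N}

/-- Together with `map_coassoc_right`, this carries both sides of coassociativity from `M` to `N`.
The axiom can thus be pushed along a surjection and pulled back along an injection. -/
theorem IsModComodHom.map_coassoc_left (hf : IsModComodHom ℳ 𝒩 X Y φ f) (x : M) :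
    TensorProduct.map f (TensorProduct.map φ φ) (TensorProduct.assoc R M A A
      (TensorProduct.map X.coact LinearMap.id (X.coact x)))
    = TensorProduct.assoc R N B B (TensorProduct.map Y.coact LinearMap.id (Y.coact (f x))) := by
  rw [hf.map_coact]
  generalize X.coact x = t
  induction t using TensorProduct.induction_on with
  | zero => simp
  | add s t hs ht => simp only [map_add, hs, ht]
  | tmul x a =>
    simp only [TensorProduct.map_tmul, LinearMap.id_apply, hf.map_coact]
    generalize X.coact x = s
    induction s using TensorProduct.induction_on with
    | zero => simp
    | add s t hs ht => simp only [map_add, TensorProduct.add_tmul, hs, ht]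
    | tmul x x' => simp

theorem IsModComodHom.map_coassoc_right (hf : IsModComodHom ℳ 𝒩 X Y φ f)
    (hφ : ∀ a, K.comul (φ a) = TensorProduct.map φ φ (H.comul a)) (x : M) :
    TensorProduct.map f (TensorProduct.map φ φ)
      (TensorProduct.map LinearMap.id H.comul (X.coact x))
    = TensorProduct.map LinearMap.id K.comul (Y.coact (f x)) := by
  rw [hf.map_coact]
  generalize X.coact x = t
  induction t using TensorProduct.induction_on with
  | zero => simp
  | add s t hs ht => simp only [map_add, hs, ht]
  | tmul x a => simp only [TensorProduct.map_tmul, LinearMap.id_apply, hφ]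

theorem IsModComodHom.map_counit (hf : IsModComodHom ℳ 𝒩 X Y φ f)
    (hφ : ∀ a, K.counit (φ a) = H.counit a) (x : M) :
    f (TensorProduct.rid R M (TensorProduct.map LinearMap.id H.counit (X.coact x)))
    = TensorProduct.rid R N (TensorProduct.map LinearMap.id K.counit (Y.coact (f x))) := by
  rw [hf.map_coact]
  generalize X.coact x = t
  induction t using TensorProduct.induction_on with
  | zero => simp
  | add s t hs ht => simp only [map_add, hs, ht]
  | tmul x a => simp [hφ]

theorem IsHopfHom.map_counit_left (h : IsHopfHom 𝒜 ℬ H K φ) (a : A) :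
    φ (TensorProduct.lid R A (TensorProduct.map H.counit LinearMap.id (H.comul a)))
    = TensorProduct.lid R B (TensorProduct.map K.counit LinearMap.id (K.comul (φ a))) := by
  rw [h.map_comul]
  generalize H.comul a = t
  induction t using TensorProduct.induction_on with
  | zero => simp
  | add s t hs ht => simp only [map_add, hs, ht]
  | tmul x a => simp [h.map_counit]

theorem IsHopfHom.map_comul_mul (h : IsHopfHom 𝒜 ℬ H K φ) (a b : A) :
    TensorProduct.map φ φ (TensorProduct.map₂ H.mul H.mul (H.comul a) (H.comul b))
    = TensorProduct.map₂ K.mul K.mul (K.comul (φ a)) (K.comul (φ b)) := by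
  rw [h.map_comul, h.map_comul]
  generalize H.comul a = s
  generalize H.comul b = t
  induction s using TensorProduct.induction_on with
  | zero => simp
  | add s s' hs hs' => simp only [map_add, LinearMap.add_apply, hs, hs']
  | tmul x x' =>
    induction t using TensorProduct.induction_on with
    | zero => simp
    | add t t' ht ht' => simp only [map_add, ht, ht']
    | tmul y y' => simp [h.map_mul]

/-- The image of a graded module-comodule under a surjective homomorphism. -/
theorem IsGradedModComod.of_surjective (hX : IsGradedModComod 𝒜 ℳ H X)
    (hφ : IsHopfHom 𝒜 ℬ H K φ) (hf : IsModComodHom ℳ 𝒩 X Y φ f)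
    (hφs : Function.Surjective φ) (hfs : Function.Surjective f)
    (hA : DirectSum.IsInternal 𝒜) (hB : DirectSum.IsInternal ℬ)
    (hN : DirectSum.IsInternal 𝒩) : IsGradedModComod ℬ 𝒩 K Y where
  isInternal := hN
  act_one y := by
    obtain ⟨x, rfl⟩ := hfs y
    rw [← hφ.map_one, ← hf.map_act, hX.act_one]
  act_act y b b' := by
    obtain ⟨x, rfl⟩ := hfs y
    obtain ⟨a, rfl⟩ := hφs b
    obtain ⟨a', rfl⟩ := hφs b'
    rw [← hφ.map_mul, ← hf.map_act, ← hf.map_act, ← hf.map_act, hX.act_act]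
  coassoc y := by
    obtain ⟨x, rfl⟩ := hfs y
    rw [← hf.map_coassoc_left, ← hf.map_coassoc_right hφ.map_comul, hX.coassoc]
  counit y := by
    obtain ⟨x, rfl⟩ := hfs y
    rw [← hf.map_counit hφ.map_counit, hX.counit]
  act_mem i j y hy b hb := by
    obtain ⟨x, hx, rfl⟩ := exists_mem_of_map_mem hX.isInternal hN hf.map_mem hfs i y hy
    obtain ⟨a, ha, rfl⟩ := exists_mem_of_map_mem hA hB hφ.map_mem hφs j b hb
    rw [← hf.map_act]
    exact hf.map_mem _ _ (hX.act_mem i j x hx a ha)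
  coact_mem n y hy := by
    obtain ⟨x, hx, rfl⟩ := exists_mem_of_map_mem hX.isInternal hN hf.map_mem hfs n y hy
    rw [hf.map_coact]
    exact map_mem_tensorGr hf.map_mem hφ.map_mem (hX.coact_mem n x hx)

theorem IsConnectedBialgebra.of_surjective (hH : IsConnectedBialgebra 𝒜 H)
    (hφ : IsHopfHom 𝒜 ℬ H K φ) (hφs : Function.Surjective φ) (hB : DirectSum.IsInternal ℬ) :
    IsConnectedBialgebra ℬ K where
  self := hH.self.of_surjective hφ hφ.self hφs hφs hH.self.isInternal hB hB
  one_mul b := by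
    obtain ⟨a, rfl⟩ := hφs b
    rw [← hφ.map_one, ← hφ.map_mul, hH.one_mul]
  counit_left b := by
    obtain ⟨a, rfl⟩ := hφs b
    rw [← hφ.map_counit_left, hH.counit_left]
  comul_mul b b' := by
    obtain ⟨a, rfl⟩ := hφs b
    obtain ⟨a', rfl⟩ := hφs b'
    rw [← hφ.map_comul_mul, ← hφ.map_mul, hφ.map_comul, hH.comul_mul]
  comul_one := by
    rw [← hφ.map_one, hφ.map_comul, hH.comul_one, TensorProduct.map_tmul]
  counit_mul b b' := by
    obtain ⟨a, rfl⟩ := hφs b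
    obtain ⟨a', rfl⟩ := hφs b'
    rw [← hφ.map_mul, hφ.map_counit, hφ.map_counit, hφ.map_counit, hH.counit_mul]
  counit_one := by rw [← hφ.map_one, hφ.map_counit, hH.counit_one]
  one_mem := by rw [← hφ.map_one]; exact hφ.map_mem 0 _ hH.one_mem
  counit_eq_zero n hn b hb := by
    obtain ⟨a, ha, rfl⟩ := exists_mem_of_map_mem hH.self.isInternal hB hφ.map_mem hφs n b hb
    rw [hφ.map_counit, hH.counit_eq_zero n hn a ha]
  connected b hb := by
    obtain ⟨a, ha, rfl⟩ := exists_mem_of_map_mem hH.self.isInternal hB hφ.map_mem hφs 0 b hb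
    rw [hφ.map_counit, ← hφ.map_one, ← map_smul, ← hH.connected a ha]

/-- A submodule that is closed under the operations of a graded module-comodule. -/
theorem IsGradedModComod.of_injective (hY : IsGradedModComod ℬ 𝒩 K Y)
    (hφ : IsHopfHom 𝒜 ℬ H K φ) (hf : IsModComodHom ℳ 𝒩 X Y φ f) (hfi : Function.Injective f)
    -- Coassociativity is an identity in a triple tensor product, so it is pulled back along this
    -- map. The degrees of the coproduct are assumed in `hco`; for descent classes an explicit
    -- formula supplies them.
    (hfi' : Function.Injective (TensorProduct.map f (TensorProduct.map φ φ)))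
    (hM : DirectSum.IsInternal ℳ) (hgr : ∀ n x, f x ∈ 𝒩 n → x ∈ ℳ n)
    (hco : ∀ n, ∀ x ∈ ℳ n, X.coact x ∈ tensorGr ℳ 𝒜 n) : IsGradedModComod 𝒜 ℳ H X where
  isInternal := hM
  act_one x := hfi (by rw [hf.map_act, hφ.map_one, hY.act_one])
  act_act x a a' := hfi (by
    rw [hf.map_act, hf.map_act, hf.map_act, hφ.map_mul, hY.act_act])
  coassoc x := hfi' (by
    rw [hf.map_coassoc_left, hf.map_coassoc_right hφ.map_comul, hY.coassoc])
  counit x := hfi (by rw [hf.map_counit hφ.map_counit, hY.counit])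
  act_mem i j x hx a ha := hgr _ _ (by
    rw [hf.map_act]
    exact hY.act_mem i j _ (hf.map_mem i x hx) _ (hφ.map_mem j a ha))
  coact_mem := hco

theorem IsConnectedBialgebra.of_injective (hK : IsConnectedBialgebra ℬ K)
    (hφ : IsHopfHom 𝒜 ℬ H K φ) (hφi : Function.Injective φ)
    (hφi' : Function.Injective (TensorProduct.map φ φ))
    (hφi'' : Function.Injective (TensorProduct.map φ (TensorProduct.map φ φ)))
    (hA : DirectSum.IsInternal 𝒜) (hgr : ∀ n a, φ a ∈ ℬ n → a ∈ 𝒜 n)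
    (hco : ∀ n, ∀ a ∈ 𝒜 n, H.comul a ∈ tensorGr 𝒜 𝒜 n) : IsConnectedBialgebra 𝒜 H where
  self := hK.self.of_injective hφ hφ.self hφi hφi'' hA hgr hco
  one_mul a := hφi (by rw [hφ.map_mul, hφ.map_one, hK.one_mul])
  counit_left a := hφi (by rw [hφ.map_counit_left, hK.counit_left])
  comul_mul a b := hφi' (by
    rw [hφ.map_comul_mul, ← hφ.map_comul, hφ.map_mul, hK.comul_mul])
  comul_one := hφi' (by
    rw [← hφ.map_comul, hφ.map_one, hK.comul_one, TensorProduct.map_tmul, hφ.map_one])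
  counit_mul a b := by
    rw [← hφ.map_counit, hφ.map_mul, hK.counit_mul, hφ.map_counit, hφ.map_counit]
  counit_one := by rw [← hφ.map_counit, hφ.map_one, hK.counit_one]
  one_mem := hgr _ _ (by rw [hφ.map_one]; exact hK.one_mem)
  counit_eq_zero n hn a ha := by
    rw [← hφ.map_counit, hK.counit_eq_zero n hn _ (hφ.map_mem n a ha)]
  connected a ha := hφi (by
    rw [map_smul, hφ.map_one, ← hφ.map_counit, ← hK.connected _ (hφ.map_mem 0 a ha)])

/-- Operations descend along surjections whose kernels they preserve. -/
theorem exists_ops_of_surjective (X : ModComodOps R A M) (hφs : Function.Surjective φ)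
    (hfs : Function.Surjective f) (h1 : ∀ x a, f x = 0 → f (X.act x a) = 0)
    (h2 : ∀ x a, φ a = 0 → f (X.act x a) = 0)
    (h3 : ∀ x, f x = 0 → TensorProduct.map f φ (X.coact x) = 0) :
    ∃ Y : ModComodOps R B N, (∀ x a, f (X.act x a) = Y.act (f x) (φ a)) ∧
      ∀ x, Y.coact (f x) = TensorProduct.map f φ (X.coact x) := by
  -- Independence of the chosen preimages, changing one argument at a time. This makes the
  -- operations defined with `Function.surjInv` linear.
  have key : ∀ x x' a a', f x = f x' → φ a = φ a' → f (X.act x a) = f (X.act x' a') := by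
    intro x x' a a' hx ha
    have e1 := h1 (x - x') a (by rw [map_sub, hx, sub_self])
    have e2 := h2 x' (a - a') (by rw [map_sub, ha, sub_self])
    rw [map_sub, LinearMap.sub_apply, map_sub, sub_eq_zero] at e1
    rw [map_sub, map_sub, sub_eq_zero] at e2
    rw [e1, e2]
  have key' : ∀ x x', f x = f x' →
      TensorProduct.map f φ (X.coact x) = TensorProduct.map f φ (X.coact x') := by
    intro x x' hx
    have e := h3 (x - x') (by rw [map_sub, hx, sub_self])
    rwa [map_sub, map_sub, sub_eq_zero] at e
  have sf : ∀ y, f (Function.surjInv hfs y) = y := Function.surjInv_eq hfs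
  have sφ : ∀ b, φ (Function.surjInv hφs b) = b := Function.surjInv_eq hφs
  refine ⟨⟨LinearMap.mk₂ R
    (fun y b => f (X.act (Function.surjInv hfs y) (Function.surjInv hφs b)))
    (fun y y' b => ?_) (fun c y b => ?_) (fun y b b' => ?_) (fun c y b => ?_),
    { toFun := fun y => TensorProduct.map f φ (X.coact (Function.surjInv hfs y))
      map_add' := fun y y' => ?_
      map_smul' := fun c y => ?_ }⟩, ?_, ?_⟩
  · rw [← map_add, ← LinearMap.add_apply, ← map_add]
    exact key _ _ _ _ (by rw [map_add]; simp only [sf]) rfl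
  · rw [← map_smul, ← LinearMap.smul_apply, ← map_smul]
    exact key _ _ _ _ (by rw [map_smul]; simp only [sf]) rfl
  · rw [← map_add, ← map_add]
    exact key _ _ _ _ rfl (by rw [map_add]; simp only [sφ])
  · rw [← map_smul, ← map_smul]
    exact key _ _ _ _ rfl (by rw [map_smul]; simp only [sφ])
  · rw [← map_add, ← map_add]
    exact key' _ _ (by rw [map_add]; simp only [sf])
  · rw [RingHom.id_apply, ← map_smul, ← map_smul]
    exact key' _ _ (by rw [map_smul]; simp only [sf])
  · intro x a
    exact key _ _ _ _ (sf _).symm (sφ _).symm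
  · intro x
    exact key' _ _ (sf _)

/-- The image of a homomorphism. -/
theorem exists_ops_of_image {L Q : Type} [AddCommGroup L] [Module R L] [AddCommGroup Q]
    [Module R Q] (X : ModComodOps R A M) (Y : ModComodOps R B N) {g : M →ₗ[R] L} {γ : A →ₗ[R] Q}
    {i : L →ₗ[R] N} {j : Q →ₗ[R] B} (hg : Function.Surjective g) (hγ : Function.Surjective γ)
    (hi : Function.Injective i) (hij : Function.Injective (TensorProduct.map i j))
    (h1 : ∀ x a, i (g (X.act x a)) = Y.act (i (g x)) (j (γ a)))
    (h2 : ∀ x, TensorProduct.map i j (TensorProduct.map g γ (X.coact x)) = Y.coact (i (g x))) :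
    ∃ Z : ModComodOps R Q L, (∀ x a, g (X.act x a) = Z.act (g x) (γ a)) ∧
      (∀ x, Z.coact (g x) = TensorProduct.map g γ (X.coact x)) ∧
      (∀ y b, i (Z.act y b) = Y.act (i y) (j b)) ∧
      ∀ y, Y.coact (i y) = TensorProduct.map i j (Z.coact y) := by
  obtain ⟨Z, hZ, hZ'⟩ := exists_ops_of_surjective (f := g) (φ := γ) X hγ hg
    (fun x a hx => hi (by rw [h1, hx, map_zero, map_zero, LinearMap.zero_apply]))
    (fun x a ha => hi (by rw [h1, ha, map_zero, map_zero, map_zero]))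
    (fun x hx => hij (by rw [h2, hx, map_zero, map_zero, map_zero]))
  refine ⟨Z, hZ, hZ', fun y b => ?_, fun y => ?_⟩
  · obtain ⟨x, rfl⟩ := hg y
    obtain ⟨a, rfl⟩ := hγ b
    rw [← hZ, h1]
  · obtain ⟨x, rfl⟩ := hg y
    rw [hZ', h2]

/-- Operations restrict to submodules that are closed under them. -/
theorem exists_ops_of_injective (Y : ModComodOps R B N) (hfi : Function.Injective f)
    (hfφi : Function.Injective (TensorProduct.map f φ))
    (h1 : ∀ x a, Y.act (f x) (φ a) ∈ LinearMap.range f)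
    (h2 : ∀ x, Y.coact (f x) ∈ LinearMap.range (TensorProduct.map f φ)) :
    ∃ X : ModComodOps R A M, (∀ x a, f (X.act x a) = Y.act (f x) (φ a)) ∧
      ∀ x, Y.coact (f x) = TensorProduct.map f φ (X.coact x) := by
  choose m hm using h1
  choose c hc using h2
  refine ⟨⟨LinearMap.mk₂ R m (fun x x' a => hfi ?_) (fun r x a => hfi ?_)
      (fun x a a' => hfi ?_) (fun r x a => hfi ?_),
    { toFun := c
      map_add' := fun x x' => hfφi ?_
      map_smul' := fun r x => hfφi ?_ }⟩, hm, fun x => (hc x).symm⟩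
  · simp only [hm, map_add, LinearMap.add_apply]
  · simp only [hm, map_smul, LinearMap.smul_apply]
  · simp only [hm, map_add]
  · simp only [hm, map_smul]
  · simp only [hc, map_add]
  · simp only [hc, map_smul, RingHom.id_apply]

end Hom

/-! ### Duality -/

theorem tensorPairing_tmul (p : M →ₗ[R] N →ₗ[R] R) (q : A →ₗ[R] B →ₗ[R] R) (x : M) (a : A)
    (y : N) (b : B) : tensorPairing p q (x ⊗ₜ[R] a) (y ⊗ₜ[R] b) = p x y * q a b := by
  simp [tensorPairing]

/-- Elementary tensors suffice. This adjointness is what lets a duality pass to a subobject of one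
side and a quotient of the other. -/
theorem tensorPairing_map {p : M →ₗ[R] N →ₗ[R] R} {q : A →ₗ[R] B →ₗ[R] R}
    {p' : M' →ₗ[R] N' →ₗ[R] R} {q' : A' →ₗ[R] B' →ₗ[R] R} {f : M' →ₗ[R] M} {g : N →ₗ[R] N'}
    {φ : A' →ₗ[R] A} {ψ : B →ₗ[R] B'} (hp : ∀ x y, p' x (g y) = p (f x) y)
    (hq : ∀ a b, q' a (ψ b) = q (φ a) b) (s : M' ⊗[R] A') (t : N ⊗[R] B) :
    tensorPairing p' q' s (TensorProduct.map g ψ t)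
      = tensorPairing p q (TensorProduct.map f φ s) t := by
  induction s using TensorProduct.induction_on with
  | zero => simp
  | add s s' hs hs' => simp only [map_add, LinearMap.add_apply, hs, hs']
  | tmul x a =>
    induction t using TensorProduct.induction_on with
    | zero => simp
    | add t t' ht ht' => simp only [map_add, ht, ht']
    | tmul y b => simp only [TensorProduct.map_tmul, tensorPairing_tmul, hp, hq]

theorem tensorPairing_flip (p : M →ₗ[R] N →ₗ[R] R) (q : A →ₗ[R] B →ₗ[R] R) (s : M ⊗[R] A)
    (t : N ⊗[R] B) : tensorPairing p.flip q.flip t s = tensorPairing p q s t := by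
  induction s using TensorProduct.induction_on with
  | zero => simp
  | add s s' hs hs' => simp only [map_add, LinearMap.add_apply, hs, hs']
  | tmul x a =>
    induction t using TensorProduct.induction_on with
    | zero => simp
    | add t t' ht ht' => simp only [map_add, LinearMap.add_apply, ht, ht']
    | tmul y b => simp only [tensorPairing_tmul, LinearMap.flip_apply]

section Dual

variable {ℳ : ℕ → Submodule R M} {𝒩 : ℕ → Submodule R N} {𝒜 : ℕ → Submodule R A}
  {ℬ : ℕ → Submodule R B} {X : ModComodOps R A M} {Y : ModComodOps R B N}
  {H : HopfOps R A} {K : HopfOps R B}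
  {ℳ' : ℕ → Submodule R M'} {𝒩' : ℕ → Submodule R N'} {𝒜' : ℕ → Submodule R A'}
  {ℬ' : ℕ → Submodule R B'} {X' : ModComodOps R A' M'} {Y' : ModComodOps R B' N'}
  {H' : HopfOps R A'} {K' : HopfOps R B'}
  {p : M →ₗ[R] N →ₗ[R] R} {q : A →ₗ[R] B →ₗ[R] R}
  {p' : M' →ₗ[R] N' →ₗ[R] R} {q' : A' →ₗ[R] B' →ₗ[R] R} {f : M' →ₗ[R] M} {g : N →ₗ[R] N'}
  {φ : A' →ₗ[R] A} {ψ : B →ₗ[R] B'}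

theorem IsGradedPairing.flip (h : IsGradedPairing ℳ 𝒩 p) : IsGradedPairing 𝒩 ℳ p.flip :=
  ⟨LinearMap.flip_nondegenerate.mpr h.nondegenerate,
    fun i j hij y hy x hx => h.orthogonal j i hij.symm x hx y hy⟩

theorem IsModComodDual.flip (h : IsModComodDual ℳ 𝒩 p q X Y) :
    IsModComodDual 𝒩 ℳ p.flip q.flip Y X :=
  ⟨h.pairing.flip, fun y b x => (h.coact_act x y b).trans (tensorPairing_flip _ _ _ _).symm,
    fun y x a => (h.act_coact x a y).trans (tensorPairing_flip _ _ _ _).symm⟩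

theorem IsHopfDual.self (h : IsHopfDual 𝒜 ℬ q H K) : IsModComodDual 𝒜 ℬ q q H.self K.self :=
  ⟨h.pairing, h.mul_comul, h.comul_mul⟩

theorem IsHopfDual.of_self (h : IsModComodDual 𝒜 ℬ q q H.self K.self)
    (h1 : ∀ b, q H.one b = K.counit b) (h2 : ∀ a, q a K.one = H.counit a) :
    IsHopfDual 𝒜 ℬ q H K :=
  ⟨h.pairing, h.act_coact, h.coact_act, h1, h2⟩

theorem IsHopfDual.flip (h : IsHopfDual 𝒜 ℬ q H K) : IsHopfDual ℬ 𝒜 q.flip K H :=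
  .of_self h.self.flip h.counit_one h.one_counit

/-- Duality passes to a subobject on one side and a quotient on the other side. -/
theorem IsModComodDual.transfer (h : IsModComodDual ℳ 𝒩 p q X Y)
    (hf : IsModComodHom ℳ' ℳ X' X φ f) (hg : IsModComodHom 𝒩 𝒩' Y Y' ψ g)
    (hgs : Function.Surjective g) (hψs : Function.Surjective ψ)
    (hp : ∀ x y, p' x (g y) = p (f x) y) (hq : ∀ a b, q' a (ψ b) = q (φ a) b)
    (hpair : IsGradedPairing ℳ' 𝒩' p') : IsModComodDual ℳ' 𝒩' p' q' X' Y' where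
  pairing := hpair
  act_coact x a y := by
    obtain ⟨y, rfl⟩ := hgs y
    rw [hp, hf.map_act, h.act_coact, hg.map_coact, tensorPairing_map hp hq,
      TensorProduct.map_tmul]
  coact_act x y b := by
    obtain ⟨y, rfl⟩ := hgs y
    obtain ⟨b, rfl⟩ := hψs b
    rw [← hg.map_act, hp, h.coact_act, hf.map_coact, ← tensorPairing_map hp hq,
      TensorProduct.map_tmul]

theorem IsHopfDual.transfer (h : IsHopfDual 𝒜 ℬ q H K)
    (hφ : IsHopfHom 𝒜' 𝒜 H' H φ) (hψ : IsHopfHom ℬ ℬ' K K' ψ)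
    (hψs : Function.Surjective ψ) (hq : ∀ a b, q' a (ψ b) = q (φ a) b)
    (hpair : IsGradedPairing 𝒜' ℬ' q') : IsHopfDual 𝒜' ℬ' q' H' K' :=
  .of_self (h.self.transfer hφ.self hψ.self hψs hψs hq hq hpair)
    (fun b => by
      obtain ⟨b, rfl⟩ := hψs b
      rw [hq, hφ.map_one, h.one_counit, hψ.map_counit])
    (fun a => by rw [← hψ.map_one, hq, h.counit_one, hφ.map_counit])

end Dual

end GradedAlgebra

end

open scoped TensorProduct
noncomputable section

attribute [local instance 2000] TensorProduct.instModule

/-! ### Operations defined by cutting basis elements in two -/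

/-- Data for cutting an element `w` of a graded set `X` at the positions `lo ≤ i ≤ deg w` into a left
part in `X` and a right part in `P`. -/
structure Cut (P X : Type) where
  -- Zero in type A and two in type D. The values of `fst i` and `snd i` outside `lo ≤ i ≤ deg w`
  -- are irrelevant.
  lo : ℕ
  fst : ℕ → X → X
  snd : ℕ → X → P

section Cuts

open DescentFamily

variable {P X : Type} [DescentFamily P] [DescentFamily X]

/-- The properties of cuts from which the diamond is constructed: coassociativity, compatibility with
descents, and an exchange property that makes the multiset of descent sets of a shuffle product
depend only on the descent sets of the factors. -/
structure IsCut (B : Cut P P) (C : Cut P X) : Prop where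
  base_lo : B.lo = 0
  lo_le : ∀ w : X, C.lo ≤ deg w
  deg_fst : ∀ {i : ℕ} {w : X}, C.lo ≤ i → i ≤ deg w → deg (C.fst i w) = i
  deg_snd : ∀ {i : ℕ} {w : X}, C.lo ≤ i → i ≤ deg w → deg (C.snd i w) = deg w - i
  fst_fst : ∀ {i j : ℕ} {w : X}, C.lo ≤ i → i ≤ j → j ≤ deg w →
    C.fst i (C.fst j w) = C.fst i w
  snd_fst : ∀ {i j : ℕ} {w : X}, C.lo ≤ i → i ≤ j → j ≤ deg w →
    C.snd i (C.fst j w) = B.fst (j - i) (C.snd i w)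
  snd_snd : ∀ {i j : ℕ} {w : X}, C.lo ≤ i → i ≤ j → j ≤ deg w →
    B.snd (j - i) (C.snd i w) = C.snd j w
  fst_deg : ∀ w : X, C.fst (deg w) w = w
  invt_invt : ∀ w : X, invt (invt w) = w
  deg_invt : ∀ w : X, deg (invt w) = deg w
  des_fst : ∀ {i : ℕ} {w w' : X}, deg w = deg w' → des w = des w' → C.lo ≤ i → i ≤ deg w →
    des (C.fst i w) = des (C.fst i w')
  des_snd : ∀ {i : ℕ} {w w' : X}, deg w = deg w' → des w = des w' → C.lo ≤ i → i ≤ deg w →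
    des (C.snd i w) = des (C.snd i w')
  -- The conditions on `w` say that it occurs in the shuffle product of `u` and `v`. It is moved to
  -- a term of the product of `u'` and `v'` with the same descents. For permutations, `g` is left
  -- multiplication by `(u' × v') (u × v)⁻¹` in the relevant degree.
  exchange : ∀ {u u' : X} {v v' : P}, deg u = deg u' → des u = des u' → deg v = deg v' →
    des v = des v' → ∃ g : X → X, Function.Injective g ∧ ∀ w, deg w = deg u + deg v →
      C.fst (deg u) (invt w) = invt u → C.snd (deg u) (invt w) = invt v →
      deg (g w) = deg w ∧ C.fst (deg u) (invt (g w)) = invt u' ∧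
        C.snd (deg u) (invt (g w)) = invt v' ∧ des (g w) = des w

/-! #### Free modules -/

theorem freeGr_le {n : ℕ} {T : Submodule ℤ (X →₀ ℤ)}
    (h : ∀ w : X, deg w = n → Finsupp.single w 1 ∈ T) : freeGr X n ≤ T := by
  rw [freeGr, Finsupp.supported_eq_span_single, Submodule.span_le]
  rintro _ ⟨w, hw, rfl⟩
  exact h w hw

theorem single_mem_freeGr (w : X) (c : ℤ) : Finsupp.single w c ∈ freeGr X (deg w) :=
  Finsupp.single_mem_supported ℤ c rfl

theorem apply_eq_zero_of_mem_freeGr {n : ℕ} {x : X →₀ ℤ} (hx : x ∈ freeGr X n) {w : X}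
    (hw : deg w ≠ n) : x w = 0 := by
  by_contra h
  exact hw (hx (Finsupp.mem_support_iff.mpr h))

theorem mem_freeGr {n : ℕ} {x : X →₀ ℤ} (h : ∀ w, x w ≠ 0 → deg w = n) : x ∈ freeGr X n :=
  fun w hw => h w (Finsupp.mem_support_iff.mp hw)

variable (X) in
/-- The projection to the degree `n` part. -/
def homProj (n : ℕ) : (X →₀ ℤ) →ₗ[ℤ] (X →₀ ℤ) :=
  Finsupp.linearCombination ℤ fun w => if deg w = n then Finsupp.single w 1 else 0

theorem homProj_of_mem {n : ℕ} {x : X →₀ ℤ} (hx : x ∈ freeGr X n) : homProj X n x = x := by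
  refine freeGr_le (T := LinearMap.eqLocus (homProj X n) LinearMap.id) (fun w hw => ?_) hx
  simp [homProj, hw]

theorem homProj_of_mem_ne {m n : ℕ} (hmn : m ≠ n) {x : X →₀ ℤ} (hx : x ∈ freeGr X m) :
    homProj X n x = 0 := by
  refine freeGr_le (T := LinearMap.ker (homProj X n)) (fun w hw => ?_) hx
  simp [homProj, hw, hmn]

theorem iSup_freeGr : ⨆ n, freeGr X n = ⊤ := by
  rw [eq_top_iff]
  intro x _
  induction x using Finsupp.induction_linear with
  | zero => exact zero_mem _
  | add x y hx hy => exact add_mem (hx trivial) (hy trivial)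
  | single w c => exact Submodule.mem_iSup_of_mem (deg w) (single_mem_freeGr w c)

theorem isInternal_freeGr : DirectSum.IsInternal (freeGr X) :=
  isInternal_of_detect iSup_freeGr (homProj X)
    (fun n x hx h => by rwa [homProj_of_mem hx] at h)
    (fun m n hmn x hx => homProj_of_mem_ne hmn hx)

theorem kron_single_left (X : Type) (x : X →₀ ℤ) (w : X) (c : ℤ) :
    kron X (Finsupp.single w c) x = c * x w := by
  classical
  induction x using Finsupp.induction_linear with
  | zero => simp
  | add f g hf hg => rw [map_add, hf, hg, Finsupp.add_apply, mul_add]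
  | single v b =>
    rw [kron_single, Finsupp.single_apply, Finsupp.single_apply]
    by_cases h : w = v
    · simp [h, mul_comm]
    · simp [h, Ne.symm h]

theorem kron_comm (X : Type) (x y : X →₀ ℤ) : kron X x y = kron X y x := by
  induction y using Finsupp.induction_linear with
  | zero => simp
  | add f g hf hg => rw [map_add, hf, hg, map_add, LinearMap.add_apply]
  | single w c => rw [kron_single, kron_single_left]

theorem kron_flip (X : Type) : (kron X).flip = kron X :=
  LinearMap.ext₂ fun x y => kron_comm X y x

theorem kron_separating {X : Type} {x : X →₀ ℤ} (h : ∀ y, kron X x y = 0) : x = 0 := by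
  ext w
  have := h (Finsupp.single w 1)
  rwa [kron_single, one_mul] at this

theorem isGradedPairing_kron : IsGradedPairing (freeGr X) (freeGr X) (kron X) where
  nondegenerate := ⟨fun x h => kron_separating h,
    fun y h => kron_separating fun x => by rw [kron_comm]; exact h x⟩
  orthogonal i j hij x hx y hy := by
    refine freeGr_le (T := LinearMap.ker (kron X x)) (fun w hw => ?_) hy
    rw [LinearMap.mem_ker, kron_single, apply_eq_zero_of_mem_freeGr hx (by omega), mul_zero]

/-! #### Operations -/

/-- The coproduct `w ↦ ∑ fst i w ⊗ snd i w`. -/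
def Cut.split (C : Cut P X) : (X →₀ ℤ) →ₗ[ℤ] (X →₀ ℤ) ⊗[ℤ] (P →₀ ℤ) :=
  Finsupp.linearCombination ℤ fun w => ∑ i ∈ Finset.Icc C.lo (deg w),
    Finsupp.single (C.fst i w) 1 ⊗ₜ[ℤ] Finsupp.single (C.snd i w) 1

/-- The product of `u` and `v`: the sum of all `w` which can be cut into `u` and `v`. -/
def Cut.glue (C : Cut P X) : (X →₀ ℤ) →ₗ[ℤ] (P →₀ ℤ) →ₗ[ℤ] (X →₀ ℤ) :=
  open Classical in
  bilin fun u v => ∑ w ∈ (finite_deg (X := X) (deg u + deg v)).toFinset with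
    C.fst (deg u) w = u ∧ C.snd (deg u) w = v, Finsupp.single w 1

/-- The product cuts positions, while the coproduct cuts values, that is, positions of the inverse.
In `Cut.shuffle` the roles are exchanged. -/
def Cut.cup (C : Cut P X) : ModComodOps ℤ (P →₀ ℤ) (X →₀ ℤ) where
  act := C.glue
  coact := (TensorProduct.map (invLin X) (invLin P)).comp (C.split.comp (invLin X))

def Cut.shuffle (C : Cut P X) : ModComodOps ℤ (P →₀ ℤ) (X →₀ ℤ) where
  act := (C.glue.compl₁₂ (invLin X) (invLin P)).compr₂ (invLin X)
  coact := C.split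

def Cut.cupHopf (B : Cut P P) (e : P) : HopfOps ℤ (P →₀ ℤ) where
  mul := B.cup.act
  one := Finsupp.single e 1
  comul := B.cup.coact
  counit := Finsupp.lapply e

def Cut.shuffleHopf (B : Cut P P) (e : P) : HopfOps ℤ (P →₀ ℤ) where
  mul := B.shuffle.act
  one := Finsupp.single e 1
  comul := B.shuffle.coact
  counit := Finsupp.lapply e

theorem Cut.split_single {P X : Type} [DescentFamily X] (C : Cut P X) (w : X) (c : ℤ) :
    C.split (Finsupp.single w c) = c • ∑ i ∈ Finset.Icc C.lo (deg w),
      Finsupp.single (C.fst i w) 1 ⊗ₜ[ℤ] Finsupp.single (C.snd i w) 1 :=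
  Finsupp.linearCombination_single ℤ c w

theorem bilin_single {α β M : Type} [AddCommGroup M] (f : α → β → M) (a : α) (b : β)
    (c d : ℤ) : bilin f (Finsupp.single a c) (Finsupp.single b d) = (c * d) • f a b := by
  rw [bilin, Finsupp.linearCombination_single, mul_smul]
  exact congrArg (fun t : M => c • t) (Finsupp.linearCombination_single ℤ d b)

/-- Nested cuts, ordered by either of the two positions. -/
theorem sum_Icc_nested {M : Type} [AddCommMonoid M] (l n : ℕ) (f : ℕ → ℕ → M) :
    ∑ j ∈ Finset.Icc l n, ∑ i ∈ Finset.Icc l j, f i j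
      = ∑ i ∈ Finset.Icc l n, ∑ k ∈ Finset.Icc 0 (n - i), f i (i + k) := by
  rw [Finset.sum_sigma', Finset.sum_sigma']
  refine Finset.sum_bij' (fun p _ => ⟨p.2, p.1 - p.2⟩) (fun p _ => ⟨p.1 + p.2, p.1⟩) ?_ ?_ ?_ ?_ ?_
  · rintro ⟨j, i⟩ h
    simp only [Finset.mem_sigma, Finset.mem_Icc] at h ⊢
    omega
  · rintro ⟨i, k⟩ h
    simp only [Finset.mem_sigma, Finset.mem_Icc] at h ⊢
    omega
  · rintro ⟨j, i⟩ h
    simp only [Finset.mem_sigma, Finset.mem_Icc] at h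
    simp only [Sigma.mk.injEq, heq_eq_eq, and_true]
    omega
  · rintro ⟨i, k⟩ h
    simp
  · rintro ⟨j, i⟩ h
    simp only [Finset.mem_sigma, Finset.mem_Icc] at h
    rw [Nat.add_sub_cancel' h.2.2]

/-! ### Associativity, duality and inversion from the cut axioms. -/

namespace IsCut

variable {B : Cut P P} {C : Cut P X}

section Inversion

theorem invLin_single (w : X) (c : ℤ) :
    invLin X (Finsupp.single w c) = Finsupp.single (invt w) c :=
  Finsupp.mapDomain_single

theorem invLin_invLin (h : IsCut B C) (x : X →₀ ℤ) : invLin X (invLin X x) = x := by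
  induction x using Finsupp.induction_linear with
  | zero => simp
  | add f g hf hg => rw [map_add, map_add, hf, hg]
  | single w c => rw [invLin_single, invLin_single, h.invt_invt]

theorem invLin_apply (h : IsCut B C) (x : X →₀ ℤ) (w : X) : invLin X x w = x (invt w) := by
  classical
  induction x using Finsupp.induction_linear with
  | zero => simp
  | add f g hf hg => rw [map_add, Finsupp.add_apply, hf, hg, Finsupp.add_apply]
  | single v c =>
    rw [invLin_single, Finsupp.single_apply, Finsupp.single_apply]
    refine if_congr ⟨?_, ?_⟩ rfl rfl
    · rintro rfl; exact (h.invt_invt v).symm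
    · rintro rfl; exact h.invt_invt w

theorem invLin_bijective (h : IsCut B C) : Function.Bijective (invLin X) :=
  Function.Involutive.bijective h.invLin_invLin

theorem invLin_mem (h : IsCut B C) {n : ℕ} {x : X →₀ ℤ} (hx : x ∈ freeGr X n) :
    invLin X x ∈ freeGr X n :=
  mem_freeGr fun w hw => by
    rw [h.invLin_apply] at hw
    by_contra hn
    exact hw (apply_eq_zero_of_mem_freeGr hx (by rwa [h.deg_invt]))

theorem kron_invLin (h : IsCut B C) (x y : X →₀ ℤ) :
    kron X (invLin X x) y = kron X x (invLin X y) := by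
  induction y using Finsupp.induction_linear with
  | zero => simp
  | add f g hf hg => rw [map_add, hf, hg, map_add, map_add]
  | single w c => rw [invLin_single, kron_single, kron_single, h.invLin_apply]

theorem kronInv_comm (h : IsCut B C) (x y : X →₀ ℤ) : kronInv X x y = kronInv X y x := by
  change kron X (invLin X x) y = kron X (invLin X y) x
  rw [h.kron_invLin, kron_comm]

theorem isGradedPairing_kronInv (h : IsCut B C) :
    IsGradedPairing (freeGr X) (freeGr X) (kronInv X) where
  nondegenerate := by
    have h0 : ∀ x, (∀ y, kronInv X x y = 0) → x = 0 := fun x hx => by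
      have := kron_separating (x := invLin X x) hx
      rw [← h.invLin_invLin x, this, map_zero]
    exact ⟨h0, fun y hy => h0 y fun x => by rw [h.kronInv_comm]; exact hy x⟩
  orthogonal i j hij x hx y hy :=
    isGradedPairing_kron.orthogonal i j hij _ (h.invLin_mem hx) y hy

end Inversion

/-- As `fst i w` has degree `i`, only the cut at `i = deg u` can contribute when `x` is a multiple
of the basis element `u`. The formula exhibits `glue` as the transpose of `split` and reduces
statements on products to statements on cuts. -/
theorem glue_apply (h : IsCut B C) (x : X →₀ ℤ) (a : P →₀ ℤ) (w : X) :
    C.glue x a w = ∑ i ∈ Finset.Icc C.lo (deg w), x (C.fst i w) * a (C.snd i w) := by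
  classical
  induction x using Finsupp.induction_linear with
  | zero => simp
  | add x y hx hy =>
    simp only [map_add, LinearMap.add_apply, Finsupp.add_apply, hx, hy, add_mul,
      Finset.sum_add_distrib]
  | single u c =>
    induction a using Finsupp.induction_linear with
    | zero => simp
    | add x y hx hy =>
      simp only [map_add, Finsupp.add_apply, hx, hy, mul_add, Finset.sum_add_distrib]
    | single v d =>
      have hcoef : (∑ w' ∈ (finite_deg (X := X) (deg u + deg v)).toFinset with
          C.fst (deg u) w' = u ∧ C.snd (deg u) w' = v, Finsupp.single w' (1 : ℤ)) w
          = if deg w = deg u + deg v ∧ C.fst (deg u) w = u ∧ C.snd (deg u) w = v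
            then 1 else 0 := by
        rw [Finsupp.finsetSum_apply]
        simp only [Finsupp.single_apply, Finset.sum_ite_eq', Finset.mem_filter,
          Set.Finite.mem_toFinset, Set.mem_ofPred_eq]
      rw [Cut.glue, bilin_single, Finsupp.smul_apply, hcoef]
      have hi : ∀ i ∈ Finset.Icc C.lo (deg w), i ≠ deg u →
          Finsupp.single u c (C.fst i w) * Finsupp.single v d (C.snd i w) = 0 := by
        intro i hi hne
        rw [Finset.mem_Icc] at hi
        rw [Finsupp.single_apply, if_neg, zero_mul]
        rintro rfl
        exact hne (h.deg_fst hi.1 hi.2).symm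
      by_cases hu : deg u ∈ Finset.Icc C.lo (deg w)
      · rw [Finset.sum_eq_single_of_mem _ hu hi, Finsupp.single_apply, Finsupp.single_apply]
        rw [Finset.mem_Icc] at hu
        by_cases h1 : C.fst (deg u) w = u
        · by_cases h2 : C.snd (deg u) w = v
          · have h3 := h.deg_snd hu.1 hu.2
            rw [h2] at h3
            rw [if_pos ⟨by omega, h1, h2⟩, if_pos h1.symm, if_pos h2.symm]
            simp
          · rw [if_neg fun h' => h2 h'.2.2, if_neg (Ne.symm h2)]; simp
        · rw [if_neg fun h' => h1 h'.2.1, if_neg (Ne.symm h1)]; simp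
      · rw [Finset.sum_eq_zero fun i hi' => hi i hi' fun h' => hu (h' ▸ hi'), if_neg, smul_zero]
        rintro ⟨h1, -⟩
        exact hu (Finset.mem_Icc.mpr ⟨h.lo_le u, by omega⟩)

theorem kron_glue (h : IsCut B C) (x : X →₀ ℤ) (a : P →₀ ℤ) (y : X →₀ ℤ) :
    kron X (C.glue x a) y = tensorPairing (kron X) (kron P) (x ⊗ₜ[ℤ] a) (C.split y) := by
  induction y using Finsupp.induction_linear with
  | zero => simp
  | add y z hy hz => rw [map_add, hy, hz, map_add, map_add]
  | single w c =>
    rw [kron_single, h.glue_apply, C.split_single, map_smul, map_sum, smul_eq_mul]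
    simp only [tensorPairing_tmul, kron_single, one_mul]

theorem split_kron (h : IsCut B C) (x : X →₀ ℤ) (y : X →₀ ℤ) (b : P →₀ ℤ) :
    kron X x (C.glue y b) = tensorPairing (kron X) (kron P) (C.split x) (y ⊗ₜ[ℤ] b) := by
  rw [← tensorPairing_flip, kron_flip, kron_flip, kron_comm, h.kron_glue]

/-- `glue` and `split` are transposes of each other, and inversion is self-adjoint for `kron`;
conjugating by it gives the other transposed pair. -/
theorem shuffle_dual_cup (hB : IsCut B B) (h : IsCut B C) :
    IsModComodDual (freeGr X) (freeGr X) (kron X) (kron P) C.shuffle C.cup where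
  pairing := isGradedPairing_kron
  act_coact x a y := by
    change kron X (invLin X (C.glue (invLin X x) (invLin P a))) y = tensorPairing _ _ _
      (TensorProduct.map (invLin X) (invLin P) (C.split (invLin X y)))
    rw [h.kron_invLin, h.kron_glue, tensorPairing_map (p := kron X) (q := kron P)
      (f := invLin X) (φ := invLin P) (fun x y => (h.kron_invLin x y).symm)
      (fun x y => (hB.kron_invLin x y).symm), TensorProduct.map_tmul]
  coact_act x y b := h.split_kron x y b

theorem invLin_hom (h : IsCut B C) :
    IsModComodHom (freeGr X) (freeGr X) C.shuffle C.cup (invLin P) (invLin X) where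
  map_mem n x hx := h.invLin_mem hx
  map_act x a := h.invLin_invLin _
  map_coact x := by
    change TensorProduct.map _ _ (C.split (invLin X (invLin X x))) = _
    rw [h.invLin_invLin]
    rfl

theorem invLin_hom' (hB : IsCut B B) (h : IsCut B C) :
    IsModComodHom (freeGr X) (freeGr X) C.cup C.shuffle (invLin P) (invLin X) where
  map_mem n x hx := h.invLin_mem hx
  map_act x a := by
    change invLin X (C.glue x a) = invLin X (C.glue (invLin X (invLin X x))
      (invLin P (invLin P a)))
    rw [h.invLin_invLin, hB.invLin_invLin]
  map_coact x := by
    change C.split (invLin X x) = TensorProduct.map (invLin X) (invLin P)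
      (TensorProduct.map (invLin X) (invLin P) (C.split (invLin X x)))
    generalize C.split (invLin X x) = t
    induction t using TensorProduct.induction_on with
    | zero => simp
    | add s t hs ht => rw [map_add, map_add, ← hs, ← ht]
    | tmul x a => simp only [TensorProduct.map_tmul, h.invLin_invLin, hB.invLin_invLin]

/-- This is the duality with the shuffle structure, pulled back on one side along the isomorphism
given by inversion. -/
theorem cup_selfDual (hB : IsCut B B) (h : IsCut B C) :
    IsModComodDual (freeGr X) (freeGr X) (kronInv X) (kronInv P) C.cup C.cup :=
  (shuffle_dual_cup hB h).transfer (g := LinearMap.id) (ψ := LinearMap.id) (invLin_hom' hB h)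
    ⟨fun _ _ hx => hx, fun _ _ => rfl, fun x => by rw [TensorProduct.map_id]; rfl⟩
    Function.surjective_id Function.surjective_id (fun _ _ => rfl) (fun _ _ => rfl)
    h.isGradedPairing_kronInv

/-- Both coefficients of `w` are sums over two nested cuts of `w`. They agree after reindexing,
since the pieces do not depend on which cut is made first. -/
theorem glue_assoc (hB : IsCut B B) (h : IsCut B C) (x : X →₀ ℤ) (a b : P →₀ ℤ) :
    C.glue (C.glue x a) b = C.glue x (B.glue a b) := by
  ext w
  rw [h.glue_apply, h.glue_apply]
  have h1 : ∀ j ∈ Finset.Icc C.lo (deg w), C.glue x a (C.fst j w) * b (C.snd j w)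
      = ∑ i ∈ Finset.Icc C.lo j,
        x (C.fst i w) * a (B.fst (j - i) (C.snd i w)) * b (C.snd j w) := by
    intro j hj
    rw [Finset.mem_Icc] at hj
    rw [h.glue_apply, h.deg_fst hj.1 hj.2, Finset.sum_mul]
    refine Finset.sum_congr rfl fun i hi => ?_
    rw [Finset.mem_Icc] at hi
    rw [h.fst_fst hi.1 hi.2 hj.2, h.snd_fst hi.1 hi.2 hj.2]
  rw [Finset.sum_congr rfl h1, sum_Icc_nested]
  refine Finset.sum_congr rfl fun i hi => ?_
  rw [Finset.mem_Icc] at hi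
  rw [hB.glue_apply, hB.base_lo, h.deg_snd hi.1 hi.2, Finset.mul_sum]
  refine Finset.sum_congr rfl fun k hk => ?_
  rw [Finset.mem_Icc] at hk
  rw [← h.snd_snd hi.1 (Nat.le_add_right i k) (by omega), Nat.add_sub_cancel_left, mul_assoc]

/-- The same reindexing of nested cuts as in `glue_assoc`, now for sums of elementary tensors. -/
theorem split_coassoc (hB : IsCut B B) (h : IsCut B C) (x : X →₀ ℤ) :
    TensorProduct.assoc ℤ _ _ _ (TensorProduct.map C.split LinearMap.id (C.split x))
      = TensorProduct.map LinearMap.id B.split (C.split x) := by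
  induction x using Finsupp.induction_linear with
  | zero => simp
  | add x y hx hy => simp only [map_add, hx, hy]
  | single w c =>
    rw [C.split_single]
    rw [map_smul, map_smul, map_smul, map_sum, map_sum, map_sum]
    congr 1
    simp only [TensorProduct.map_tmul, LinearMap.id_apply]
    have h1 : ∀ j ∈ Finset.Icc C.lo (deg w), TensorProduct.assoc ℤ _ _ _
        (C.split (Finsupp.single (C.fst j w) 1) ⊗ₜ[ℤ] Finsupp.single (C.snd j w) 1)
        = ∑ i ∈ Finset.Icc C.lo j, (Finsupp.single (C.fst i w) (1 : ℤ)) ⊗ₜ[ℤ]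
          ((Finsupp.single (B.fst (j - i) (C.snd i w)) (1 : ℤ)) ⊗ₜ[ℤ]
            Finsupp.single (C.snd j w) (1 : ℤ)) := by
      intro j hj
      rw [Finset.mem_Icc] at hj
      rw [C.split_single, h.deg_fst hj.1 hj.2, one_smul, TensorProduct.sum_tmul, map_sum]
      refine Finset.sum_congr rfl fun i hi => ?_
      rw [Finset.mem_Icc] at hi
      rw [h.fst_fst hi.1 hi.2 hj.2, h.snd_fst hi.1 hi.2 hj.2, TensorProduct.assoc_tmul]
    rw [Finset.sum_congr rfl h1, sum_Icc_nested]
    refine Finset.sum_congr rfl fun i hi => ?_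
    rw [Finset.mem_Icc] at hi
    rw [B.split_single, hB.base_lo, h.deg_snd hi.1 hi.2, one_smul, TensorProduct.tmul_sum]
    refine Finset.sum_congr rfl fun k hk => ?_
    rw [Finset.mem_Icc] at hk
    rw [← h.snd_snd hi.1 (Nat.le_add_right i k) (by omega), Nat.add_sub_cancel_left]

theorem glue_mem (h : IsCut B C) {m n : ℕ} {x : X →₀ ℤ} (hx : x ∈ freeGr X m) {a : P →₀ ℤ}
    (ha : a ∈ freeGr P n) : C.glue x a ∈ freeGr X (m + n) := by
  refine mem_freeGr fun w hw => ?_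
  rw [h.glue_apply] at hw
  obtain ⟨i, hi, hne⟩ := Finset.exists_ne_zero_of_sum_ne_zero hw
  rw [Finset.mem_Icc] at hi
  have h1 : deg (C.fst i w) = m := by
    by_contra h'
    exact hne (by rw [apply_eq_zero_of_mem_freeGr hx h', zero_mul])
  have h2 : deg (C.snd i w) = n := by
    by_contra h'
    exact hne (by rw [apply_eq_zero_of_mem_freeGr ha h', mul_zero])
  rw [h.deg_fst hi.1 hi.2] at h1
  rw [h.deg_snd hi.1 hi.2] at h2
  omega

theorem split_mem (h : IsCut B C) {n : ℕ} {x : X →₀ ℤ} (hx : x ∈ freeGr X n) :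
    C.split x ∈ tensorGr (freeGr X) (freeGr P) n := by
  refine freeGr_le (T := (tensorGr (freeGr X) (freeGr P) n).comap C.split) (fun w hw => ?_) hx
  rw [Submodule.mem_comap, C.split_single, one_smul]
  refine sum_mem fun i hi => ?_
  rw [Finset.mem_Icc] at hi
  refine tmul_mem_tensorGr ?_ (single_mem_freeGr _ _) (single_mem_freeGr _ _)
  rw [h.deg_fst hi.1 hi.2, h.deg_snd hi.1 hi.2]
  omega

end IsCut

/-- A unit for cuts: the only element of degree zero. -/
structure IsCutUnit (B : Cut P P) (e : P) : Prop where
  deg_unit : deg e = 0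
  eq_unit : ∀ v : P, deg v = 0 → v = e
  snd_zero : ∀ v : P, B.snd 0 v = v
  invt_unit : invt e = e

namespace IsCut

variable {B : Cut P P} {C : Cut P X} {e : P}

theorem snd_eq_unit (h : IsCut B C) (he : IsCutUnit B e) {i : ℕ} {w : X} (h1 : C.lo ≤ i)
    (h2 : i ≤ deg w) : C.snd i w = e ↔ i = deg w := by
  constructor
  · intro h'
    have := h.deg_snd h1 h2
    rw [h', he.deg_unit] at this
    omega
  · rintro rfl
    exact he.eq_unit _ (by rw [h.deg_snd h1 h2, Nat.sub_self])

theorem glue_one (h : IsCut B C) (he : IsCutUnit B e) (x : X →₀ ℤ) :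
    C.glue x (Finsupp.single e 1) = x := by
  classical
  ext w
  have hw : deg w ∈ Finset.Icc C.lo (deg w) := Finset.mem_Icc.mpr ⟨h.lo_le w, le_rfl⟩
  rw [h.glue_apply, Finset.sum_eq_single_of_mem _ hw, h.fst_deg,
    (h.snd_eq_unit he (h.lo_le w) le_rfl).mpr rfl]
  · simp
  · intro i hi hne
    rw [Finset.mem_Icc] at hi
    rw [Finsupp.single_apply, if_neg, mul_zero]
    intro h'
    exact hne ((h.snd_eq_unit he hi.1 hi.2).mp h'.symm)

theorem split_counit (h : IsCut B C) (he : IsCutUnit B e) (x : X →₀ ℤ) :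
    TensorProduct.rid ℤ _ (TensorProduct.map LinearMap.id (Finsupp.lapply e) (C.split x)) = x := by
  classical
  induction x using Finsupp.induction_linear with
  | zero => simp
  | add x y hx hy => simp only [map_add, hx, hy]
  | single w c =>
    have hw : deg w ∈ Finset.Icc C.lo (deg w) := Finset.mem_Icc.mpr ⟨h.lo_le w, le_rfl⟩
    rw [C.split_single, map_smul, map_smul, map_sum, map_sum, Finset.sum_eq_single_of_mem _ hw,
      h.fst_deg, (h.snd_eq_unit he (h.lo_le w) le_rfl).mpr rfl]
    · simp
    · intro i hi hne
      rw [Finset.mem_Icc] at hi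
      have : (Finsupp.single (C.snd i w) (1 : ℤ)) e = 0 := by
        rw [Finsupp.single_apply, if_neg]
        exact fun h' => hne ((h.snd_eq_unit he hi.1 hi.2).mp h')
      simp [this]

theorem fst_eq_unit (h : IsCut B B) (he : IsCutUnit B e) {i : ℕ} {w : P}
    (h2 : i ≤ deg w) : B.fst i w = e ↔ i = 0 := by
  have h1 : B.lo ≤ i := by rw [h.base_lo]; exact Nat.zero_le i
  constructor
  · intro h'
    have := h.deg_fst h1 h2
    rw [h', he.deg_unit] at this
    omega
  · rintro rfl
    exact he.eq_unit _ (h.deg_fst h1 h2)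

theorem one_glue (h : IsCut B B) (he : IsCutUnit B e) (x : P →₀ ℤ) :
    B.glue (Finsupp.single e 1) x = x := by
  classical
  ext w
  have hw : 0 ∈ Finset.Icc B.lo (deg w) := Finset.mem_Icc.mpr ⟨h.base_lo.le, Nat.zero_le _⟩
  rw [h.glue_apply, Finset.sum_eq_single_of_mem _ hw, he.snd_zero,
    (h.fst_eq_unit he (Nat.zero_le _)).mpr rfl]
  · simp
  · intro i hi hne
    rw [Finset.mem_Icc] at hi
    rw [Finsupp.single_apply, if_neg, zero_mul]
    intro h'
    exact hne ((h.fst_eq_unit he hi.2).mp h'.symm)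

theorem counit_split (h : IsCut B B) (he : IsCutUnit B e) (x : P →₀ ℤ) :
    TensorProduct.lid ℤ _ (TensorProduct.map (Finsupp.lapply e) LinearMap.id (B.split x)) = x := by
  classical
  induction x using Finsupp.induction_linear with
  | zero => simp
  | add x y hx hy => simp only [map_add, hx, hy]
  | single w c =>
    have hw : 0 ∈ Finset.Icc B.lo (deg w) := Finset.mem_Icc.mpr ⟨h.base_lo.le, Nat.zero_le _⟩
    rw [B.split_single, map_smul, map_smul, map_sum, map_sum, Finset.sum_eq_single_of_mem _ hw,
      he.snd_zero, (h.fst_eq_unit he (Nat.zero_le _)).mpr rfl]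
    · simp
    · intro i hi hne
      rw [Finset.mem_Icc] at hi
      have : (Finsupp.single (B.fst i w) (1 : ℤ)) e = 0 := by
        rw [Finsupp.single_apply, if_neg]
        exact fun h' => hne ((h.fst_eq_unit he hi.2).mp h')
      simp [this]

theorem invLin_hopfHom (hB : IsCut B B) (he : IsCutUnit B e) :
    IsHopfHom (freeGr P) (freeGr P) (B.shuffleHopf e) (B.cupHopf e) (invLin P) where
  map_mem := (invLin_hom hB).map_mem
  map_mul := (invLin_hom hB).map_act
  map_one := by
    change invLin P (Finsupp.single e 1) = _
    rw [invLin_single, he.invt_unit]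
    rfl
  map_comul := (invLin_hom hB).map_coact
  map_counit x := by
    change invLin P x e = x e
    rw [hB.invLin_apply, he.invt_unit]

theorem shuffle_isGradedModComod (hB : IsCut B B) (h : IsCut B C) (he : IsCutUnit B e) :
    IsGradedModComod (freeGr P) (freeGr X) (B.shuffleHopf e) C.shuffle where
  isInternal := isInternal_freeGr
  act_one x := by
    change invLin X (C.glue (invLin X x) (invLin P (Finsupp.single e 1))) = x
    rw [invLin_single, he.invt_unit, h.glue_one he, h.invLin_invLin]
  act_act x a b := by
    change invLin X (C.glue (invLin X (invLin X (C.glue (invLin X x) (invLin P a))))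
      (invLin P b)) = invLin X (C.glue (invLin X x)
        (invLin P (invLin P (B.glue (invLin P a) (invLin P b)))))
    rw [h.invLin_invLin, hB.invLin_invLin, glue_assoc hB h]
  coassoc := split_coassoc hB h
  counit := h.split_counit he
  act_mem i j x hx a ha := h.invLin_mem (h.glue_mem (h.invLin_mem hx) (hB.invLin_mem ha))
  coact_mem n x hx := h.split_mem hx

theorem cup_isGradedModComod (hB : IsCut B B) (h : IsCut B C) (he : IsCutUnit B e) :
    IsGradedModComod (freeGr P) (freeGr X) (B.cupHopf e) C.cup :=
  (shuffle_isGradedModComod hB h he).of_surjective (invLin_hopfHom hB he) (invLin_hom h)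
    hB.invLin_bijective.2 h.invLin_bijective.2 isInternal_freeGr isInternal_freeGr
    isInternal_freeGr

/-- Compatibility of product and coproduct is the one axiom not derived from cuts;
`comul_mul_shuffle` supplies it for permutations. -/
theorem shuffle_isConnectedBialgebra (hB : IsCut B B) (he : IsCutUnit B e)
    (hmul : ∀ a b, (B.shuffleHopf e).comul ((B.shuffleHopf e).mul a b)
      = TensorProduct.map₂ (B.shuffleHopf e).mul (B.shuffleHopf e).mul
        ((B.shuffleHopf e).comul a) ((B.shuffleHopf e).comul b)) :
    IsConnectedBialgebra (freeGr P) (B.shuffleHopf e) where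
  self := shuffle_isGradedModComod hB hB he
  one_mul x := by
    change invLin P (B.glue (invLin P (Finsupp.single e 1)) (invLin P x)) = x
    rw [invLin_single, he.invt_unit, hB.one_glue he, hB.invLin_invLin]
  counit_left := hB.counit_split he
  comul_mul := hmul
  comul_one := by
    change B.split (Finsupp.single e 1) = _
    rw [B.split_single, he.deg_unit, hB.base_lo, Finset.Icc_self, Finset.sum_singleton, one_smul,
      he.snd_zero, (hB.fst_eq_unit he (Nat.zero_le _)).mpr rfl]
    rfl
  counit_mul a b := by
    change invLin P (B.glue (invLin P a) (invLin P b)) e = a e * b e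
    rw [hB.invLin_apply, he.invt_unit, hB.glue_apply, he.deg_unit, hB.base_lo, Finset.Icc_self,
      Finset.sum_singleton, he.snd_zero, (hB.fst_eq_unit he (Nat.zero_le _)).mpr rfl,
      hB.invLin_apply, hB.invLin_apply, he.invt_unit]
  counit_one := Finsupp.single_eq_same
  one_mem := by
    have := single_mem_freeGr e (1 : ℤ)
    rwa [he.deg_unit] at this
  counit_eq_zero n hn a ha :=
    apply_eq_zero_of_mem_freeGr ha (by rw [he.deg_unit]; exact hn.symm)
  connected a ha := by
    classical
    ext w
    change a w = a e * (Finsupp.single e 1 : P →₀ ℤ) w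
    by_cases hw : deg w = 0
    · rw [he.eq_unit w hw, Finsupp.single_eq_same, mul_one]
    · rw [apply_eq_zero_of_mem_freeGr ha hw, Finsupp.single_apply, if_neg, mul_zero]
      rintro rfl
      exact hw he.deg_unit

theorem cup_isConnectedBialgebra (hB : IsCut B B) (he : IsCutUnit B e)
    (h : IsConnectedBialgebra (freeGr P) (B.shuffleHopf e)) :
    IsConnectedBialgebra (freeGr P) (B.cupHopf e) :=
  h.of_surjective (invLin_hopfHom hB he) hB.invLin_bijective.2 isInternal_freeGr

theorem shuffle_hopfDual_cup (hB : IsCut B B) :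
    IsHopfDual (freeGr P) (freeGr P) (kron P) (B.shuffleHopf e) (B.cupHopf e) :=
  .of_self (shuffle_dual_cup hB hB)
    (fun b => (kron_single_left P b e 1).trans (one_mul _))
    (fun a => (kron_single P a e 1).trans (one_mul _))

theorem cup_hopfSelfDual (hB : IsCut B B) (he : IsCutUnit B e) :
    IsHopfDual (freeGr P) (freeGr P) (kronInv P) (B.cupHopf e) (B.cupHopf e) :=
  .of_self (cup_selfDual hB hB)
    (fun b => by
      change kron P (invLin P (Finsupp.single e 1)) b = b e
      rw [invLin_single, he.invt_unit, kron_single_left, one_mul])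
    (fun a => by
      change kron P (invLin P a) (Finsupp.single e 1) = a e
      rw [kron_single, one_mul, hB.invLin_apply, he.invt_unit])

end IsCut

end Cuts

end

open scoped TensorProduct
noncomputable section

attribute [local instance 2000] TensorProduct.instModule

/-! ### The diamond of a family of cuts -/

section Diamond

open DescentFamily

/-! #### The span of the descent classes and its graded dual -/

section Classes

variable {X : Type} [DescentFamily X]

theorem desClass_apply (n : ℕ) (I : Finset ℕ) (w : X) [Decidable (deg w = n ∧ des w = I)] :
    desClass X n I w = if deg w = n ∧ des w = I then 1 else 0 := by
  classical
  rw [desClass, Finsupp.finsetSum_apply]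
  simp only [Finsupp.single_apply, Finset.sum_ite_eq', Finset.mem_filter,
    Set.Finite.mem_toFinset, Set.mem_ofPred_eq]

/-- A function which is constant on descent classes is a combination of them. -/
theorem mem_of_constant {x : X →₀ ℤ} (hx : ∀ u u', deg u = deg u' → des u = des u' → x u = x u')
    {T : Submodule ℤ (X →₀ ℤ)} (hT : ∀ u, x u ≠ 0 → desClass X (deg u) (des u) ∈ T) : x ∈ T := by
  classical
  -- The common value of `x` on a descent class, read off at a chosen element; empty classes get
  -- zero.
  let c : ℕ × Finset ℕ → ℤ := fun p =>
    if h : ∃ u : X, (deg u, des u) = p then x h.choose else 0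
  have hc : ∀ u, c (deg u, des u) = x u := by
    intro u
    have h : ∃ u' : X, (deg u', des u') = (deg u, des u) := ⟨u, rfl⟩
    have h' := Prod.ext_iff.mp h.choose_spec
    simp only [c, dif_pos h]
    exact hx _ _ h'.1 h'.2
  have : x = ∑ p ∈ x.support.image (fun u => (deg u, des u)), c p • desClass X p.1 p.2 := by
    ext w
    rw [Finsupp.finsetSum_apply]
    have h1 : ∀ p ∈ x.support.image (fun u => (deg u, des u)),
        (c p • desClass X p.1 p.2) w = if (deg w, des w) = p then x w else 0 := by
      intro p _
      rw [Finsupp.smul_apply, desClass_apply, ← hc w]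
      by_cases h : (deg w, des w) = p
      · subst h; simp
      · rw [if_neg h, if_neg fun h' => h (Prod.ext h'.1 h'.2), smul_zero]
    rw [Finset.sum_congr rfl h1, Finset.sum_ite_eq]
    split_ifs with h
    · rfl
    · by_contra hw
      exact h (Finset.mem_image_of_mem _ (Finsupp.mem_support_iff.mpr hw))
  rw [this]
  refine sum_mem fun p hp => ?_
  obtain ⟨u, hu, rfl⟩ := Finset.mem_image.mp hp
  exact Submodule.smul_mem _ _ (hT u (Finsupp.mem_support_iff.mp hu))

theorem desClass_mem (n : ℕ) (I : Finset ℕ) : desClass X n I ∈ DesAlg X :=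
  Submodule.subset_span ⟨(n, I), rfl⟩

/-- Descent classes are indicator functions, and a finitely supported function meets only finitely
many of them. Closure of `Σ` under a product thereby becomes invariance of its coefficients. -/
theorem mem_DesAlg {x : X →₀ ℤ} :
    x ∈ DesAlg X ↔ ∀ u u', deg u = deg u' → des u = des u' → x u = x u' := by
  classical
  refine ⟨fun hx => ?_, fun hx => mem_of_constant hx fun u _ => desClass_mem _ _⟩
  induction hx using Submodule.span_induction with
  | mem x h =>
    obtain ⟨p, rfl⟩ := h
    intro u u' h1 h2
    simp only [desClass_apply, h1, h2]
  | zero => intros; rfl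
  | add x y _ _ hx hy =>
    intro u u' h1 h2
    rw [Finsupp.add_apply, Finsupp.add_apply, hx u u' h1 h2, hy u u' h1 h2]
  | smul c x _ hx =>
    intro u u' h1 h2
    rw [Finsupp.smul_apply, Finsupp.smul_apply, hx u u' h1 h2]

/-- A descent class as an element of their span. -/
def desElt (n : ℕ) (I : Finset ℕ) : DesAlg X := ⟨desClass X n I, desClass_mem n I⟩

theorem desElt_mem (n : ℕ) (I : Finset ℕ) : desElt n I ∈ desGr X n :=
  mem_freeGr fun w hw => by
    classical
    change desClass X n I w ≠ 0 at hw
    rw [desClass_apply] at hw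
    by_contra h
    exact hw (if_neg fun h' => h h'.1)

theorem desGr_le {n : ℕ} {T : Submodule ℤ (DesAlg X)} (hT : ∀ I, desElt n I ∈ T) :
    desGr X n ≤ T := by
  intro x hx
  have : x.1 ∈ T.map (DesAlg X).subtype := by
    refine mem_of_constant (mem_DesAlg.mp x.2) fun u hu => ?_
    have : deg u = n := hx (Finsupp.mem_support_iff.mpr hu)
    rw [this]
    exact ⟨desElt n _, hT _, rfl⟩
  obtain ⟨y, hy, hyx⟩ := this
  rwa [← Subtype.ext hyx]

theorem iSup_desGr : ⨆ n, desGr X n = ⊤ := by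
  rw [eq_top_iff]
  intro x _
  have : x.1 ∈ (⨆ n, desGr X n).map (DesAlg X).subtype :=
    mem_of_constant (mem_DesAlg.mp x.2) fun u _ =>
      ⟨desElt _ _, Submodule.mem_iSup_of_mem _ (desElt_mem _ _), rfl⟩
  obtain ⟨y, hy, hyx⟩ := this
  rwa [← Subtype.ext hyx]

theorem isInternal_desGr : DirectSum.IsInternal (desGr X) :=
  isInternal_of_detect iSup_desGr (fun n => (homProj X n).comp (DesAlg X).subtype)
    (fun n x hx h => by
      change homProj X n x.1 = 0 at h
      exact Subtype.ext ((homProj_of_mem (x := x.1) hx).symm.trans h))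
    (fun m n hmn x hx => homProj_of_mem_ne hmn hx)

theorem kron_desClass (n : ℕ) (I : Finset ℕ) (w : X) (c : ℤ)
    [Decidable (deg w = n ∧ des w = I)] :
    kron X (desClass X n I) (Finsupp.single w c) = if deg w = n ∧ des w = I then c else 0 := by
  rw [kron_single, desClass_apply, mul_ite, mul_one, mul_zero]

theorem chi_apply (f : X →₀ ℤ) (x : DesAlg X) : (chi X f).1 x = kron X x.1 f := rfl

theorem DesDual_ext {φ ψ : DesDual X} (h : ∀ n I, φ.1 (desElt n I) = ψ.1 (desElt n I)) :
    φ = ψ := by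
  refine Subtype.ext (LinearMap.ext fun x => ?_)
  have hx : x ∈ ⨆ n, desGr X n := by rw [iSup_desGr]; trivial
  have hle : ⨆ n, desGr X n ≤ LinearMap.eqLocus φ.1 ψ.1 :=
    iSup_le fun n => desGr_le fun I => h n I
  exact hle hx

theorem chi_single_congr {u u' : X} (h1 : deg u = deg u') (h2 : des u = des u') (c : ℤ) :
    chi X (Finsupp.single u c) = chi X (Finsupp.single u' c) := by
  classical
  refine DesDual_ext fun n I => ?_
  simp only [chi_apply, desElt, kron_desClass, h1, h2]

/-- A representative of the descent class of `u`. -/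
def desRep (u : X) : X :=
  Function.surjInv (Set.rangeFactorization_surjective (f := fun u : X => (deg u, des u)))
    (Set.rangeFactorization _ u)

theorem desRep_key (u : X) : (deg (desRep u), des (desRep u)) = (deg u, des u) :=
  congrArg Subtype.val (Function.surjInv_eq
    (Set.rangeFactorization_surjective (f := fun u : X => (deg u, des u)))
    (Set.rangeFactorization _ u))

theorem deg_desRep (u : X) : deg (desRep u) = deg u := congrArg Prod.fst (desRep_key u)

theorem des_desRep (u : X) : des (desRep u) = des u := congrArg Prod.snd (desRep_key u)

theorem desRep_eq_iff {u u' : X} : desRep u = desRep u' ↔ deg u = deg u' ∧ des u = des u' := by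
  constructor
  · intro h
    rw [← deg_desRep u, ← des_desRep u, h, deg_desRep, des_desRep]
    exact ⟨rfl, rfl⟩
  · rintro ⟨h1, h2⟩
    unfold desRep
    congr 1
    exact Subtype.ext (Prod.ext h1 h2)

variable (X) in
/-- The linear extension of `desRep`. -/
def repLin : (X →₀ ℤ) →ₗ[ℤ] (X →₀ ℤ) := Finsupp.lmapDomain ℤ ℤ desRep

/-- Both sides add up the coefficients of `x` over the descent class of `r`. So `chi X x = 0` forces
`repLin X x = 0`, and a linear map that only sees descent classes vanishes on the kernel of `chi`.
-/
theorem repLin_apply (x : X →₀ ℤ) (r : X) :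
    repLin X x (desRep r) = (chi X x).1 (desElt (deg r) (des r)) := by
  classical
  induction x using Finsupp.induction_linear with
  | zero => simp
  | add x y hx hy =>
    rw [map_add, Finsupp.add_apply, hx, hy, map_add]
    rfl
  | single u c =>
    have : repLin X (Finsupp.single u c) = Finsupp.single (desRep u) c :=
      Finsupp.mapDomain_single
    rw [this, chi_apply]
    simp only [desElt, kron_desClass, Finsupp.single_apply, desRep_eq_iff]

theorem repLin_eq_zero {x : X →₀ ℤ} (hx : chi X x = 0) : repLin X x = 0 := by
  classical
  ext r
  by_cases hr : r ∈ Set.range (desRep (X := X))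
  · obtain ⟨r, rfl⟩ := hr
    rw [repLin_apply, hx]
    rfl
  · exact Finsupp.mapDomain_of_notMem_range x r hr

/-- An element of the graded dual is given by its values on the finitely many nonempty classes below
some degree. Placing each value at a representative of its class gives a preimage. -/
theorem chi_surjective : Function.Surjective (chi X) := by
  classical
  intro φ
  obtain ⟨N, hN⟩ := φ.2
  have hfin : {u : X | deg u < N}.Finite := by
    have : {u : X | deg u < N} = ⋃ n ∈ Set.Iio N, {u : X | deg u = n} := by
      ext u; simp
    rw [this]
    exact (Set.finite_Iio N).biUnion fun n _ => finite_deg n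
  refine ⟨∑ r ∈ hfin.toFinset.image desRep,
    Finsupp.single r (φ.1 (desElt (deg r) (des r))), DesDual_ext fun n I => ?_⟩
  rw [chi_apply, map_sum]
  simp only [desElt, kron_desClass]
  by_cases h : ∃ u : X, deg u = n ∧ des u = I
  · obtain ⟨u, rfl, rfl⟩ := h
    rw [Finset.sum_eq_single (desRep u)]
    · rw [if_pos ⟨deg_desRep u, des_desRep u⟩, deg_desRep, des_desRep]
    · intro r hr hne
      obtain ⟨u', -, rfl⟩ := Finset.mem_image.mp hr
      refine if_neg fun h => hne ?_
      rw [deg_desRep, des_desRep] at h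
      exact desRep_eq_iff.mpr h
    · intro hu
      rw [if_pos ⟨deg_desRep u, des_desRep u⟩, deg_desRep, des_desRep]
      refine hN _ ?_ _ (desElt_mem _ _)
      by_contra h'
      exact hu (Finset.mem_image_of_mem _ (hfin.mem_toFinset.mpr (not_le.mp h')))
  · rw [Finset.sum_eq_zero fun r _ => if_neg fun h' => h ⟨r, h'⟩]
    have : (desElt n I : DesAlg X) = 0 := by
      refine Subtype.ext (Finsupp.ext fun w => ?_)
      change desClass X n I w = 0
      rw [desClass_apply, if_neg fun h' => h ⟨w, h'⟩]
    change 0 = φ.1 (desElt n I)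
    rw [this, map_zero]

/-- A degree is detected by the values of a functional on that degree of `Σ`. A submodule `N` is
allowed in order to cover `Λ` and, with `N = ⊤`, the whole graded dual. -/
theorem isInternal_of_dual {N : Submodule ℤ (DesDual X)}
    (htop : ⨆ n, (dualGr X n).comap N.subtype = ⊤) :
    DirectSum.IsInternal fun n => (dualGr X n).comap N.subtype := by
  classical
  -- Values outside degree `n` are replaced by zero. The result need not be linear in `x`; only
  -- linearity in `φ` matters.
  let π : ∀ n : ℕ, N →ₗ[ℤ] (DesAlg X → ℤ) := fun n =>
    { toFun := fun φ x => if x ∈ desGr X n then φ.1.1 x else 0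
      map_add' := fun φ ψ => by
        ext x
        by_cases h : x ∈ desGr X n
        · simp only [Pi.add_apply, if_pos h]; rfl
        · simp only [Pi.add_apply, if_neg h, add_zero]
      map_smul' := fun c φ => by
        ext x
        by_cases h : x ∈ desGr X n
        · simp only [Pi.smul_apply, if_pos h]; rfl
        · simp only [Pi.smul_apply, if_neg h, smul_zero] }
  refine isInternal_of_detect htop π (fun n φ hφ h => ?_) (fun m n hmn φ hφ => ?_)
  · refine Subtype.ext (DesDual_ext fun m I => ?_)
    by_cases hm : m = n
    · subst hm
      have h1 := congrFun h (desElt m I)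
      simp only [π, LinearMap.coe_mk, AddHom.coe_mk, if_pos (desElt_mem m I)] at h1
      exact h1
    · exact hφ m hm _ (desElt_mem m I)
  · ext x
    simp only [π, LinearMap.coe_mk, AddHom.coe_mk, Pi.zero_apply]
    split_ifs with h
    · exact hφ n hmn.symm x h
    · rfl

theorem iSup_eq_top_of_surjective {M N : Type} [AddCommGroup M] [AddCommGroup N] [Module ℤ M]
    [Module ℤ N] {ℳ : ℕ → Submodule ℤ M} {𝒩 : ℕ → Submodule ℤ N} (hM : ⨆ n, ℳ n = ⊤)
    {f : M →ₗ[ℤ] N} (hf : ∀ n, ∀ x ∈ ℳ n, f x ∈ 𝒩 n) (hs : Function.Surjective f) :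
    ⨆ n, 𝒩 n = ⊤ := by
  rw [eq_top_iff, ← LinearMap.range_eq_top.mpr hs, LinearMap.range_eq_map, ← hM, Submodule.map_iSup]
  exact iSup_mono fun n => by
    rintro _ ⟨x, hx, rfl⟩
    exact hf n x hx

end Classes

/-! #### The maps of the diamond -/

namespace IsCut

variable {P X : Type} [DescentFamily P] [DescentFamily X] {B : Cut P P} {C : Cut P X}

theorem evalPairing_chi' (h : IsCut B C) (x : DesAlg X) (f : X →₀ ℤ) :
    evalPairing X x (chi' X f) = kronInv X ((DesAlg X).subtype x) f :=
  (h.kron_invLin x.1 f).symm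

theorem chi'_surjective (h : IsCut B C) : Function.Surjective (chi' X) :=
  chi_surjective.comp h.invLin_bijective.2

theorem chi'_mem (h : IsCut B C) {n : ℕ} {f : X →₀ ℤ} (hf : f ∈ freeGr X n) :
    chi' X f ∈ dualGr X n := fun m hm x hx =>
  (h.evalPairing_chi' x f).trans (h.isGradedPairing_kronInv.orthogonal m n hm _ hx _ hf)

theorem isInternal_dualGr (h : IsCut B C) : DirectSum.IsInternal (dualGr X) := by
  have htop : ⨆ n, dualGr X n = ⊤ :=
    iSup_eq_top_of_surjective iSup_freeGr (fun _ _ hx => h.chi'_mem hx) h.chi'_surjective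
  -- The grading is obtained on `⊤` as a submodule and then transported to the module itself.
  have h1 : DirectSum.IsInternal fun n => (dualGr X n).comap (⊤ : Submodule ℤ (DesDual X)).subtype :=
    isInternal_of_dual (iSup_eq_top_of_surjective
      (f := (LinearEquiv.ofTop (⊤ : Submodule ℤ (DesDual X)) rfl).symm.toLinearMap)
      htop (fun _ _ hx => hx) (LinearEquiv.surjective _))
  refine DirectSum.isInternal_submodule_of_iSupIndep_of_iSup_eq_top ?_ htop
  have h2 := h1.submodule_iSupIndep
  have h3 := h2.map_orderIso (Submodule.orderIsoMapComap
    (LinearEquiv.ofTop (⊤ : Submodule ℤ (DesDual X)) rfl))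
  convert h3 using 1
  ext n x
  constructor
  · intro hx
    exact ⟨⟨x, trivial⟩, hx, rfl⟩
  · rintro ⟨y, hy, rfl⟩
    exact hy

theorem chiLam_surjective : Function.Surjective (chiLam X) :=
  LinearMap.submoduleMap_surjective (chi' X) (DesAlg X)

theorem chiLam_mem (h : IsCut B C) {n : ℕ} {x : DesAlg X} (hx : x ∈ desGr X n) :
    chiLam X x ∈ lamGr X n := h.chi'_mem (f := x.1) hx

theorem isInternal_lamGr (h : IsCut B C) : DirectSum.IsInternal (lamGr X) :=
  isInternal_of_dual (iSup_eq_top_of_surjective iSup_desGr (fun _ _ hx => h.chiLam_mem hx)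
    chiLam_surjective)

/-! #### Closure properties -/

/-- By `glue_apply` the coefficient at `w` is a sum over the cuts of `w`, and the descents of both
halves are determined by those of `w`. -/
theorem glue_mem_DesAlg (h : IsCut B C) {x : X →₀ ℤ} (hx : x ∈ DesAlg X) {a : P →₀ ℤ}
    (ha : a ∈ DesAlg P) : C.glue x a ∈ DesAlg X := by
  rw [mem_DesAlg] at hx ha ⊢
  intro w w' h1 h2
  rw [h.glue_apply, h.glue_apply, ← h1]
  refine Finset.sum_congr rfl fun i hi => ?_
  rw [Finset.mem_Icc] at hi
  have hi' : i ≤ deg w' := by rw [← h1]; exact hi.2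
  rw [hx _ (C.fst i w') (by rw [h.deg_fst hi.1 hi.2, h.deg_fst hi.1 hi'])
      (h.des_fst h1 h2 hi.1 hi.2),
    ha _ (C.snd i w') (by rw [h.deg_snd hi.1 hi.2, h.deg_snd hi.1 hi', h1])
      (h.des_snd h1 h2 hi.1 hi.2)]

/-- The elements of a descent class which occur in the shuffle product of `u` and `v`. -/
def shuffleClass (C : Cut P X) (n : ℕ) (K : Finset ℕ) (u : X) (v : P) : Finset X :=
  open Classical in
  {w ∈ {w ∈ (finite_deg (X := X) n).toFinset | des w = K} |
    (invt (C.fst (deg u) (invt w)), invt (C.snd (deg u) (invt w))) = (u, v)}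

theorem mem_shuffleClass {n : ℕ} {K : Finset ℕ} {u : X} {v : P} {w : X} (hB : IsCut B B)
    (h : IsCut B C) : w ∈ shuffleClass C n K u v ↔ deg w = n ∧ des w = K ∧
      C.fst (deg u) (invt w) = invt u ∧ C.snd (deg u) (invt w) = invt v := by
  simp only [shuffleClass, Finset.mem_filter, Set.Finite.mem_toFinset, Set.mem_ofPred_eq,
    Prod.mk.injEq, and_assoc]
  refine and_congr_right fun _ => and_congr_right fun _ => and_congr ⟨?_, ?_⟩ ⟨?_, ?_⟩
  · intro h'; rw [← h.invt_invt (C.fst _ _), h']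
  · intro h'; rw [h', h.invt_invt]
  · intro h'; rw [← hB.invt_invt (C.snd _ _), h']
  · intro h'; rw [h', hB.invt_invt]

/-- The exchange map embeds one set into the other. Used in both directions it gives equality of the
cardinalities. -/
theorem card_shuffleClass_le (hB : IsCut B B) (h : IsCut B C) {n : ℕ} {K : Finset ℕ} {u u' : X}
    {v v' : P} (hn : deg u + deg v = n) (h1 : deg u = deg u') (h2 : des u = des u')
    (h3 : deg v = deg v') (h4 : des v = des v') :
    (shuffleClass C n K u v).card ≤ (shuffleClass C n K u' v').card := by
  obtain ⟨g, hg, hg'⟩ := h.exchange h1 h2 h3 h4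
  refine Finset.card_le_card_of_injOn g (fun w hw => ?_) hg.injOn
  rw [Finset.mem_coe, mem_shuffleClass hB h] at hw ⊢
  obtain ⟨e1, e2, e3, e4⟩ := hg' w (hw.1.trans hn.symm) hw.2.2.1 hw.2.2.2
  rw [← h1]
  exact ⟨e1.trans hw.1, e4.trans hw.2.1, e2, e3⟩

/-- The coproduct of a descent class is a combination of tensor products of descent classes. -/
theorem exists_coact_desElt (hB : IsCut B B) (h : IsCut B C) (n : ℕ) (K : Finset ℕ) :
    ∃ t ∈ tensorGr (desGr X) (desGr P) n,
      TensorProduct.map (DesAlg X).subtype (DesAlg P).subtype t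
        = C.cup.coact (desClass X n K) := by
  classical
  let W : Finset X := {w ∈ (finite_deg (X := X) n).toFinset | des w = K}
  have hW : ∀ w ∈ W, deg w = n := fun w hw => by
    simp only [W, Finset.mem_filter, Set.Finite.mem_toFinset, Set.mem_ofPred_eq] at hw
    exact hw.1
  let g : X × P → (X →₀ ℤ) ⊗[ℤ] (P →₀ ℤ) := fun p =>
    Finsupp.single p.1 1 ⊗ₜ[ℤ] Finsupp.single p.2 1
  -- The two parts of `w` when its values are cut at `i`.
  let F : ℕ → X → X × P := fun i w =>
    (invt (C.fst i (invt w)), invt (C.snd i (invt w)))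
  have hsum : C.cup.coact (desClass X n K)
      = ∑ i ∈ Finset.Icc C.lo n, ∑ w ∈ W, g (F i w) := by
    rw [desClass, map_sum, Finset.sum_comm]
    refine Finset.sum_congr rfl fun w hw => ?_
    change TensorProduct.map (invLin X) (invLin P) (C.split (invLin X (Finsupp.single w 1))) = _
    rw [invLin_single, C.split_single, one_smul, map_sum, h.deg_invt, hW w hw]
    refine Finset.sum_congr rfl fun i _ => ?_
    rw [TensorProduct.map_tmul, invLin_single, invLin_single]
  suffices H : ∀ i ∈ Finset.Icc C.lo n, ∃ t ∈ tensorGr (desGr X) (desGr P) n,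
      TensorProduct.map (DesAlg X).subtype (DesAlg P).subtype t = ∑ w ∈ W, g (F i w) by
    choose! t ht ht' using H
    refine ⟨∑ i ∈ Finset.Icc C.lo n, t i, sum_mem ht, ?_⟩
    rw [map_sum, hsum]
    exact Finset.sum_congr rfl ht'
  intro i hi
  rw [Finset.mem_Icc] at hi
  let U : Finset X := (finite_deg (X := X) i).toFinset
  let V : Finset P := (finite_deg (X := P) (n - i)).toFinset
  have hU : ∀ u, u ∈ U ↔ deg u = i := fun u => by
    simp only [U, Set.Finite.mem_toFinset, Set.mem_ofPred_eq]
  have hV : ∀ v, v ∈ V ↔ deg v = n - i := fun v => by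
    simp only [V, Set.Finite.mem_toFinset, Set.mem_ofPred_eq]
  -- The coefficient of `u ⊗ v` is the size of `shuffleClass C n K u v`. By the exchange property it
  -- depends only on the descents, so any pair with descents `I` and `J` may be chosen to define it.
  let c : Finset ℕ → Finset ℕ → ℕ := fun I J =>
    if hc : ∃ p : X × P, p.1 ∈ U ∧ p.2 ∈ V ∧ des p.1 = I ∧ des p.2 = J then
      (shuffleClass C n K hc.choose.1 hc.choose.2).card else 0
  have hc : ∀ u ∈ U, ∀ v ∈ V, (shuffleClass C n K u v).card = c (des u) (des v) := by
    intro u hu v hv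
    have hex : ∃ p : X × P, p.1 ∈ U ∧ p.2 ∈ V ∧ des p.1 = des u ∧ des p.2 = des v :=
      ⟨(u, v), hu, hv, rfl, rfl⟩
    obtain ⟨e1, e2, e3, e4⟩ := hex.choose_spec
    simp only [c, dif_pos hex]
    rw [hU] at hu e1
    rw [hV] at hv e2
    exact le_antisymm
      (card_shuffleClass_le hB h (by omega) (hu.trans e1.symm) e3.symm (hv.trans e2.symm) e4.symm)
      (card_shuffleClass_le hB h (by omega) (e1.trans hu.symm) e3 (e2.trans hv.symm) e4)
  have hF : ∀ w ∈ W, F i w ∈ U ×ˢ V := by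
    intro w hw
    have hdeg : i ≤ deg (invt w) := by rw [h.deg_invt, hW w hw]; exact hi.2
    rw [Finset.mem_product, hU, hV]
    simp only [F]
    rw [h.deg_invt, hB.deg_invt, h.deg_fst hi.1 hdeg, h.deg_snd hi.1 hdeg, h.deg_invt, hW w hw]
    exact ⟨rfl, rfl⟩
  have h1 : ∑ w ∈ W, g (F i w)
      = ∑ u ∈ U, ∑ v ∈ V, c (des u) (des v) • g (u, v) := by
    rw [← Finset.sum_fiberwise_of_maps_to hF, Finset.sum_product]
    refine Finset.sum_congr rfl fun u hu => Finset.sum_congr rfl fun v hv => ?_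
    rw [← hc u hu v hv]
    have : shuffleClass C n K u v = {w ∈ W | F i w = (u, v)} := by
      ext w
      simp only [shuffleClass, (hU u).mp hu, W, F]
    rw [this, ← Finset.sum_const]
    refine Finset.sum_congr rfl fun w hw => ?_
    rw [(Finset.mem_filter.mp hw).2]
  have hdX : ∀ I, desClass X i I = ∑ u ∈ U with des u = I, Finsupp.single u 1 := fun I => rfl
  have hdP : ∀ J, desClass P (n - i) J = ∑ v ∈ V with des v = J, Finsupp.single v 1 :=
    fun J => rfl
  refine ⟨∑ I ∈ U.image des, ∑ J ∈ V.image des,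
    c I J • (desElt i I ⊗ₜ[ℤ] desElt (n - i) J), ?_, ?_⟩
  · exact sum_mem fun I _ => sum_mem fun J _ => nsmul_mem
      (tmul_mem_tensorGr (by omega) (desElt_mem _ _) (desElt_mem _ _)) _
  · have hst : ∀ I J, TensorProduct.map (DesAlg X).subtype (DesAlg P).subtype
        (desElt i I ⊗ₜ[ℤ] desElt (n - i) J) = ∑ u ∈ U with des u = I, ∑ v ∈ V with des v = J,
          g (u, v) := by
      intro I J
      rw [TensorProduct.map_tmul]
      change desClass X i I ⊗ₜ[ℤ] desClass P (n - i) J = _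
      rw [hdX, hdP, TensorProduct.sum_tmul]
      refine Finset.sum_congr rfl fun u _ => ?_
      rw [TensorProduct.tmul_sum]
    rw [h1, map_sum, ← Finset.sum_fiberwise_of_maps_to (s := U) (t := U.image des) (g := des)
      fun u hu => Finset.mem_image_of_mem _ hu]
    refine Finset.sum_congr rfl fun I _ => ?_
    rw [map_sum]
    have h2 : ∀ u ∈ U, ∑ v ∈ V, c (des u) (des v) • g (u, v)
        = ∑ J ∈ V.image des, ∑ v ∈ V with des v = J, c (des u) (des v) • g (u, v) := fun u _ =>
      (Finset.sum_fiberwise_of_maps_to (fun v hv => Finset.mem_image_of_mem _ hv) _).symm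
    rw [Finset.sum_congr rfl fun u hu => h2 u (Finset.mem_filter.mp hu).1, Finset.sum_comm]
    refine Finset.sum_congr rfl fun J _ => ?_
    rw [map_nsmul, hst, Finset.smul_sum]
    refine Finset.sum_congr rfl fun u hu => ?_
    rw [Finset.smul_sum]
    refine Finset.sum_congr rfl fun v hv => ?_
    rw [(Finset.mem_filter.mp hu).2, (Finset.mem_filter.mp hv).2]

end IsCut

end Diamond

end

open scoped TensorProduct
noncomputable section

attribute [local instance 2000] TensorProduct.instModule

/-! ### Structures, homomorphisms and forms on the corners of the diamond. -/

section DiamondOps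

open DescentFamily

namespace IsCut

variable {P X : Type} [DescentFamily P] [DescentFamily X] {B : Cut P P} {C : Cut P X} {e : P}

/-- The modules are torsion-free over `ℤ`, hence flat, so tensoring preserves injectivity. This
allows coproducts to be restricted and coproduct identities to be pulled back. -/
theorem subtype_tensor_injective :
    Function.Injective (TensorProduct.map (DesAlg X).subtype (DesAlg P).subtype) :=
  TensorProduct.map_injective_of_flat_flat_of_isDomain _ _ (DesAlg X).subtype_injective
    (DesAlg P).subtype_injective

theorem lam_subtype_tensor_injective :
    Function.Injective (TensorProduct.map (Lam X).subtype (Lam P).subtype) :=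
  TensorProduct.map_injective_of_flat_flat_of_isDomain _ _ (Lam X).subtype_injective
    (Lam P).subtype_injective

theorem subtype_tensor_injective₃ : Function.Injective (TensorProduct.map (DesAlg X).subtype
    (TensorProduct.map (DesAlg P).subtype (DesAlg P).subtype)) :=
  TensorProduct.map_injective_of_flat_flat_of_isDomain _ _ (DesAlg X).subtype_injective
    subtype_tensor_injective

/-- The operations on the span of the descent classes. -/
theorem exists_desOps (hB : IsCut B B) (h : IsCut B C) :
    ∃ XS : ModComodOps ℤ (DesAlg P) (DesAlg X),
      IsModComodHom (desGr X) (freeGr X) XS C.cup (DesAlg P).subtype (DesAlg X).subtype ∧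
      ∀ n, ∀ x ∈ desGr X n, XS.coact x ∈ tensorGr (desGr X) (desGr P) n := by
  obtain ⟨XS, h1, h2⟩ := exists_ops_of_injective (f := (DesAlg X).subtype)
    (φ := (DesAlg P).subtype) C.cup (DesAlg X).subtype_injective subtype_tensor_injective
    (fun x a => by
      rw [Submodule.range_subtype]
      exact h.glue_mem_DesAlg x.2 a.2)
    (fun x => by
      have hx : x ∈ ⨆ n, desGr X n := by rw [iSup_desGr]; trivial
      have hle : ⨆ n, desGr X n ≤ (LinearMap.range (TensorProduct.map (DesAlg X).subtype
          (DesAlg P).subtype)).comap (C.cup.coact.comp (DesAlg X).subtype) :=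
        iSup_le fun n => desGr_le fun I => by
          obtain ⟨t, -, ht⟩ := exists_coact_desElt hB h n I
          exact ⟨t, ht⟩
      exact hle hx)
  refine ⟨XS, ⟨fun n x hx => hx, h1, h2⟩, fun n => ?_⟩
  have hle : desGr X n ≤ (tensorGr (desGr X) (desGr P) n).comap XS.coact := desGr_le fun I => by
    obtain ⟨t, ht, ht'⟩ := exists_coact_desElt hB h n I
    have : XS.coact (desElt n I) = t :=
      subtype_tensor_injective (((h2 (desElt n I)).symm.trans rfl).trans ht'.symm)
    change XS.coact (desElt n I) ∈ tensorGr (desGr X) (desGr P) n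
    rwa [this]
  exact hle

/-- After undoing inversions, the map is `χ ⊗ χ` applied to `split`. Its value at `w` depends only
on the degree and descents of `w`, as those of both halves do. So it factors through `repLin`, which
vanishes on the kernel of `χ`. -/
theorem chi'_comul_eq_zero (h : IsCut B C) {x : X →₀ ℤ} (hx : chi' X x = 0)
    (hB : IsCut B B) : TensorProduct.map (chi' X) (chi' P) (C.cup.coact x) = 0 := by
  let G : (X →₀ ℤ) →ₗ[ℤ] DesDual X ⊗[ℤ] DesDual P :=
    (TensorProduct.map (chi X) (chi P)).comp C.split
  have hG : ∀ y, G y = G (repLin X y) := by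
    intro y
    induction y using Finsupp.induction_linear with
    | zero => simp
    | add y z hy hz => simp only [map_add, hy, hz]
    | single w c =>
      have hw : repLin X (Finsupp.single w c) = Finsupp.single (desRep w) c :=
        Finsupp.mapDomain_single
      rw [hw]
      simp only [G, LinearMap.comp_apply, C.split_single, deg_desRep]
      rw [map_smul, map_smul, map_sum, map_sum]
      congr 1
      refine Finset.sum_congr rfl fun i hi => ?_
      rw [Finset.mem_Icc] at hi
      have hi' : i ≤ deg (desRep w) := by rw [deg_desRep]; exact hi.2
      rw [TensorProduct.map_tmul, TensorProduct.map_tmul,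
        chi_single_congr (u := C.fst i w) (u' := C.fst i (desRep w))
          (by rw [h.deg_fst hi.1 hi.2, h.deg_fst hi.1 hi'])
          (h.des_fst (deg_desRep w).symm (des_desRep w).symm hi.1 hi.2),
        chi_single_congr (u := C.snd i w) (u' := C.snd i (desRep w))
          (by rw [h.deg_snd hi.1 hi.2, h.deg_snd hi.1 hi', deg_desRep])
          (h.des_snd (deg_desRep w).symm (des_desRep w).symm hi.1 hi.2)]
  have h1 : TensorProduct.map (chi' X) (chi' P) (C.cup.coact x) = G (invLin X x) := by
    change TensorProduct.map (chi' X) (chi' P)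
      (TensorProduct.map (invLin X) (invLin P) (C.split (invLin X x)))
      = TensorProduct.map (chi X) (chi P) (C.split (invLin X x))
    generalize C.split (invLin X x) = t
    induction t using TensorProduct.induction_on with
    | zero => simp
    | add s t hs ht => simp only [map_add, hs, ht]
    | tmul y a =>
      simp only [TensorProduct.map_tmul, chi', LinearMap.comp_apply, h.invLin_invLin,
        hB.invLin_invLin]
  rw [h1, hG, repLin_eq_zero (x := invLin X x) hx, map_zero]

/-- The operations on the graded dual of the span of the descent classes. -/
theorem exists_dualOps (hB : IsCut B B) (h : IsCut B C)
    {XS : ModComodOps ℤ (DesAlg P) (DesAlg X)}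
    (hS : IsModComodHom (desGr X) (freeGr X) XS C.cup (DesAlg P).subtype (DesAlg X).subtype) :
    ∃ XT : ModComodOps ℤ (DesDual P) (DesDual X),
      IsModComodHom (freeGr X) (dualGr X) C.cup XT (chi' P) (chi' X) := by
  -- The product is the transpose of the coproduct of `Σ`, so its value on `Σ` only depends on the
  -- images of the factors under `χ'`. The kernel condition for the coaction is instead
  -- `chi'_comul_eq_zero`.
  have key : ∀ (y : DesAlg X) x a, (chi' X (C.cup.act x a)).1 y
      = tensorPairing (evalPairing X) (evalPairing P) (XS.coact y)
        (chi' X x ⊗ₜ[ℤ] chi' P a) := by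
    intro y x a
    have h1 := h.evalPairing_chi' y (C.cup.act x a)
    have h2 := (cup_selfDual hB h).coact_act ((DesAlg X).subtype y) x a
    have h3 := tensorPairing_map (p := kronInv X) (q := kronInv P) h.evalPairing_chi'
      hB.evalPairing_chi' (XS.coact y) (x ⊗ₜ[ℤ] a)
    rw [TensorProduct.map_tmul] at h3
    rw [h3, ← hS.map_coact, ← h2]
    exact h1
  obtain ⟨XT, h1, h2⟩ := exists_ops_of_surjective (f := chi' X) (φ := chi' P) C.cup
    hB.chi'_surjective h.chi'_surjective
    (fun x a hx => Subtype.ext (LinearMap.ext fun y => by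
      rw [key, hx, TensorProduct.zero_tmul, map_zero]; rfl))
    (fun x a ha => Subtype.ext (LinearMap.ext fun y => by
      rw [key, ha, TensorProduct.tmul_zero, map_zero]; rfl))
    (fun x hx => h.chi'_comul_eq_zero hx hB)
  exact ⟨XT, fun n x hx => h.chi'_mem hx, h1, h2⟩

/-- The operations on the image of the span of the descent classes in its graded dual. -/
theorem exists_lamOps (h : IsCut B C)
    {XS : ModComodOps ℤ (DesAlg P) (DesAlg X)} {XT : ModComodOps ℤ (DesDual P) (DesDual X)}
    (hS : IsModComodHom (desGr X) (freeGr X) XS C.cup (DesAlg P).subtype (DesAlg X).subtype)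
    (hT : IsModComodHom (freeGr X) (dualGr X) C.cup XT (chi' P) (chi' X)) :
    ∃ XL : ModComodOps ℤ (Lam P) (Lam X),
      IsModComodHom (desGr X) (lamGr X) XS XL (chiLam P) (chiLam X) ∧
      IsModComodHom (lamGr X) (dualGr X) XL XT (Lam P).subtype (Lam X).subtype := by
  have hact : ∀ x a, (Lam X).subtype (chiLam X (XS.act x a))
      = XT.act ((Lam X).subtype (chiLam X x)) ((Lam P).subtype (chiLam P a)) := by
    intro x a
    change chi' X ((DesAlg X).subtype (XS.act x a)) = _
    rw [hS.map_act, hT.map_act]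
    rfl
  have hco : ∀ x, TensorProduct.map (Lam X).subtype (Lam P).subtype
      (TensorProduct.map (chiLam X) (chiLam P) (XS.coact x))
      = XT.coact ((Lam X).subtype (chiLam X x)) := by
    intro x
    change _ = XT.coact (chi' X ((DesAlg X).subtype x))
    rw [hT.map_coact, hS.map_coact]
    generalize XS.coact x = t
    induction t using TensorProduct.induction_on with
    | zero => simp
    | add s t hs ht => simp only [map_add, hs, ht]
    | tmul y a => rfl
  obtain ⟨XL, h1, h2, h3, h4⟩ := exists_ops_of_image XS XT chiLam_surjective
    chiLam_surjective (Lam X).subtype_injective lam_subtype_tensor_injective hact hco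
  exact ⟨XL, ⟨fun n x hx => h.chiLam_mem hx, h1, h2⟩, ⟨fun n x hx => hx, h3, h4⟩⟩

/-- The form on `Λ`. -/
theorem exists_lamForm (h : IsCut B C) : ∃ b : Lam X →ₗ[ℤ] Lam X →ₗ[ℤ] ℤ,
    ∀ x y, b (chiLam X x) y = evalPairing X x ((Lam X).subtype y) := by
  -- By symmetry of `kronInv`, the value of `χ'(z)` at `x` is the value of `χ'(x)` at `z`. It
  -- therefore depends on `x` only through `χ'(x)`.
  have key : ∀ x x' : DesAlg X, chiLam X x = chiLam X x' → ∀ y,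
      evalPairing X x ((Lam X).subtype y) = evalPairing X x' ((Lam X).subtype y) := by
    intro x x' hxx' y
    obtain ⟨z, rfl⟩ := chiLam_surjective y
    change evalPairing X x (chi' X z.1) = evalPairing X x' (chi' X z.1)
    have e : ∀ x : DesAlg X, evalPairing X x (chi' X z.1) = evalPairing X z (chi' X x.1) := by
      intro x
      rw [h.evalPairing_chi', h.evalPairing_chi', h.kronInv_comm]
      rfl
    rw [e, e]
    exact congrArg (fun y : Lam X => y.1.1 z) hxx'
  let s : Lam X → DesAlg X := Function.surjInv chiLam_surjective
  have hs : ∀ y, chiLam X (s y) = y := Function.surjInv_eq chiLam_surjective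
  refine ⟨LinearMap.mk₂ ℤ (fun x y => evalPairing X (s x) ((Lam X).subtype y)) ?_ ?_ ?_ ?_, ?_⟩
  · intro x x' y
    rw [← LinearMap.add_apply, ← map_add]
    exact key _ _ (by rw [map_add, hs, hs, hs]) y
  · intro c x y
    rw [← LinearMap.smul_apply, ← map_smul]
    exact key _ _ (by rw [map_smul, hs, hs]) y
  · intro x y y'
    rw [map_add, map_add]
  · intro c x y
    rw [map_smul, map_smul]
  · intro x y
    exact key _ _ (hs _) y

theorem lamForm_chiLam (h : IsCut B C) {b : Lam X →ₗ[ℤ] Lam X →ₗ[ℤ] ℤ}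
    (hb : ∀ x y, b (chiLam X x) y = evalPairing X x ((Lam X).subtype y)) (x y : DesAlg X) :
    b (chiLam X x) (chiLam X y) = kronInv X x.1 y.1 :=
  (hb x _).trans (h.evalPairing_chi' x y.1)

theorem isLamForm (h : IsCut B C) {b : Lam X →ₗ[ℤ] Lam X →ₗ[ℤ] ℤ}
    (hb : ∀ x y, b (chiLam X x) y = evalPairing X x ((Lam X).subtype y)) : IsLamForm X b := by
  classical
  have hval : ∀ m n I J, b (lamElt X m I) (lamElt X n J)
      = ∑ w ∈ (finite_deg (X := X) n).toFinset with des w = J,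
        if deg w = m ∧ des (invt w) = I then 1 else 0 := by
    intro m n I J
    rw [lamElt, lamElt, h.lamForm_chiLam hb]
    change kron X (invLin X (desClass X m I)) (desClass X n J) = _
    conv_lhs => rw [desClass.eq_1 X n J, map_sum]
    refine Finset.sum_congr rfl fun w _ => ?_
    rw [kron_single, one_mul, h.invLin_apply, desClass_apply, h.deg_invt]
  refine ⟨fun n I J => ?_, fun m n I J hmn => ?_, fun x y => ?_⟩
  · rw [hval, Finset.sum_ite, Finset.sum_const_zero, add_zero, Finset.sum_const, nsmul_eq_mul,
      mul_one, ← Set.ncard_coe_finset]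
    congr 2
    ext w
    simp only [Finset.coe_filter, Finset.mem_filter, Set.Finite.mem_toFinset, Set.mem_ofPred_eq]
    tauto
  · rw [hval]
    refine Finset.sum_eq_zero fun w hw => if_neg ?_
    simp only [Finset.mem_filter, Set.Finite.mem_toFinset, Set.mem_ofPred_eq] at hw
    omega
  · obtain ⟨x, rfl⟩ := chiLam_surjective x
    obtain ⟨y, rfl⟩ := chiLam_surjective y
    rw [h.lamForm_chiLam hb, h.lamForm_chiLam hb, h.kronInv_comm]

/-- An element orthogonal to all `χ'(x)` is a functional that vanishes on `Σ`, hence zero; symmetry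
covers the other argument. -/
theorem isGradedPairing_lamForm (h : IsCut B C) {b : Lam X →ₗ[ℤ] Lam X →ₗ[ℤ] ℤ}
    (hb : ∀ x y, b (chiLam X x) y = evalPairing X x ((Lam X).subtype y)) :
    IsGradedPairing (lamGr X) (lamGr X) b where
  nondegenerate := by
    have h0 : ∀ y, (∀ x, b x y = 0) → y = 0 := fun y hy =>
      Subtype.ext (Subtype.ext (LinearMap.ext fun x => (hb x y).symm.trans (hy _)))
    exact ⟨fun x hx => h0 x fun y => by rw [(h.isLamForm hb).symm]; exact hx y, h0⟩
  orthogonal i j hij x hx y hy := by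
    obtain ⟨x, hx', rfl⟩ := exists_mem_of_map_mem isInternal_desGr h.isInternal_lamGr
      (fun n x hx => h.chiLam_mem hx) chiLam_surjective i x hx
    exact (hb x y).trans (hy i hij x hx')

theorem isGradedPairing_eval (h : IsCut B C) :
    IsGradedPairing (desGr X) (dualGr X) (evalPairing X) where
  nondegenerate := ⟨fun x hx => Subtype.ext (h.isGradedPairing_kronInv.nondegenerate.1 _ fun f =>
      (h.evalPairing_chi' x f).symm.trans (hx _)),
    fun _ hφ => Subtype.ext (LinearMap.ext hφ)⟩
  orthogonal i _ hij x hx _ hφ := hφ i hij x hx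

theorem single_unit_mem (he : IsCutUnit B e) : Finsupp.single e 1 ∈ DesAlg P := by
  classical
  rw [mem_DesAlg]
  intro u u' h1 _
  rw [Finsupp.single_apply, Finsupp.single_apply]
  refine if_congr ⟨?_, ?_⟩ rfl rfl
  · rintro rfl; exact (he.eq_unit u' (by rw [← h1, he.deg_unit])).symm
  · rintro rfl; exact (he.eq_unit u (by rw [h1, he.deg_unit])).symm

set_option maxHeartbeats 1000000 in
/-- The diamond, in types A and D at the same time. -/
theorem exists_diamond (hB : IsCut B B) (h : IsCut B C) (he : IsCutUnit B e)
    (hH : IsConnectedBialgebra (freeGr P) (B.cupHopf e)) :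
    ∃ (HS : HopfOps ℤ (DesAlg P)) (HT : HopfOps ℤ (DesDual P)) (HL : HopfOps ℤ (Lam P))
      (XS : ModComodOps ℤ (DesAlg P) (DesAlg X)) (XT : ModComodOps ℤ (DesDual P) (DesDual X))
      (XL : ModComodOps ℤ (Lam P) (Lam X))
      (bA : Lam P →ₗ[ℤ] Lam P →ₗ[ℤ] ℤ) (bD : Lam X →ₗ[ℤ] Lam X →ₗ[ℤ] ℤ),
      IsGradedHopf (desGr P) HS ∧
      IsGradedHopf (dualGr P) HT ∧
      IsGradedHopf (lamGr P) HL ∧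
      IsHopfHom (desGr P) (freeGr P) HS (B.cupHopf e) (DesAlg P).subtype ∧
      IsHopfHom (freeGr P) (dualGr P) (B.cupHopf e) HT (chi' P) ∧
      IsHopfHom (desGr P) (lamGr P) HS HL (chiLam P) ∧
      IsHopfHom (lamGr P) (dualGr P) HL HT (Lam P).subtype ∧
      IsGradedModComod (desGr P) (desGr X) HS XS ∧
      IsGradedModComod (dualGr P) (dualGr X) HT XT ∧
      IsGradedModComod (lamGr P) (lamGr X) HL XL ∧
      IsModComodHom (desGr X) (freeGr X) XS C.cup (DesAlg P).subtype (DesAlg X).subtype ∧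
      IsModComodHom (freeGr X) (dualGr X) C.cup XT (chi' P) (chi' X) ∧
      IsModComodHom (desGr X) (lamGr X) XS XL (chiLam P) (chiLam X) ∧
      IsModComodHom (lamGr X) (dualGr X) XL XT (Lam P).subtype (Lam X).subtype ∧
      (chi' X).comp (DesAlg X).subtype = (Lam X).subtype.comp (chiLam X) ∧
      Function.Injective (DesAlg X).subtype ∧
      Function.Surjective (chi' X) ∧
      Function.Surjective (chiLam X) ∧
      Function.Injective (Lam X).subtype ∧
      IsLamForm P bA ∧
      IsLamForm X bD ∧
      IsHopfDual (desGr P) (dualGr P) (evalPairing P) HS HT ∧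
      IsHopfDual (freeGr P) (freeGr P) (kronInv P) (B.cupHopf e) (B.cupHopf e) ∧
      IsHopfDual (lamGr P) (lamGr P) bA HL HL ∧
      IsModComodDual (desGr X) (dualGr X) (evalPairing X) (evalPairing P) XS XT ∧
      IsModComodDual (freeGr X) (freeGr X) (kronInv X) (kronInv P) C.cup C.cup ∧
      IsModComodDual (lamGr X) (lamGr X) bD bA XL XL ∧
      (∀ (x : DesAlg X) (f : X →₀ ℤ),
        kronInv X ((DesAlg X).subtype x) f = evalPairing X x (chi' X f)) ∧
      (∀ (x : DesAlg X) (y : Lam X),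
        bD (chiLam X x) y = evalPairing X x ((Lam X).subtype y)) := by
  obtain ⟨AS, hAS, hAS'⟩ := exists_desOps hB hB
  obtain ⟨AT, hAT⟩ := exists_dualOps hB hB hAS
  obtain ⟨AL, hAL, hAL'⟩ := exists_lamOps hB hAS hAT
  obtain ⟨XS, hXS, hXS'⟩ := exists_desOps hB h
  obtain ⟨XT, hXT⟩ := exists_dualOps hB h hXS
  obtain ⟨XL, hXL, hXL'⟩ := exists_lamOps h hXS hXT
  obtain ⟨bA, hbA⟩ := hB.exists_lamForm
  obtain ⟨bD, hbD⟩ := h.exists_lamForm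
  let one : DesAlg P := ⟨Finsupp.single e 1, single_unit_mem he⟩
  let HS : HopfOps ℤ (DesAlg P) :=
    ⟨AS.act, one, AS.coact, (Finsupp.lapply e).comp (DesAlg P).subtype⟩
  -- Dually to `HS`, the counit of `Σ*` is evaluation at the unit of `Σ`; `Λ` receives the
  -- restriction.
  let HT : HopfOps ℤ (DesDual P) :=
    ⟨AT.act, chi' P (Finsupp.single e 1), AT.coact, evalPairing P one⟩
  let HL : HopfOps ℤ (Lam P) :=
    ⟨AL.act, chiLam P one, AL.coact, (evalPairing P one).comp (Lam P).subtype⟩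
  have hcounit : ∀ f : P →₀ ℤ, evalPairing P one (chi' P f) = f e := fun f =>
    (hB.evalPairing_chi' one f).trans ((cup_hopfSelfDual hB he).one_counit f)
  have hHS : IsHopfHom (desGr P) (freeGr P) HS (B.cupHopf e) (DesAlg P).subtype :=
    ⟨hAS.map_mem, hAS.map_act, rfl, hAS.map_coact, fun _ => rfl⟩
  have hHT : IsHopfHom (freeGr P) (dualGr P) (B.cupHopf e) HT (chi' P) :=
    ⟨hAT.map_mem, hAT.map_act, rfl, hAT.map_coact, hcounit⟩
  have hHL : IsHopfHom (desGr P) (lamGr P) HS HL (chiLam P) :=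
    ⟨hAL.map_mem, hAL.map_act, rfl, hAL.map_coact, fun a => hcounit a.1⟩
  have hHL' : IsHopfHom (lamGr P) (dualGr P) HL HT (Lam P).subtype :=
    ⟨hAL'.map_mem, hAL'.map_act, rfl, hAL'.map_coact, fun _ => rfl⟩
  -- The axioms pass to `Σ` as a subobject, to `Σ*` as a quotient, and to `Λ` as a quotient of `Σ`.
  have cS : IsConnectedBialgebra (desGr P) HS :=
    hH.of_injective hHS (DesAlg P).subtype_injective subtype_tensor_injective
      subtype_tensor_injective₃ isInternal_desGr (fun _ _ hx => hx) hAS'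
  have cT : IsConnectedBialgebra (dualGr P) HT :=
    hH.of_surjective hHT hB.chi'_surjective hB.isInternal_dualGr
  have cL : IsConnectedBialgebra (lamGr P) HL :=
    cS.of_surjective hHL chiLam_surjective hB.isInternal_lamGr
  have mS : IsGradedModComod (desGr P) (desGr X) HS XS :=
    (cup_isGradedModComod hB h he).of_injective hHS hXS (DesAlg X).subtype_injective
      subtype_tensor_injective₃ isInternal_desGr (fun _ _ hx => hx) hXS'
  have dS : IsHopfDual (desGr P) (dualGr P) (evalPairing P) HS HT :=
    (cup_hopfSelfDual hB he).transfer hHS hHT hB.chi'_surjective hB.evalPairing_chi'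
      hB.isGradedPairing_eval
  have dXS : IsModComodDual (desGr X) (dualGr X) (evalPairing X) (evalPairing P) XS XT :=
    (cup_selfDual hB h).transfer hXS hXT h.chi'_surjective hB.chi'_surjective
      h.evalPairing_chi' hB.evalPairing_chi' h.isGradedPairing_eval
  exact ⟨HS, HT, HL, XS, XT, XL, bA, bD, cS.isGradedHopf, cT.isGradedHopf, cL.isGradedHopf,
    hHS, hHT, hHL, hHL', mS,
    (cup_isGradedModComod hB h he).of_surjective hHT hXT hB.chi'_surjective h.chi'_surjective
      isInternal_freeGr hB.isInternal_dualGr h.isInternal_dualGr,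
    mS.of_surjective hHL hXL chiLam_surjective chiLam_surjective isInternal_desGr
      hB.isInternal_lamGr h.isInternal_lamGr,
    hXS, hXT, hXL, hXL', rfl, (DesAlg X).subtype_injective, h.chi'_surjective,
    chiLam_surjective, (Lam X).subtype_injective, hB.isLamForm hbA, h.isLamForm hbD, dS,
    cup_hopfSelfDual hB he,
    -- `Λ` is a subobject of `Σ*` and a quotient of `Σ`, so the duality between these two becomes a
    -- self-duality.
    dS.flip.transfer hHL' hHL chiLam_surjective
      (fun a b => ((hB.isLamForm hbA).symm _ _).trans (hbA b a)) (hB.isGradedPairing_lamForm hbA),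
    dXS, cup_selfDual hB h,
    dXS.flip.transfer hXL' hXL chiLam_surjective chiLam_surjective
      (fun a b => ((h.isLamForm hbD).symm _ _).trans (hbD b a))
      (fun a b => ((hB.isLamForm hbA).symm _ _).trans (hbA b a)) (h.isGradedPairing_lamForm hbD),
    fun x f => (h.evalPairing_chi' x f).symm, hbD⟩

end IsCut

end DiamondOps

end

open scoped TensorProduct
noncomputable section

/-! ### Signed permutations as odd functions -/

namespace SignedPerm

variable {n : ℕ}

/-- The odd function on integers with the values `w(1), …, w(n)` and zero beyond `n`. -/
def app (w : SignedPerm n) (a : ℤ) : ℤ :=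
  if h : a.natAbs - 1 < n then
    a.sign * ((w.sgn ⟨a.natAbs - 1, h⟩ : ℤ) * (((w.perm ⟨a.natAbs - 1, h⟩ : ℕ) : ℤ) + 1))
  else 0

theorem app_neg (w : SignedPerm n) (a : ℤ) : w.app (-a) = -w.app a := by
  simp only [app, Int.natAbs_neg, Int.sign_neg]
  split_ifs <;> ring

theorem app_fin (w : SignedPerm n) (i : Fin n) :
    w.app ((i : ℕ) + 1) = (w.sgn i : ℤ) * (((w.perm i : ℕ) : ℤ) + 1) := by
  have h1 : (((i : ℕ) : ℤ) + 1).natAbs - 1 = i := by omega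
  have h2 : (((i : ℕ) : ℤ) + 1).sign = 1 := Int.sign_eq_one_of_pos (by omega)
  have h3 : (⟨(((i : ℕ) : ℤ) + 1).natAbs - 1, h1 ▸ i.2⟩ : Fin n) = i := Fin.ext h1
  rw [app, dif_pos (h1 ▸ i.2), h3, h2, one_mul]

theorem exists_fin {a : ℤ} (h1 : 1 ≤ a) (h2 : a ≤ n) : ∃ i : Fin n, a = (i : ℕ) + 1 :=
  ⟨⟨(a - 1).toNat, by omega⟩, by simp only []; omega⟩

theorem sgn_eq (w : SignedPerm n) (i : Fin n) : w.sgn i = 1 ∨ w.sgn i = -1 :=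
  Int.units_eq_one_or _

theorem app_fin_cases (w : SignedPerm n) (i : Fin n) :
    (w.sgn i = 1 ∧ w.app ((i : ℕ) + 1) = (w.perm i : ℕ) + 1) ∨
      (w.sgn i = -1 ∧ w.app ((i : ℕ) + 1) = -((w.perm i : ℕ) + 1)) := by
  rw [app_fin]
  rcases w.sgn_eq i with h | h <;> simp [h]

theorem natAbs_app_fin (w : SignedPerm n) (i : Fin n) :
    (w.app ((i : ℕ) + 1)).natAbs = (w.perm i : ℕ) + 1 := by
  rcases w.app_fin_cases i with h | h <;> omega

theorem app_zero (w : SignedPerm n) : w.app 0 = 0 := by simp [app]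

theorem app_of_lt (w : SignedPerm n) {a : ℤ} (h : n < a.natAbs) : w.app a = 0 :=
  dif_neg (by omega)

theorem natAbs_app (w : SignedPerm n) {a : ℤ} (h0 : a ≠ 0) (h : a.natAbs ≤ n) :
    w.app a ≠ 0 ∧ (w.app a).natAbs ≤ n := by
  rcases lt_or_gt_of_ne h0 with h1 | h1
  · obtain ⟨i, hi⟩ := exists_fin (n := n) (a := -a) (by omega) (by omega)
    have := w.natAbs_app_fin i
    have := (w.perm i).2
    rw [← hi, app_neg] at *
    omega
  · obtain ⟨i, hi⟩ := exists_fin (n := n) (a := a) (by omega) (by omega)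
    have := w.natAbs_app_fin i
    have := (w.perm i).2
    rw [← hi] at *
    omega

theorem app_mul (w z : SignedPerm n) (a : ℤ) : (w * z).app a = w.app (z.app a) := by
  have key : ∀ i : Fin n, (w * z).app ((i : ℕ) + 1) = w.app (z.app ((i : ℕ) + 1)) := by
    intro i
    have h1 : (w * z).sgn i = z.sgn i * w.sgn (z.perm i) := rfl
    have h2 : (w * z).perm i = w.perm (z.perm i) := rfl
    rw [app_fin, h1, h2]
    rcases z.app_fin_cases i with ⟨hs, hz⟩ | ⟨hs, hz⟩
    · rw [hz, app_fin, hs]; simp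
    · rw [hz, app_neg, app_fin, hs]; simp
  rcases lt_trichotomy a 0 with h | h | h
  · by_cases hn : a.natAbs ≤ n
    · obtain ⟨i, hi⟩ := exists_fin (n := n) (a := -a) (by omega) (by omega)
      have ha : a = -((i : ℕ) + 1) := by omega
      rw [ha, app_neg, app_neg, app_neg, key]
    · rw [app_of_lt _ (not_le.mp hn), app_of_lt _ (not_le.mp hn), app_zero]
  · rw [h, app_zero, app_zero, app_zero]
  · by_cases hn : a.natAbs ≤ n
    · obtain ⟨i, hi⟩ := exists_fin (n := n) (a := a) (by omega) (by omega)
      rw [hi, key]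
    · rw [app_of_lt _ (not_le.mp hn), app_of_lt _ (not_le.mp hn), app_zero]

theorem app_one {a : ℤ} (h : a.natAbs ≤ n) : (1 : SignedPerm n).app a = a := by
  have key : ∀ i : Fin n, (1 : SignedPerm n).app ((i : ℕ) + 1) = (i : ℕ) + 1 := by
    intro i
    rw [app_fin]
    exact one_mul _
  rcases lt_trichotomy a 0 with h | h | h
  · obtain ⟨i, hi⟩ := exists_fin (n := n) (a := -a) (by omega) (by omega)
    rw [← neg_neg a, app_neg, hi, key]
  · rw [h, app_zero]
  · obtain ⟨i, hi⟩ := exists_fin (n := n) (a := a) (by omega) (by omega)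
    rw [hi, key]

theorem app_inv_app (w : SignedPerm n) {a : ℤ} (h : a.natAbs ≤ n) :
    w⁻¹.app (w.app a) = a := by
  rw [← app_mul, inv_mul_cancel, app_one h]

theorem app_app_inv (w : SignedPerm n) {a : ℤ} (h : a.natAbs ≤ n) :
    w.app (w⁻¹.app a) = a := by
  rw [← app_mul, mul_inv_cancel, app_one h]

theorem app_injective (w : SignedPerm n) {a b : ℤ} (ha : a.natAbs ≤ n) (hb : b.natAbs ≤ n)
    (h : w.app a = w.app b) : a = b := by
  rw [← w.app_inv_app ha, h, w.app_inv_app hb]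

theorem natAbs_app_injective (w : SignedPerm n) {a b : ℤ} (ha : a.natAbs ≤ n) (hb : b.natAbs ≤ n)
    (h : (w.app a).natAbs = (w.app b).natAbs) : a.natAbs = b.natAbs := by
  rcases Int.natAbs_eq_natAbs_iff.mp h with h | h
  · rw [w.app_injective ha hb h]
  · rw [← app_neg] at h
    rw [w.app_injective ha (by omega) h, Int.natAbs_neg]

theorem ext_app {w z : SignedPerm n} (h : ∀ a : ℤ, 1 ≤ a → a ≤ n → w.app a = z.app a) :
    w = z := by
  have key : ∀ i : Fin n, w.app ((i : ℕ) + 1) = z.app ((i : ℕ) + 1) := fun i =>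
    h _ (by omega) (by omega)
  have hp : ∀ i, w.perm i = z.perm i := fun i => by
    have h1 := w.natAbs_app_fin i
    have h2 := z.natAbs_app_fin i
    rw [key, h2] at h1
    exact Fin.ext (by omega)
  refine SignedPerm.ext (Equiv.ext hp) (funext fun i => ?_)
  have h1 := w.app_fin_cases i
  have h2 := z.app_fin_cases i
  rw [key] at h1
  rcases h1 with ⟨h1, h1'⟩ | ⟨h1, h1'⟩ <;> rcases h2 with ⟨h2, h2'⟩ | ⟨h2, h2'⟩
  · rw [h1, h2]
  · omega
  · omega
  · rw [h1, h2]

theorem window_length (w : SignedPerm n) : w.window.length = n := List.length_ofFn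

theorem window_getD (w : SignedPerm n) (p : ℕ) : w.window.getD p 0 = w.app (p + 1) := by
  by_cases h : p < n
  · rw [List.getD_eq_getElem _ _ (by rwa [window_length])]
    simp only [window, List.getElem_ofFn]
    exact (app_fin w ⟨p, h⟩).symm
  · rw [List.getD_eq_default _ _ (by rw [window_length]; omega), app_of_lt]
    omega

/-- A permutation as a signed permutation. -/
def ofPerm (w : Equiv.Perm (Fin n)) : SignedPerm n := ⟨w, fun _ => 1⟩

theorem ofPerm_mul (w z : Equiv.Perm (Fin n)) : ofPerm (w * z) = ofPerm w * ofPerm z :=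
  SignedPerm.ext rfl (funext fun _ => (one_mul _).symm)

theorem ofPerm_inv (w : Equiv.Perm (Fin n)) : ofPerm w⁻¹ = (ofPerm w)⁻¹ := rfl

theorem ofPerm_injective : Function.Injective (ofPerm (n := n)) :=
  fun _ _ h => congrArg SignedPerm.perm h

theorem app_ofPerm_pos (w : Equiv.Perm (Fin n)) {a : ℤ} (h1 : 1 ≤ a) (h2 : a ≤ n) :
    1 ≤ (ofPerm w).app a := by
  obtain ⟨i, rfl⟩ := exists_fin h1 h2
  rcases (ofPerm w).app_fin_cases i with h | h
  · omega
  · exact absurd h.1 (by change (1 : ℤˣ) ≠ -1; decide)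

end SignedPerm

open SignedPerm

theorem oneLine_eq {n : ℕ} (w : Equiv.Perm (Fin n)) : oneLine w = (ofPerm w).window := by
  simp only [oneLine, window, ofPerm, Units.val_one, one_mul]

/-- The odd function on integers whose values are the letters of a word. -/
def wordApp (a : List ℤ) (x : ℤ) : ℤ := x.sign * a.getD (x.natAbs - 1) 0

theorem wordApp_neg (a : List ℤ) (x : ℤ) : wordApp a (-x) = -wordApp a x := by
  simp [wordApp]

theorem wordApp_succ (a : List ℤ) (p : ℕ) : wordApp a (p + 1) = a.getD p 0 := by
  have h2 : ((p : ℤ) + 1).sign = 1 := Int.sign_eq_one_of_pos (by omega)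
  have h1 : ((p : ℤ) + 1).natAbs - 1 = p := by omega
  rw [wordApp, h2, one_mul, h1]

theorem wordApp_window {n : ℕ} (w : SignedPerm n) (x : ℤ) : wordApp w.window x = w.app x := by
  have key : ∀ p : ℕ, wordApp w.window (p + 1) = w.app (p + 1) := fun p => by
    rw [wordApp_succ, window_getD]
  rcases lt_trichotomy x 0 with h | h | h
  · have hx : x = -(((-x - 1).toNat : ℤ) + 1) := by omega
    rw [hx, wordApp_neg, key, app_neg]
  · rw [h, app_zero]; simp [wordApp]
  · have hx : x = ((x - 1).toNat : ℤ) + 1 := by omega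
    rw [hx, key]

theorem wordApp_take (a : List ℤ) {i : ℕ} {x : ℤ} (h0 : x ≠ 0) (h : x.natAbs ≤ i) :
    wordApp (a.take i) x = wordApp a x := by
  rw [wordApp, wordApp, List.getD_eq_getElem?_getD, List.getD_eq_getElem?_getD,
    List.getElem?_take_of_lt (by omega)]

theorem wordApp_drop (a : List ℤ) (i : ℕ) {x : ℤ} (h : 1 ≤ x) :
    wordApp (a.drop i) x = wordApp a (i + x) := by
  have hx : x = ((x - 1).toNat : ℤ) + 1 := by omega
  have hx' : (i : ℤ) + x = ((i + (x - 1).toNat : ℕ) : ℤ) + 1 := by omega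
  rw [hx', wordApp_succ, hx, wordApp_succ, List.getD_eq_getElem?_getD,
    List.getD_eq_getElem?_getD, List.getElem?_drop]
  congr 3
  omega

/-! ### Order patterns -/

/-- `f` and `g` order the positions `1, …, m` in the same way. -/
def SameA (m : ℕ) (f g : ℤ → ℤ) : Prop :=
  ∀ a b : ℤ, 1 ≤ a → a ≤ m → 1 ≤ b → b ≤ m → (f a < f b ↔ g a < g b)

/-- `f` and `g` have the same signs and order the positions `1, …, m` in the same way by absolute
values. -/
def SameB (m : ℕ) (f g : ℤ → ℤ) : Prop :=
  (∀ a : ℤ, 1 ≤ a → a ≤ m → (f a < 0 ↔ g a < 0)) ∧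
  ∀ a b : ℤ, 1 ≤ a → a ≤ m → 1 ≤ b → b ≤ m →
    ((f a).natAbs < (f b).natAbs ↔ (g a).natAbs < (g b).natAbs)

/-- `f` and `g` have the same inversions of type D. -/
def SameD (m : ℕ) (f g : ℤ → ℤ) : Prop :=
  ∀ a b : ℤ, a ≠ 0 → a.natAbs ≤ m → b ≠ 0 → b.natAbs ≤ m → a.natAbs ≠ b.natAbs →
    (f a < f b ↔ g a < g b)

theorem SameA.symm {m : ℕ} {f g : ℤ → ℤ} (h : SameA m f g) : SameA m g f :=
  fun a b h1 h2 h3 h4 => (h a b h1 h2 h3 h4).symm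

theorem SameA.trans {m : ℕ} {f g k : ℤ → ℤ} (h : SameA m f g) (h' : SameA m g k) : SameA m f k :=
  fun a b h1 h2 h3 h4 => (h a b h1 h2 h3 h4).trans (h' a b h1 h2 h3 h4)

theorem SameB.trans {m : ℕ} {f g k : ℤ → ℤ} (h : SameB m f g) (h' : SameB m g k) : SameB m f k :=
  ⟨fun a h1 h2 => (h.1 a h1 h2).trans (h'.1 a h1 h2),
    fun a b h1 h2 h3 h4 => (h.2 a b h1 h2 h3 h4).trans (h'.2 a b h1 h2 h3 h4)⟩

theorem SameD.symm {m : ℕ} {f g : ℤ → ℤ} (h : SameD m f g) : SameD m g f :=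
  fun a b h1 h2 h3 h4 h5 => (h a b h1 h2 h3 h4 h5).symm

theorem SameD.trans {m : ℕ} {f g k : ℤ → ℤ} (h : SameD m f g) (h' : SameD m g k) : SameD m f k :=
  fun a b h1 h2 h3 h4 h5 => (h a b h1 h2 h3 h4 h5).trans (h' a b h1 h2 h3 h4 h5)

theorem SameD.sameA {m : ℕ} {f g : ℤ → ℤ} (h : SameD m f g) : SameA m f g :=
  fun a b h1 h2 h3 h4 => by
    by_cases hab : a = b
    · rw [hab]; exact ⟨fun h => absurd h (lt_irrefl _), fun h => absurd h (lt_irrefl _)⟩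
    · exact h a b (by omega) (by omega) (by omega) (by omega) (by omega)

/-- The order of `±f(|a|)` and `±f(|b|)` is determined by their signs and by which absolute value is
larger, provided these are different and nonzero. -/
theorem SameB.sameD {m : ℕ} {f g : ℤ → ℤ} (h : SameB m f g) (hf : ∀ a, f (-a) = -f a)
    (hg : ∀ a, g (-a) = -g a)
    (hf' : ∀ a b : ℤ, 1 ≤ a → a ≤ m → 1 ≤ b → b ≤ m → a ≠ b → (f a).natAbs ≠ (f b).natAbs)
    (hg' : ∀ a b : ℤ, 1 ≤ a → a ≤ m → 1 ≤ b → b ≤ m → a ≠ b → (g a).natAbs ≠ (g b).natAbs)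
    (hf0 : ∀ a : ℤ, 1 ≤ a → a ≤ m → f a ≠ 0) (hg0 : ∀ a : ℤ, 1 ≤ a → a ≤ m → g a ≠ 0) :
    SameD m f g := by
  intro a b ha ha' hb hb' hab
  have h1 := h.1 (a.natAbs : ℤ) (by omega) (by omega)
  have h2 := h.1 (b.natAbs : ℤ) (by omega) (by omega)
  have h3 := h.2 (a.natAbs : ℤ) (b.natAbs : ℤ) (by omega) (by omega) (by omega) (by omega)
  have h4 := hf' (a.natAbs : ℤ) (b.natAbs : ℤ) (by omega) (by omega) (by omega) (by omega)
    (by omega)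
  have h5 := hg' (a.natAbs : ℤ) (b.natAbs : ℤ) (by omega) (by omega) (by omega) (by omega)
    (by omega)
  have h6 := hf0 (a.natAbs : ℤ) (by omega) (by omega)
  have h7 := hg0 (a.natAbs : ℤ) (by omega) (by omega)
  have h8 := hf0 (b.natAbs : ℤ) (by omega) (by omega)
  have h9 := hg0 (b.natAbs : ℤ) (by omega) (by omega)
  have ea : (f a = f a.natAbs ∧ g a = g a.natAbs) ∨ (f a = -f a.natAbs ∧ g a = -g a.natAbs) := by
    rcases Int.natAbs_eq a with h | h
    · left; rw [← h]; exact ⟨rfl, rfl⟩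
    · right; rw [← hf, ← hg, ← h]; exact ⟨rfl, rfl⟩
  have eb : (f b = f b.natAbs ∧ g b = g b.natAbs) ∨ (f b = -f b.natAbs ∧ g b = -g b.natAbs) := by
    rcases Int.natAbs_eq b with h | h
    · left; rw [← h]; exact ⟨rfl, rfl⟩
    · right; rw [← hf, ← hg, ← h]; exact ⟨rfl, rfl⟩
  generalize f a = x at *
  generalize f b = y at *
  generalize g a = x' at *
  generalize g b = y' at *
  generalize f a.natAbs = X at *
  generalize f b.natAbs = Y at *
  generalize g a.natAbs = X' at *
  generalize g b.natAbs = Y' at *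
  clear hf hg hf' hg' hf0 hg0 h
  rcases ea with ⟨rfl, rfl⟩ | ⟨rfl, rfl⟩ <;> rcases eb with ⟨rfl, rfl⟩ | ⟨rfl, rfl⟩ <;> omega

/-- `τ σ⁻¹` is an order automorphism of a finite chain, hence the identity. -/
theorem perm_eq_of_lt_iff {n : ℕ} {σ τ : Equiv.Perm (Fin n)}
    (h : ∀ i j, σ i < σ j ↔ τ i < τ j) : σ = τ := by
  let e : Fin n ≃o Fin n := StrictMono.orderIsoOfSurjective (fun i => τ (σ⁻¹ i))
    (fun i j hij => (h _ _).mp (by simpa using hij)) (τ.surjective.comp (σ⁻¹).surjective)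
  have he : e = OrderIso.refl _ := Subsingleton.elim _ _
  ext i
  have := congrArg (fun f : Fin n ≃o Fin n => f (σ i)) he
  have h' : τ (σ⁻¹ (σ i)) = σ i := this
  rw [Equiv.Perm.inv_def, Equiv.symm_apply_apply] at h'
  rw [h']

theorem SameB.eq {n : ℕ} {w z : SignedPerm n} (h : SameB n w.app z.app) : w = z := by
  have hp : w.perm = z.perm := perm_eq_of_lt_iff fun i j => by
    have := h.2 ((i : ℕ) + 1) ((j : ℕ) + 1) (by omega) (by omega) (by omega) (by omega)
    rw [natAbs_app_fin, natAbs_app_fin, natAbs_app_fin, natAbs_app_fin] at this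
    rw [Fin.lt_def, Fin.lt_def]
    omega
  refine SignedPerm.ext hp (funext fun i => ?_)
  have h0 := h.1 ((i : ℕ) + 1) (by omega) (by omega)
  rcases w.app_fin_cases i with ⟨h1, h1'⟩ | ⟨h1, h1'⟩ <;>
    rcases z.app_fin_cases i with ⟨h2, h2'⟩ | ⟨h2, h2'⟩
  · rw [h1, h2]
  · omega
  · omega
  · rw [h1, h2]

theorem SameA.eq {n : ℕ} {w z : Equiv.Perm (Fin n)} (h : SameA n (ofPerm w).app (ofPerm z).app) :
    w = z := by
  refine ofPerm_injective (SameB.eq ⟨fun a h1 h2 => ?_, fun a b h1 h2 h3 h4 => ?_⟩)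
  · have := app_ofPerm_pos w h1 h2
    have := app_ofPerm_pos z h1 h2
    omega
  · have := h a b h1 h2 h3 h4
    have := app_ofPerm_pos w h1 h2
    have := app_ofPerm_pos z h1 h2
    have := app_ofPerm_pos w h3 h4
    have := app_ofPerm_pos z h3 h4
    omega

/-! ### Standardization -/

/-- The stable sort lists positions lexicographically by value and position; its inverse is the
rank. -/
theorem sort_inv_lt_iff {n : ℕ} {α : Type} [LinearOrder α] (f : Fin n → α) (i j : Fin n) :
    (Tuple.sort f)⁻¹ i < (Tuple.sort f)⁻¹ j ↔ f i < f j ∨ f i = f j ∧ i < j := by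
  have h := Tuple.eq_sort_iff'.mp (rfl : Tuple.sort f = Tuple.sort f)
  rw [← h.lt_iff_lt]
  simp only [Equiv.coe_trans, Function.comp_apply, Equiv.Perm.inv_def, Equiv.apply_symm_apply]
  exact Prod.Lex.toLex_lt_toLex

/-- Standardization preserves the order pattern of words with different letters. -/
theorem sameA_st {a : List ℤ} (ha : a.Nodup) : SameA a.length (ofPerm (st a).2).app (wordApp a) := by
  intro x y h1 h2 h3 h4
  obtain ⟨i, rfl⟩ := exists_fin h1 h2
  obtain ⟨j, rfl⟩ := exists_fin h3 h4
  have e : ∀ i : Fin a.length, (ofPerm (st a).2).app ((i : ℕ) + 1)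
      = (((Tuple.sort a.get)⁻¹ i : Fin _) : ℕ) + 1 := by
    intro i
    exact (app_fin (n := a.length) _ i).trans (one_mul _)
  have hi := e i
  have hj := e j
  rw [hi, hj, wordApp_succ, wordApp_succ, List.getD_eq_getElem _ _ i.2,
    List.getD_eq_getElem _ _ j.2]
  have key := sort_inv_lt_iff a.get i j
  rw [Fin.lt_def] at key
  have : (a.get i = a.get j ∧ i < j) ↔ False := by
    rw [iff_false]
    rintro ⟨h, hij⟩
    exact hij.ne (List.nodup_iff_injective_get.mp ha h)
  rw [this, or_false] at key
  simp only [List.get_eq_getElem] at key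
  rw [← key]
  omega

/-- A permutation is determined by its order pattern, so a word with different letters has only one
candidate. -/
theorem st_eq_iff {a : List ℤ} (ha : a.Nodup) {n : ℕ} (v : Equiv.Perm (Fin n)) :
    st a = ⟨n, v⟩ ↔ a.length = n ∧ SameA n (wordApp a) (ofPerm v).app := by
  constructor
  · intro h
    have hn : a.length = n := congrArg Sigma.fst h
    subst hn
    have hv : (st a).2 = v := eq_of_heq (Sigma.mk.inj h).2
    rw [← hv]
    exact ⟨rfl, (sameA_st ha).symm⟩
  · rintro ⟨rfl, h⟩
    have : (st a).2 = v := SameA.eq ((sameA_st ha).trans h)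
    rw [← this]
    rfl

/-- Signed standardization preserves signs and the order of the absolute values of words with
different absolute values. -/
theorem sameB_stB {a : List ℤ} (ha : (a.map Int.natAbs).Nodup) :
    SameB a.length (stB a).2.app (wordApp a) := by
  have e : ∀ i : Fin a.length, ((stB a).2.sgn i = if a.get i < 0 then -1 else 1) ∧
      wordApp a ((i : ℕ) + 1) = a.get i := fun i =>
    ⟨rfl, by rw [wordApp_succ, List.getD_eq_getElem _ _ i.2]; rfl⟩
  refine ⟨fun x h1 h2 => ?_, fun x y h1 h2 h3 h4 => ?_⟩
  · obtain ⟨i, rfl⟩ := exists_fin h1 h2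
    rw [(e i).2]
    have hs := (e i).1
    rcases (stB a).2.app_fin_cases i with ⟨h, h'⟩ | ⟨h, h'⟩
    · by_cases hi : a.get i < 0
      · rw [if_pos hi, h] at hs
        exact absurd hs (by decide)
      · rw [h']
        constructor
        · intro h; omega
        · intro h; exact absurd h hi
    · by_cases hi : a.get i < 0
      · rw [h']
        constructor
        · intro _; exact hi
        · intro _; omega
      · rw [if_neg hi, h] at hs
        exact absurd hs (by decide)
  · obtain ⟨i, rfl⟩ := exists_fin h1 h2
    obtain ⟨j, rfl⟩ := exists_fin h3 h4
    have hi := (stB a).2.natAbs_app_fin i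
    have hj := (stB a).2.natAbs_app_fin j
    rw [hi, hj, (e i).2, (e j).2]
    have key := sort_inv_lt_iff (fun i : Fin a.length =>
      toLex (|a.get i|, if a.get i < 0 then -((i : ℕ) : ℤ) - 1 else ((i : ℕ) : ℤ))) i j
    rw [Nat.add_lt_add_iff_right, ← Fin.lt_def]
    refine key.trans ?_
    rw [Prod.Lex.toLex_lt_toLex]
    have hinj : |a.get i| = |a.get j| → i = j := by
      intro h
      have h' : (a.get i).natAbs = (a.get j).natAbs := by
        rw [← Int.natAbs_abs, h, Int.natAbs_abs]
      have := List.nodup_iff_injective_get.mp ha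
        (a₁ := ⟨i, by simp⟩) (a₂ := ⟨j, by simp⟩) (by simpa using h')
      have h'' := congrArg Fin.val this
      exact Fin.ext h''
    have habs : |a.get i| < |a.get j| ↔ (a.get i).natAbs < (a.get j).natAbs := by
      rw [Int.abs_eq_natAbs, Int.abs_eq_natAbs, Nat.cast_lt]
    rw [← habs]
    constructor
    · rintro ((h | ⟨h, h'⟩) | ⟨h, h'⟩)
      · exact h
      · have := hinj h
        subst this
        exact absurd h' (lt_irrefl _)
      · have := hinj (congrArg (fun p => (ofLex p).1) h)
        subst this
        exact absurd h' (lt_irrefl _)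
    · intro h
      exact Or.inl (Or.inl h)

theorem stB_eq {a : List ℤ} (ha : (a.map Int.natAbs).Nodup) {n : ℕ} {v : SignedPerm n}
    (hn : a.length = n) (h : SameB n (wordApp a) v.app) : stB a = ⟨n, v⟩ := by
  subst hn
  have : (stB a).2 = v := SameB.eq ((sameB_stB ha).trans h)
  rw [← this]
  rfl

theorem window_natAbs_nodup {n : ℕ} (w : SignedPerm n) : (w.window.map Int.natAbs).Nodup := by
  rw [window, List.map_ofFn, List.nodup_ofFn]
  intro i j hij
  simp only [Function.comp_apply, ← app_fin] at hij
  have := w.natAbs_app_injective (a := (i : ℕ) + 1) (b := (j : ℕ) + 1) (by omega) (by omega) hij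
  exact Fin.ext (by omega)

theorem window_nodup {n : ℕ} (w : SignedPerm n) : w.window.Nodup :=
  (window_natAbs_nodup w).of_map _

end

open scoped TensorProduct
noncomputable section

open SignedPerm

/-! ### Parabolic subgroups -/

namespace SignedPerm

variable {m n : ℕ}

theorem app_times_left (u : SignedPerm m) (v : Equiv.Perm (Fin n)) {a : ℤ} (ha : a.natAbs ≤ m) :
    (times u v).app a = u.app a := by
  have key : ∀ i : Fin m, (times u v).app ((i : ℕ) + 1) = u.app ((i : ℕ) + 1) := by
    intro i
    have h1 := (times u v).app_fin (Fin.castAdd n i)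
    have h2 : (times u v).perm (Fin.castAdd n i) = Fin.castAdd n (u.perm i) := by
      simp [times]
    have h3 : (times u v).sgn (Fin.castAdd n i) = u.sgn i := by simp [times]
    rw [h2, h3, Fin.val_castAdd, Fin.val_castAdd, ← app_fin] at h1
    exact h1
  rcases lt_trichotomy a 0 with h | h | h
  · obtain ⟨i, hi⟩ := exists_fin (n := m) (a := -a) (by omega) (by omega)
    have ha : a = -((i : ℕ) + 1) := by omega
    rw [ha, app_neg, app_neg, key]
  · rw [h, app_zero, app_zero]
  · obtain ⟨i, hi⟩ := exists_fin (n := m) (a := a) (by omega) (by omega)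
    rw [hi, key]

theorem app_times_right (u : SignedPerm m) (v : Equiv.Perm (Fin n)) {x : ℤ} (h1 : 1 ≤ x)
    (h2 : x ≤ n) : (times u v).app (m + x) = m + (ofPerm v).app x := by
  obtain ⟨i, rfl⟩ := exists_fin h1 h2
  have h1 := (times u v).app_fin (Fin.natAdd m i)
  have h2 : (times u v).perm (Fin.natAdd m i) = Fin.natAdd m (v i) := by
    simp [times]
  have h3 : (times u v).sgn (Fin.natAdd m i) = 1 := by simp [times]
  rw [h2, h3, Fin.val_natAdd, Fin.val_natAdd] at h1
  rw [app_fin (ofPerm v)]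
  have h4 : (ofPerm v).sgn i = 1 := rfl
  have h5 : (ofPerm v).perm i = v i := rfl
  rw [h4, h5]
  push_cast at h1 ⊢
  rw [← add_assoc, h1]
  ring

theorem times_mul (u u' : SignedPerm m) (v v' : Equiv.Perm (Fin n)) :
    times (u * u') (v * v') = times u v * times u' v' := by
  refine ext_app fun a h1 h2 => ?_
  rw [app_mul]
  by_cases h : a ≤ m
  · have := u'.natAbs_app (a := a) (by omega) (by omega)
    rw [app_times_left (u * u') _ (by omega), app_times_left u' _ (by omega),
      app_times_left u _ (by omega), app_mul]
  · obtain ⟨x, rfl⟩ : ∃ x : ℤ, a = m + x := ⟨a - m, by ring⟩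
    push_cast at h2
    have e := app_ofPerm_pos v' (a := x) (by omega) (by omega)
    have e' := (ofPerm v').natAbs_app (a := x) (by omega) (by omega)
    rw [app_times_right _ _ (by omega) (by omega), app_times_right _ _ (by omega) (by omega),
      app_times_right _ _ (by omega) (by omega), ofPerm_mul, app_mul]

theorem times_one : times (1 : SignedPerm m) (1 : Equiv.Perm (Fin n)) = 1 := by
  refine ext_app fun a h1 h2 => ?_
  rw [app_one (by omega)]
  by_cases h : a ≤ m
  · rw [app_times_left _ _ (by omega), app_one (by omega)]
  · obtain ⟨x, rfl⟩ : ∃ x : ℤ, a = m + x := ⟨a - m, by ring⟩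
    push_cast at h2
    rw [app_times_right _ _ (by omega) (by omega)]
    congr 1
    exact app_one (n := n) (a := x) (by omega)

theorem times_inv (u : SignedPerm m) (v : Equiv.Perm (Fin n)) :
    (times u v)⁻¹ = times u⁻¹ v⁻¹ := by
  rw [inv_eq_iff_mul_eq_one, ← times_mul, mul_inv_cancel, mul_inv_cancel, times_one]

theorem times_mem_groupD {u : SignedPerm m} (hu : u ∈ groupD m) (v : Equiv.Perm (Fin n)) :
    times u v ∈ groupD (m + n) := by
  change ∏ i, (times u v).sgn i = 1
  rw [Fin.prod_univ_add]
  have h1 : ∏ i : Fin m, (times u v).sgn (Fin.castAdd n i) = ∏ i, u.sgn i :=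
    Finset.prod_congr rfl fun i _ => by simp [times]
  have h2 : ∏ i : Fin n, (times u v).sgn (Fin.natAdd m i) = 1 :=
    Finset.prod_eq_one fun i _ => by simp [times]
  rw [h1, h2, mul_one]
  exact hu

/-- The parabolic embedding in type A. -/
def timesA (u : Equiv.Perm (Fin m)) (v : Equiv.Perm (Fin n)) : Equiv.Perm (Fin (m + n)) :=
  finSumFinEquiv.permCongr (Equiv.sumCongr u v)

theorem ofPerm_timesA (u : Equiv.Perm (Fin m)) (v : Equiv.Perm (Fin n)) :
    ofPerm (timesA u v) = times (ofPerm u) v := by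
  refine SignedPerm.ext rfl (funext fun i => ?_)
  refine Fin.addCases (fun i => ?_) (fun i => ?_) i <;> simp [ofPerm, times]

theorem mem_desD {w : SignedPerm n} {p : ℕ} : p ∈ w.desD ↔ p < n ∧
    ((p = 0 ∧ w.app 1 < -w.app 2) ∨ (1 ≤ p ∧ w.app (p + 1) < w.app p)) := by
  rw [desD, Finset.mem_filter, Finset.mem_range, List.getD_cons_succ]
  refine and_congr_right fun _ => ?_
  cases p with
  | zero =>
    rw [List.getD_cons_zero, window_getD, window_getD]
    simp
  | succ p =>
    rw [List.getD_cons_succ, window_getD, window_getD]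
    simp

end SignedPerm

theorem mem_desA {n : ℕ} {w : Equiv.Perm (Fin n)} {p : ℕ} : p ∈ desA w ↔
    1 ≤ p ∧ p < n ∧ (ofPerm w).app (p + 1) < (ofPerm w).app p := by
  rw [desA, Finset.mem_filter, Finset.mem_Ico, oneLine_eq, window_getD, window_getD, and_assoc]
  refine and_congr_right fun h => ?_
  have : (((p - 1 : ℕ) : ℤ) + 1) = p := by omega
  rw [this]

/-- Signed permutations respect the condition that two positions have different absolute values. -/
theorem SameD.comp {m : ℕ} {f g : ℤ → ℤ} (h : SameD m f g) (u : SignedPerm m) :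
    SameD m (fun a => f (u.app a)) (fun a => g (u.app a)) := by
  intro a b h1 h2 h3 h4 h5
  have ha := u.natAbs_app h1 h2
  have hb := u.natAbs_app h3 h4
  exact h _ _ ha.1 ha.2 hb.1 hb.2 fun h' => h5 (u.natAbs_app_injective h2 h4 h')

theorem SameA.comp {m : ℕ} {f g : ℤ → ℤ} (h : SameA m f g) (u : Equiv.Perm (Fin m)) :
    SameA m (fun a => f ((ofPerm u).app a)) (fun a => g ((ofPerm u).app a)) := by
  intro a b h1 h2 h3 h4
  have ha := (ofPerm u).natAbs_app (a := a) (by omega) (by omega)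
  have hb := (ofPerm u).natAbs_app (a := b) (by omega) (by omega)
  have ha' := app_ofPerm_pos u h1 h2
  have hb' := app_ofPerm_pos u h3 h4
  exact h _ _ ha' (by omega) hb' (by omega)

theorem SameA.congr_left {m : ℕ} {f f' g : ℤ → ℤ} (h : SameA m f g)
    (hf : ∀ a : ℤ, 1 ≤ a → a ≤ m → f a = f' a) : SameA m f' g := fun a b h1 h2 h3 h4 => by
  rw [← hf a h1 h2, ← hf b h3 h4]; exact h a b h1 h2 h3 h4

theorem SameD.congr_left {m : ℕ} {f f' g : ℤ → ℤ} (h : SameD m f g)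
    (hf : ∀ a : ℤ, a ≠ 0 → a.natAbs ≤ m → f a = f' a) : SameD m f' g :=
  fun a b h1 h2 h3 h4 h5 => by
    rw [← hf a h1 h2, ← hf b h3 h4]; exact h a b h1 h2 h3 h4 h5

theorem SameA.congr_right {m : ℕ} {f g g' : ℤ → ℤ} (h : SameA m f g)
    (hf : ∀ a : ℤ, 1 ≤ a → a ≤ m → g a = g' a) : SameA m f g' :=
  (h.symm.congr_left hf).symm

theorem SameD.congr_right {m : ℕ} {f g g' : ℤ → ℤ} (h : SameD m f g)
    (hf : ∀ a : ℤ, a ≠ 0 → a.natAbs ≤ m → g a = g' a) : SameD m f g' :=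
  (h.symm.congr_left hf).symm

theorem SameA.mono {m k : ℕ} {f g : ℤ → ℤ} (h : SameA m f g) (hk : k ≤ m) : SameA k f g :=
  fun a b h1 h2 h3 h4 => h a b h1 (by omega) h3 (by omega)

theorem SameD.mono {m k : ℕ} {f g : ℤ → ℤ} (h : SameD m f g) (hk : k ≤ m) : SameD k f g :=
  fun a b h1 h2 h3 h4 h5 => h a b h1 (by omega) h3 (by omega) h5

theorem SameA.shift {m k l : ℕ} {f g : ℤ → ℤ} (h : SameA m f g) (hk : k + l ≤ m) :
    SameA l (fun x => f (k + x)) (fun x => g (k + x)) :=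
  fun a b h1 h2 h3 h4 => h _ _ (by omega) (by omega) (by omega) (by omega)

theorem SameA.sameB {m : ℕ} {f g : ℤ → ℤ} (h : SameA m f g)
    (hf : ∀ a : ℤ, 1 ≤ a → a ≤ m → 1 ≤ f a) (hg : ∀ a : ℤ, 1 ≤ a → a ≤ m → 1 ≤ g a) :
    SameB m f g := by
  refine ⟨fun a h1 h2 => ?_, fun a b h1 h2 h3 h4 => ?_⟩
  · have := hf a h1 h2
    have := hg a h1 h2
    omega
  · have := h a b h1 h2 h3 h4
    have := hf a h1 h2
    have := hg a h1 h2
    have := hf b h3 h4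
    have := hg b h3 h4
    omega

/-- The parabolic factor of minimal length: `z` is increasing on both parts, in the sense of
type D on the first part. -/
structure IsMinRep (m n : ℕ) (z : SignedPerm (m + n)) : Prop where
  left : SameD m z.app id
  right : SameA n (fun x => z.app (m + x)) id

/-- Precomposing the patterns of `w` with `(u × v)⁻¹` straightens them on both parts. With the
converse `IsMinRep.mul_times`, this is the parabolic factorization. -/
theorem isMinRep_mul_times {m n : ℕ} {w : SignedPerm (m + n)} {u : SignedPerm m}
    {v : Equiv.Perm (Fin n)} (h1 : SameD m w.app u.app)
    (h2 : SameA n (fun x => w.app (m + x)) (ofPerm v).app) :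
    IsMinRep m n (w * (times u v)⁻¹) where
  left := ((h1.comp u⁻¹).congr_left fun a h1 h2 => by
      rw [times_inv, app_mul, app_times_left _ _ h2]).congr_right fun a h1 h2 =>
      u.app_app_inv h2
  right := ((h2.comp v⁻¹).congr_left fun a h1 h2 => by
      rw [times_inv, app_mul, app_times_right _ _ h1 h2]).congr_right fun a h1 h2 => by
      rw [ofPerm_inv]
      exact (ofPerm v).app_app_inv (by omega)

theorem IsMinRep.mul_times {m n : ℕ} {z : SignedPerm (m + n)} (h : IsMinRep m n z)
    (u : SignedPerm m) (v : Equiv.Perm (Fin n)) :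
    SameD m (z * times u v).app u.app ∧
      SameA n (fun x => (z * times u v).app (m + x)) (ofPerm v).app :=
  ⟨(h.left.comp u).congr_left fun a h1 h2 => by rw [app_mul, app_times_left _ _ h2],
    (h.right.comp v).congr_left fun a h1 h2 => by rw [app_mul, app_times_right _ _ h1 h2]⟩

/-- Adjacent letters of `y z⁻¹`, with `z` of minimal length and `y` in the parabolic subgroup: whether
they form a descent depends only on `z` and on the descents of `y`. -/
theorem IsMinRep.lt_iff {m n : ℕ} {z y y' : SignedPerm (m + n)} (hz : IsMinRep m n z)
    (hy : ∀ a : ℤ, a.natAbs ≤ m → (y.app a).natAbs ≤ m)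
    (hy' : ∀ a : ℤ, a.natAbs ≤ m → (y'.app a).natAbs ≤ m)
    (hp : ∀ a : ℤ, m < a → a ≤ m + n → m < y.app a)
    (hp' : ∀ a : ℤ, m < a → a ≤ m + n → m < y'.app a)
    (hd : ∀ a : ℤ, 1 ≤ a → a < m → (y.app (a + 1) < y.app a ↔ y'.app (a + 1) < y'.app a))
    (hd0 : 2 ≤ m → (y.app 1 < -y.app 2 ↔ y'.app 1 < -y'.app 2))
    (hdr : ∀ a : ℤ, m < a → a < m + n → (y.app (a + 1) < y.app a ↔ y'.app (a + 1) < y'.app a))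
    {a b : ℤ} (ha : a ≠ 0) (ha' : a.natAbs ≤ m + n) (hb : b ≠ 0) (hb' : b.natAbs ≤ m + n)
    (hab : a.natAbs ≠ b.natAbs) (hlt : z.app a < z.app b)
    (hcov : ∀ c : ℤ, c ≠ 0 → c.natAbs ≤ m + n → z.app a < z.app c → z.app c < z.app b →
      c = a ∨ c = -a ∨ c = b ∨ c = -b) :
    y.app b < y.app a ↔ y'.app b < y'.app a := by
  have hr : ∀ p q : ℤ, m < p → p ≤ m + n → m < q → q ≤ m + n →
      (z.app p < z.app q ↔ p < q) := by
    intro p q h1 h2 h3 h4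
    have := hz.right (p - m) (q - m) (by omega) (by omega) (by omega) (by omega)
    simp only [add_sub_cancel, id_eq] at this
    rw [this]
    omega
  have hn : ∀ a : ℤ, a < -m → -(m + n : ℤ) ≤ a → y.app a < -m ∧ y'.app a < -m := by
    intro a h1 h2
    have e1 := hp (-a) (by omega) (by omega)
    have e2 := hp' (-a) (by omega) (by omega)
    rw [app_neg] at e1 e2
    omega
  rcases le_or_gt a.natAbs m with hA | hA <;> rcases le_or_gt b.natAbs m with hB | hB
  -- Both positions lie in the left block. As `z` is increasing there, `hcov` makes them neighbours
  -- in the type D order on `±1, …, ±m`: consecutive integers of equal sign, or one of the pairs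
  -- `-2, 1` and `-1, 2`, which express the descent at zero.
  · have hab' : a < b := (hz.left a b ha hA hb hB hab).mp hlt
    have hcov' : ∀ c : ℤ, c ≠ 0 → a < c → c < b → c = a ∨ c = -a ∨ c = b ∨ c = -b := by
      intro c h0 h1 h2
      by_contra hc
      have e1 := (hz.left a c ha hA h0 (by omega) (by omega)).mpr h1
      have e2 := (hz.left c b h0 (by omega) hb hB (by omega)).mpr h2
      exact hc (hcov c h0 (by omega) e1 e2)
    have c1 := hcov' (a + 1)
    have c2 := hcov' (b - 1)
    have c3 := hcov' 1
    have c4 := hcov' (-1)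
    have cases : (1 ≤ a ∧ b = a + 1) ∨ (b ≤ -1 ∧ b = a + 1) ∨ (a = -2 ∧ b = 1) ∨
        (a = -1 ∧ b = 2) := by omega
    clear c1 c2 c3 c4
    rcases cases with ⟨h1, rfl⟩ | ⟨h1, rfl⟩ | ⟨rfl, rfl⟩ | ⟨rfl, rfl⟩
    · exact hd a h1 (by omega)
    · have e := hd (-(a + 1)) (by omega) (by omega)
      have e1 : -(a + 1) + 1 = -a := by ring
      rw [e1, app_neg, app_neg, app_neg, app_neg] at e
      omega
    · have e := hd0 (by omega)
      rw [app_neg, app_neg]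
      exact e
    · have e := hd0 (by omega)
      rw [app_neg, app_neg]
      omega
  -- One position in each block: `y` and `y'` respect the blocks, so the sign of the position in the
  -- right block decides.
  · have e1 := hy a hA
    have e2 := hy' a hA
    rcases lt_or_gt_of_ne hb with h | h
    · have := hn b (by omega) (by omega)
      omega
    · have := hp b (by omega) (by omega)
      have := hp' b (by omega) (by omega)
      omega
  · have e1 := hy b hB
    have e2 := hy' b hB
    rcases lt_or_gt_of_ne ha with h | h
    · have := hn a (by omega) (by omega)
      omega
    · have := hp a (by omega) (by omega)
      have := hp' a (by omega) (by omega)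
      omega
  -- Both positions lie in the right block. Opposite signs decide the comparison; for equal signs
  -- `hcov` forces consecutive positions.
  · rcases lt_or_gt_of_ne ha with h | h <;> rcases lt_or_gt_of_ne hb with h' | h'
    · have e := hr (-b) (-a) (by omega) (by omega) (by omega) (by omega)
      rw [app_neg, app_neg] at e
      have hab' : a < b := by omega
      have hb1 : b = a + 1 := by
        by_contra hne
        have e1 := hr (-(a + 1)) (-a) (by omega) (by omega) (by omega) (by omega)
        have e2 := hr (-b) (-(a + 1)) (by omega) (by omega) (by omega) (by omega)
        rw [app_neg, app_neg] at e1 e2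
        have := hcov (a + 1) (by omega) (by omega) (by omega) (by omega)
        omega
      subst hb1
      have e := hdr (-(a + 1)) (by omega) (by omega)
      have e1 : -(a + 1) + 1 = -a := by ring
      rw [e1, app_neg, app_neg, app_neg, app_neg] at e
      omega
    · have := hn a (by omega) (by omega)
      have := hp b (by omega) (by omega)
      have := hp' b (by omega) (by omega)
      omega
    · have := hn b (by omega) (by omega)
      have := hp a (by omega) (by omega)
      have := hp' a (by omega) (by omega)
      omega
    · have e := hr a b (by omega) (by omega) (by omega) (by omega)
      have hab' : a < b := e.mp hlt
      have hb1 : b = a + 1 := by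
        by_contra hne
        have e1 := hr a (a + 1) (by omega) (by omega) (by omega) (by omega)
        have e2 := hr (a + 1) b (by omega) (by omega) (by omega) (by omega)
        have := hcov (a + 1) (by omega) (by omega) (by omega) (by omega)
        omega
      subst hb1
      exact hdr a (by omega) (by omega)

/-- The hypotheses of `IsMinRep.lt_iff` for elements of the parabolic subgroup. -/
theorem IsMinRep.lt_iff_times {m n : ℕ} {z : SignedPerm (m + n)} (hz : IsMinRep m n z)
    {u u' : SignedPerm m} {v v' : Equiv.Perm (Fin n)}
    (hd : ∀ a : ℤ, 1 ≤ a → a < m → (u.app (a + 1) < u.app a ↔ u'.app (a + 1) < u'.app a))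
    (hd0 : 2 ≤ m → (u.app 1 < -u.app 2 ↔ u'.app 1 < -u'.app 2))
    (hv : desA v = desA v')
    {a b : ℤ} (ha : a ≠ 0) (ha' : a.natAbs ≤ m + n) (hb : b ≠ 0) (hb' : b.natAbs ≤ m + n)
    (hab : a.natAbs ≠ b.natAbs) (hlt : z.app a < z.app b)
    (hcov : ∀ c : ℤ, c ≠ 0 → c.natAbs ≤ m + n → z.app a < z.app c → z.app c < z.app b →
      c = a ∨ c = -a ∨ c = b ∨ c = -b) :
    (times u v).app b < (times u v).app a ↔ (times u' v').app b < (times u' v').app a := by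
  have hle : ∀ (u : SignedPerm m) (v : Equiv.Perm (Fin n)) (a : ℤ), a.natAbs ≤ m →
      ((times u v).app a).natAbs ≤ m := by
    intro u v a h
    rw [app_times_left _ _ h]
    by_cases h0 : a = 0
    · rw [h0, app_zero]; omega
    · exact (u.natAbs_app h0 h).2
  have hgt : ∀ (u : SignedPerm m) (v : Equiv.Perm (Fin n)) (a : ℤ), m < a → a ≤ m + n →
      m < (times u v).app a := by
    intro u v a h1 h2
    obtain ⟨x, rfl⟩ : ∃ x : ℤ, a = m + x := ⟨a - m, by ring⟩
    rw [app_times_right _ _ (by omega) (by omega)]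
    have := app_ofPerm_pos v (a := x) (by omega) (by omega)
    omega
  refine hz.lt_iff (hle u v) (hle u' v') (hgt u v) (hgt u' v') ?_ ?_ ?_ ha ha' hb hb' hab hlt hcov
  · intro a h1 h2
    rw [app_times_left _ _ (by omega), app_times_left _ _ (by omega),
      app_times_left _ _ (by omega), app_times_left _ _ (by omega)]
    exact hd a h1 h2
  · intro h
    rw [app_times_left _ _ (by omega), app_times_left _ _ (by omega),
      app_times_left _ _ (by omega), app_times_left _ _ (by omega)]
    exact hd0 h
  · intro a h1 h2
    obtain ⟨x, rfl⟩ : ∃ x : ℤ, a = m + x := ⟨a - m, by ring⟩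
    rw [add_assoc, app_times_right _ _ (by omega) (by omega),
      app_times_right _ _ (by omega) (by omega), app_times_right _ _ (by omega) (by omega),
      app_times_right _ _ (by omega) (by omega)]
    have e := Finset.ext_iff.mp hv x.toNat
    rw [mem_desA, mem_desA] at e
    have hx : ((x.toNat : ℕ) : ℤ) = x := by omega
    rw [hx] at e
    have h3 : 1 ≤ x.toNat := by omega
    have h4 : x.toNat < n := by omega
    simp only [h3, h4, true_and] at e
    rw [add_lt_add_iff_left, add_lt_add_iff_left]
    exact e

/-- The values `p` and `p + 1` of `z` have nothing between them, so `IsMinRep.lt_iff_times` applies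
to their positions. -/
theorem IsMinRep.adjacent {m n : ℕ} {z : SignedPerm (m + n)} (hz : IsMinRep m n z)
    {u u' : SignedPerm m} {v v' : Equiv.Perm (Fin n)}
    (hd : ∀ a : ℤ, 1 ≤ a → a < m → (u.app (a + 1) < u.app a ↔ u'.app (a + 1) < u'.app a))
    (hd0 : 2 ≤ m → (u.app 1 < -u.app 2 ↔ u'.app 1 < -u'.app 2))
    (hv : desA v = desA v') {p : ℕ} (h1 : 1 ≤ p) (h2 : p < m + n) :
    (times u v * z⁻¹).app (p + 1) < (times u v * z⁻¹).app p ↔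
      (times u' v' * z⁻¹).app (p + 1) < (times u' v' * z⁻¹).app p := by
  have ea := z.app_app_inv (a := (p : ℤ)) (by omega)
  have eb := z.app_app_inv (a := (p : ℤ) + 1) (by omega)
  have ha := z⁻¹.natAbs_app (a := (p : ℤ)) (by omega) (by omega)
  have hb := z⁻¹.natAbs_app (a := (p : ℤ) + 1) (by omega) (by omega)
  rw [app_mul, app_mul, app_mul, app_mul]
  refine hz.lt_iff_times hd hd0 hv ha.1 ha.2 hb.1 hb.2 (fun h => ?_) (by omega) ?_
  · have := z⁻¹.natAbs_app_injective (by omega) (by omega) h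
    omega
  · intro c _ _ h3 h4
    omega

/-- Only `-1` is a value of `z` between `-2` and `1`. It is taken at the negative of the position of
`1`, which the covering condition tolerates. -/
theorem IsMinRep.adjacent_zero {m n : ℕ} {z : SignedPerm (m + n)} (hz : IsMinRep m n z)
    {u u' : SignedPerm m} {v v' : Equiv.Perm (Fin n)}
    (hd : ∀ a : ℤ, 1 ≤ a → a < m → (u.app (a + 1) < u.app a ↔ u'.app (a + 1) < u'.app a))
    (hd0 : 2 ≤ m → (u.app 1 < -u.app 2 ↔ u'.app 1 < -u'.app 2))
    (hv : desA v = desA v') (h2 : 2 ≤ m + n) :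
    (times u v * z⁻¹).app 1 < -(times u v * z⁻¹).app 2 ↔
      (times u' v' * z⁻¹).app 1 < -(times u' v' * z⁻¹).app 2 := by
  have ea := z.app_app_inv (a := (-2 : ℤ)) (by omega)
  have eb := z.app_app_inv (a := (1 : ℤ)) (by omega)
  have ha := z⁻¹.natAbs_app (a := (-2 : ℤ)) (by omega) (by omega)
  have hb := z⁻¹.natAbs_app (a := (1 : ℤ)) (by omega) (by omega)
  rw [← app_neg, ← app_neg, app_mul, app_mul, app_mul, app_mul]
  refine hz.lt_iff_times hd hd0 hv ha.1 ha.2 hb.1 hb.2 (fun h => ?_) (by omega) ?_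
  · have := z⁻¹.natAbs_app_injective (by omega) (by omega) h
    omega
  · intro c h0 hc h3 h4
    have h5 := z.natAbs_app h0 hc
    have h6 : z.app c = z.app (-z⁻¹.app 1) := by rw [app_neg]; omega
    have h7 := z.app_injective hc (by omega) h6
    omega

end

open scoped TensorProduct
noncomputable section

open SignedPerm

/-! ### Standardized parts of windows -/

section Standardize

variable {N : ℕ} (w : SignedPerm N) {i : ℕ}

theorem length_take_window (hi : i ≤ N) : (w.window.take i).length = i := by
  rw [List.length_take, window_length, min_eq_left hi]

theorem length_drop_window : (w.window.drop i).length = N - i := by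
  rw [List.length_drop, window_length]

theorem wordApp_take_window {a : ℤ} (h0 : a ≠ 0) (ha : a.natAbs ≤ i) :
    wordApp (w.window.take i) a = w.app a := by
  rw [wordApp_take _ h0 ha, wordApp_window]

theorem wordApp_drop_window {a : ℤ} (h : 1 ≤ a) :
    wordApp (w.window.drop i) a = w.app (i + a) := by
  rw [wordApp_drop _ _ h, wordApp_window]

theorem take_window_nodup : (w.window.take i).Nodup :=
  (window_nodup w).sublist (List.take_sublist _ _)

theorem drop_window_nodup : (w.window.drop i).Nodup :=
  (window_nodup w).sublist (List.drop_sublist _ _)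

theorem take_window_natAbs_nodup : ((w.window.take i).map Int.natAbs).Nodup :=
  (window_natAbs_nodup w).sublist ((List.take_sublist _ _).map _)

theorem sameA_st_take (hi : i ≤ N) : SameA i (ofPerm (st (w.window.take i)).2).app w.app := by
  have h := sameA_st (take_window_nodup w (i := i))
  rw [length_take_window w hi] at h
  exact h.congr_right fun a h1 h2 => wordApp_take_window w (by omega) (by omega)

theorem sameA_st_drop :
    SameA (N - i) (ofPerm (st (w.window.drop i)).2).app (fun x => w.app (i + x)) := by
  have h := sameA_st (drop_window_nodup w (i := i))
  rw [length_drop_window w] at h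
  exact h.congr_right fun a h1 h2 => wordApp_drop_window w h1

theorem st_take_eq_iff (hi : i ≤ N) {v : Equiv.Perm (Fin i)} :
    st (w.window.take i) = ⟨i, v⟩ ↔ SameA i w.app (ofPerm v).app := by
  rw [st_eq_iff (take_window_nodup w), length_take_window w hi]
  have e : ∀ a : ℤ, 1 ≤ a → a ≤ i → wordApp (w.window.take i) a = w.app a := fun a h1 h2 =>
    wordApp_take_window w (by omega) (by omega)
  exact ⟨fun h => h.2.congr_left e, fun h => ⟨rfl, h.congr_left fun a h1 h2 => (e a h1 h2).symm⟩⟩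

theorem st_drop_eq_iff {m n : ℕ} (w : SignedPerm (m + n)) {v : Equiv.Perm (Fin n)} :
    st (w.window.drop m) = ⟨n, v⟩ ↔ SameA n (fun x => w.app (m + x)) (ofPerm v).app := by
  rw [st_eq_iff (drop_window_nodup w), length_drop_window w]
  have e : ∀ a : ℤ, 1 ≤ a → a ≤ n → wordApp (w.window.drop m) a = w.app (m + a) :=
    fun a h1 _ => wordApp_drop_window w h1
  exact ⟨fun h => h.2.congr_left e, fun h =>
    ⟨by omega, h.congr_left fun a h1 h2 => (e a h1 h2).symm⟩⟩

end Standardize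

/-! ### The group of type D -/

theorem app_s0B {n : ℕ} {a : ℤ} (ha : a.natAbs ≤ n) :
    (s0B n).app a = if a.natAbs = 1 then -a else a := by
  have key : ∀ i : Fin n, (s0B n).app ((i : ℕ) + 1)
      = if (i : ℕ) = 0 then -(((i : ℕ) : ℤ) + 1) else ((i : ℕ) : ℤ) + 1 := by
    intro i
    rw [app_fin]
    have h1 : (s0B n).sgn i = if (i : ℕ) = 0 then -1 else 1 := rfl
    have h2 : (s0B n).perm i = i := rfl
    rw [h1, h2]
    split_ifs <;> simp
  rcases lt_trichotomy a 0 with h | h | h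
  · obtain ⟨i, hi⟩ := exists_fin (n := n) (a := -a) (by omega) (by omega)
    have ha : a = -((i : ℕ) + 1) := by omega
    rw [ha, app_neg, key, Int.natAbs_neg]
    split_ifs <;> omega
  · rw [h, app_zero]; simp
  · obtain ⟨i, hi⟩ := exists_fin (n := n) (a := a) (by omega) (by omega)
    rw [hi, key]
    split_ifs <;> omega

theorem s0B_notMem {n : ℕ} (hn : 1 ≤ n) : signHom n (s0B n) = -1 := by
  change ∏ i : Fin n, (s0B n).sgn i = -1
  have h1 : ∀ i : Fin n, (s0B n).sgn i = if i = ⟨0, hn⟩ then -1 else 1 := fun i =>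
    if_congr (by rw [Fin.ext_iff]) rfl rfl
  rw [Finset.prod_congr rfl fun i _ => h1 i, Finset.prod_ite_eq']
  simp

theorem s0B_mul_self (n : ℕ) : s0B n * s0B n = 1 := by
  refine ext_app fun a h1 h2 => ?_
  rw [app_mul, app_s0B (a := a) (by omega), app_one (by omega)]
  split_ifs with h
  · rw [app_neg, app_s0B (by omega), if_pos h, neg_neg]
  · rw [app_s0B (by omega), if_neg h]

/-- `s0B` only exchanges the values `1` and `-1`, which no comparison of letters with different
absolute values notices. The parity can thus be corrected without changing the type D pattern. -/
theorem sameD_s0B_mul {n : ℕ} (w : SignedPerm n) : SameD n (s0B n * w).app w.app := by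
  have h : SameD n (s0B n).app id := by
    intro a b h1 h2 h3 h4 h5
    rw [app_s0B h2, app_s0B h4]
    simp only [id_eq]
    split_ifs <;> omega
  exact (h.comp w).congr_left fun a _ _ => (app_mul _ _ _).symm

/-- Elements of the group of type D are determined by their inversions. -/
theorem SameD.eq {n : ℕ} {w z : SignedPerm n} (hw : w ∈ groupD n) (hz : z ∈ groupD n)
    (h : SameD n w.app z.app) : w = z := by
  have h' : SameD n (w * z⁻¹).app id :=
    ((h.comp z⁻¹).congr_left fun a _ _ => (app_mul _ _ _).symm).congr_right
      fun a _ h2 => z.app_app_inv h2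
  have hy : w * z⁻¹ ∈ groupD n := mul_mem hw (inv_mem hz)
  suffices w * z⁻¹ = 1 from mul_inv_eq_one.mp this
  generalize w * z⁻¹ = y at h' hy
  -- This follows from `y p < y q` and `-y q < y p`. It makes the absolute values those of the
  -- identity and all letters after the first positive; the parity then fixes the first sign.
  have hpq : ∀ p q : ℤ, 1 ≤ p → p < q → q ≤ n →
      (y.app p).natAbs < (y.app q).natAbs ∧ 0 < y.app q := by
    intro p q h1 h2 h3
    have e1 := (h' p q (by omega) (by omega) (by omega) (by omega) (by omega)).mpr h2
    have e2 := (h' (-q) p (by omega) (by omega) (by omega) (by omega) (by omega)).mpr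
      (by simp only [id_eq]; omega)
    rw [app_neg] at e2
    omega
  have hperm : y.perm = 1 := perm_eq_of_lt_iff fun i j => by
    rw [Equiv.Perm.one_apply, Equiv.Perm.one_apply, Fin.lt_def, Fin.lt_def]
    have hi := y.natAbs_app_fin i
    have hj := y.natAbs_app_fin j
    rcases lt_trichotomy (i : ℕ) j with h | h | h
    · have := hpq ((i : ℕ) + 1) ((j : ℕ) + 1) (by omega) (by omega) (by omega)
      omega
    · have := Fin.ext h
      subst this
      omega
    · have := hpq ((j : ℕ) + 1) ((i : ℕ) + 1) (by omega) (by omega) (by omega)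
      omega
  have hsgn : ∀ i : Fin n, (i : ℕ) ≠ 0 → y.sgn i = 1 := by
    intro i hi
    have := hpq 1 ((i : ℕ) + 1) (by omega) (by omega) (by omega)
    rcases y.app_fin_cases i with h | h
    · exact h.1
    · omega
  refine SignedPerm.ext hperm (funext fun i => ?_)
  change y.sgn i = 1
  by_cases hi : (i : ℕ) = 0
  · have hprod : ∏ j, y.sgn j = 1 := hy
    rwa [Finset.prod_eq_single i (fun j _ hj => hsgn j fun h => hj (Fin.ext (h.trans hi.symm)))
      (fun h => absurd (Finset.mem_univ i) h)] at hprod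
  · exact hsgn i hi

/-- The type D standardization of a word with different nonzero absolute values. -/
theorem leftStD_spec {a : List ℤ} (ha : (a.map Int.natAbs).Nodup) (h0 : ∀ x ∈ a, x ≠ 0)
    (hn : 1 ≤ a.length) : (leftStD a).1 = a.length ∧ (leftStD a).2 ∈ groupD (leftStD a).1 ∧
      SameD a.length (leftStD a).2.app (wordApp a) := by
  classical
  have hw0 : ∀ x : ℤ, 1 ≤ x → x ≤ a.length → wordApp a x ∈ a := by
    intro x h1 h2
    obtain ⟨i, rfl⟩ := exists_fin h1 h2
    rw [wordApp_succ, List.getD_eq_getElem _ _ i.2]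
    exact List.getElem_mem i.2
  have hB : SameD a.length (stB a).2.app (wordApp a) := by
    refine (sameB_stB ha).sameD (app_neg _) (wordApp_neg a) ?_ ?_ ?_ ?_
    · intro x y h1 h2 h3 h4 hxy h
      have := (stB a).2.natAbs_app_injective (a := x) (b := y)
        (by change _ ≤ a.length; omega) (by change _ ≤ a.length; omega) h
      omega
    · intro x y h1 h2 h3 h4 hxy h
      obtain ⟨i, rfl⟩ := exists_fin h1 h2
      obtain ⟨j, rfl⟩ := exists_fin h3 h4
      rw [wordApp_succ, wordApp_succ, List.getD_eq_getElem _ _ i.2,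
        List.getD_eq_getElem _ _ j.2] at h
      have := List.nodup_iff_injective_get.mp ha
        (a₁ := ⟨i, by simp⟩) (a₂ := ⟨j, by simp⟩) (by simpa using h)
      have h'' := congrArg Fin.val this
      simp only at h''
      omega
    · intro x h1 h2
      exact ((stB a).2.natAbs_app (a := x) (by omega) (by change _ ≤ a.length; omega)).1
    · intro x h1 h2
      exact h0 _ (hw0 x h1 h2)
  by_cases h : (stB a).2 ∈ groupD (stB a).1
  · have e : leftStD a = stB a := if_pos h
    rw [e]
    exact ⟨rfl, h, hB⟩
  · have e : leftStD a = ⟨(stB a).1, s0B (stB a).1 * (stB a).2⟩ := if_neg h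
    rw [e]
    refine ⟨rfl, ?_, (sameD_s0B_mul (n := a.length) (stB a).2).trans hB⟩
    have h1 : signHom (stB a).1 (s0B (stB a).1) = -1 := s0B_notMem (n := a.length) hn
    have h2 : signHom (stB a).1 (stB a).2 = -1 := (Int.units_eq_one_or _).resolve_left h
    change signHom (stB a).1 (s0B (stB a).1 * (stB a).2) = 1
    rw [map_mul, h1, h2]
    rfl

section Parts

variable {N : ℕ} (w : SignedPerm N) {i : ℕ}

theorem mem_window {x : ℤ} (hx : x ∈ w.window) : x ≠ 0 ∧ x.natAbs ≤ N := by
  rw [window, List.mem_ofFn] at hx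
  obtain ⟨i, rfl⟩ := hx
  rw [← app_fin]
  exact w.natAbs_app (by omega) (by omega)

theorem leftStD_take (h1 : 1 ≤ i) (hi : i ≤ N) : (leftStD (w.window.take i)).1 = i ∧
    (leftStD (w.window.take i)).2 ∈ groupD (leftStD (w.window.take i)).1 ∧
      SameD i (leftStD (w.window.take i)).2.app w.app := by
  have h := leftStD_spec (take_window_natAbs_nodup w (i := i))
    (fun x hx => (mem_window w (List.mem_of_mem_take hx)).1)
    (by rw [length_take_window w hi]; exact h1)
  rw [length_take_window w hi] at h
  exact ⟨h.1, h.2.1, h.2.2.congr_right fun a h1 h2 => wordApp_take_window w h1 h2⟩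

/-- By `SameD.eq` the pattern determines the element of type D, whether or not a parity correction
took place. -/
theorem leftStD_take_eq_iff (h1 : 1 ≤ i) (hi : i ≤ N) {u : SignedPerm i} (hu : u ∈ groupD i) :
    leftStD (w.window.take i) = ⟨i, u⟩ ↔ SameD i w.app u.app := by
  obtain ⟨e1, e2, e3⟩ := leftStD_take w h1 hi
  generalize leftStD (w.window.take i) = x at *
  obtain ⟨k, x⟩ := x
  simp only at e1 e2 e3
  subst e1
  constructor
  · intro h
    obtain rfl : x = u := eq_of_heq (Sigma.mk.inj h).2
    exact e3.symm
  · intro h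
    rw [SameD.eq e2 hu (e3.trans h)]

end Parts

/-! ### Cuts of permutations -/

section CutA

/-- The odd function of a permutation. -/
def PermA.app (s : PermA) : ℤ → ℤ := (ofPerm s.2).app

theorem PermA.ext_of_sameA {s t : PermA} (h : s.1 = t.1) (h' : SameA s.1 s.app t.app) : s = t := by
  obtain ⟨n, s⟩ := s
  obtain ⟨m, t⟩ := t
  obtain rfl : n = m := h
  obtain rfl : s = t := SameA.eq h'
  rfl

/-- Cutting permutations in two. -/
def cutA : Cut PermA PermA where
  lo := 0
  fst i w := st ((oneLine w.2).take i)
  snd i w := st ((oneLine w.2).drop i)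

theorem cutA_fst_deg {i : ℕ} {w : PermA} (h : i ≤ w.1) : (cutA.fst i w).1 = i := by
  change ((oneLine w.2).take i).length = i
  rw [oneLine_eq, length_take_window _ h]

theorem cutA_snd_deg {i : ℕ} {w : PermA} : (cutA.snd i w).1 = w.1 - i := by
  change ((oneLine w.2).drop i).length = w.1 - i
  rw [oneLine_eq, length_drop_window]

/-- With `cutA_snd_app`, this trades standardization for patterns: identities between iterated cuts
become chains of equal patterns. -/
theorem cutA_fst_app {i : ℕ} {w : PermA} (h : i ≤ w.1) : SameA i (cutA.fst i w).app w.app := by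
  have := sameA_st_take (ofPerm w.2) h
  rw [← oneLine_eq] at this
  exact this

theorem cutA_snd_app (i : ℕ) (w : PermA) :
    SameA (w.1 - i) (cutA.snd i w).app (fun x => w.app (i + x)) := by
  have := sameA_st_drop (ofPerm w.2) (i := i)
  rw [← oneLine_eq] at this
  exact this

theorem cutA_fst_eq_iff {m n : ℕ} {w : Equiv.Perm (Fin (m + n))} {u : Equiv.Perm (Fin m)} :
    cutA.fst m ⟨m + n, w⟩ = ⟨m, u⟩ ↔ SameA m (ofPerm w).app (ofPerm u).app := by
  change st ((oneLine w).take m) = _ ↔ _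
  rw [oneLine_eq, st_take_eq_iff _ (by omega)]

theorem cutA_snd_eq_iff {m n : ℕ} {w : Equiv.Perm (Fin (m + n))} {v : Equiv.Perm (Fin n)} :
    cutA.snd m ⟨m + n, w⟩ = ⟨n, v⟩ ↔
      SameA n (fun x => (ofPerm w).app (m + x)) (ofPerm v).app := by
  change st ((oneLine w).drop m) = _ ↔ _
  rw [oneLine_eq, st_drop_eq_iff]

/-- The descents of a permutation, in terms of its order pattern. -/
theorem lt_iff_of_desA_eq {w w' : PermA} (h1 : w.1 = w'.1) (h2 : desA w.2 = desA w'.2) {p : ℕ}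
    (hp : 1 ≤ p) (hp' : p < w.1) : w.app (p + 1) < w.app p ↔ w'.app (p + 1) < w'.app p := by
  have := Finset.ext_iff.mp h2 p
  have hp'' : p < w'.1 := by omega
  rw [mem_desA, mem_desA] at this
  simp only [hp, hp', hp'', true_and] at this
  exact this

theorem desA_eq_of_lt_iff {w w' : PermA} (h1 : w.1 = w'.1)
    (h : ∀ p : ℕ, 1 ≤ p → p < w.1 → (w.app (p + 1) < w.app p ↔ w'.app (p + 1) < w'.app p)) :
    desA w.2 = desA w'.2 := by
  ext p
  rw [mem_desA, mem_desA]
  refine and_congr_right fun hp => ⟨fun k => ⟨by omega, (h p hp k.1).mp k.2⟩, fun k => ?_⟩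
  have hp' : p < w.1 := by omega
  exact ⟨hp', (h p hp hp').mpr k.2⟩

/-- Left multiplication in one degree. -/
def leftMulA {k : ℕ} (y : Equiv.Perm (Fin k)) (w : PermA) : PermA :=
  ⟨w.1, (if h : w.1 = k then h ▸ y else 1) * w.2⟩

theorem leftMulA_injective {k : ℕ} (y : Equiv.Perm (Fin k)) : Function.Injective (leftMulA y) := by
  rintro ⟨a, x⟩ ⟨b, x'⟩ h
  obtain rfl : a = b := congrArg Sigma.fst h
  obtain rfl : x = x' := mul_left_cancel (eq_of_heq (Sigma.mk.inj h).2)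
  rfl

theorem leftMulA_apply {k : ℕ} (y w : Equiv.Perm (Fin k)) :
    leftMulA y ⟨k, w⟩ = ⟨k, y * w⟩ := by
  rw [leftMulA]
  simp only [dite_true]

/-- Cuts restrict patterns, so nested cuts and the descents of the halves can be read off from
patterns. For the exchange, `w⁻¹ = z (u⁻¹ × v⁻¹)` with `z` minimal, and `w = (u × v) z⁻¹` is sent to
`(u' × v') z⁻¹`, which has the same descents by `IsMinRep.adjacent`. -/
theorem isCut_cutA : IsCut cutA cutA where
  base_lo := rfl
  lo_le _ := Nat.zero_le _
  deg_fst _ h := cutA_fst_deg h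
  deg_snd _ _ := cutA_snd_deg
  fst_fst {i j w} _ h1 h2 := by
    have hj := cutA_fst_deg (w := w) h2
    have hi := cutA_fst_deg (i := i) (w := cutA.fst j w) (by omega)
    refine PermA.ext_of_sameA (hi.trans (cutA_fst_deg (h1.trans h2)).symm) ?_
    rw [hi]
    exact ((cutA_fst_app (by omega)).trans ((cutA_fst_app h2).mono h1)).trans
      (cutA_fst_app (h1.trans h2)).symm
  snd_fst {i j w} _ h1 h2 := by
    have h2' : j ≤ w.1 := h2
    have hj := cutA_fst_deg (w := w) h2
    have hi := cutA_snd_deg (i := i) (w := cutA.fst j w)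
    have hi' := cutA_snd_deg (i := i) (w := w)
    have hk := cutA_fst_deg (i := j - i) (w := cutA.snd i w) (by omega)
    refine PermA.ext_of_sameA (by omega) ?_
    have e1 := cutA_snd_app i (cutA.fst j w)
    have e2 := (cutA_fst_app h2).shift (k := i) (l := j - i) (by omega)
    have e3 := (cutA_snd_app i w).mono (k := j - i) (by omega)
    have e4 := cutA_fst_app (i := j - i) (w := cutA.snd i w) (by omega)
    rw [hj] at e1
    rw [hi, hj]
    exact (e1.trans e2).trans (e4.trans e3).symm
  snd_snd {i j w} _ h1 h2 := by
    have h2' : j ≤ w.1 := h2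
    have hi := cutA_snd_deg (i := i) (w := w)
    have hj := cutA_snd_deg (i := j) (w := w)
    have hk := cutA_snd_deg (i := j - i) (w := cutA.snd i w)
    refine PermA.ext_of_sameA (by omega) ?_
    have e1 := cutA_snd_app (j - i) (cutA.snd i w)
    have e2 := (cutA_snd_app i w).shift (k := j - i) (l := w.1 - j) (by omega)
    have e3 := cutA_snd_app j w
    have hd : (cutA.snd i w).1 - (j - i) = w.1 - j := by omega
    rw [hd] at e1
    rw [hk, hd]
    refine (e1.trans (e2.congr_right fun a _ _ => ?_)).trans e3.symm
    congr 1
    push_cast [h1]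
    ring
  fst_deg w := by
    have h : w.1 ≤ w.1 := le_rfl
    refine PermA.ext_of_sameA (cutA_fst_deg h) ?_
    change SameA (cutA.fst w.1 w).1 _ _
    rw [cutA_fst_deg h]
    exact cutA_fst_app h
  invt_invt w := by
    change (⟨w.1, w.2⁻¹⁻¹⟩ : PermA) = w
    rw [inv_inv]
  deg_invt _ := rfl
  des_fst {i w w'} h1 h2 _ h3 := by
    have h1' : w.1 = w'.1 := h1
    have h3' : i ≤ w.1 := h3
    have hi := cutA_fst_deg (w := w) h3
    have hi' := cutA_fst_deg (i := i) (w := w') (by omega)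
    refine desA_eq_of_lt_iff (hi.trans hi'.symm) fun p hp hp' => ?_
    rw [hi] at hp'
    rw [cutA_fst_app h3 _ _ (by omega) (by omega) (by omega) (by omega),
      cutA_fst_app (w := w') (by omega) _ _ (by omega) (by omega) (by omega) (by omega)]
    exact lt_iff_of_desA_eq h1 h2 hp (by omega)
  des_snd {i w w'} h1 h2 _ h3 := by
    have h1' : w.1 = w'.1 := h1
    have h3' : i ≤ w.1 := h3
    have hi := cutA_snd_deg (i := i) (w := w)
    have hi' := cutA_snd_deg (i := i) (w := w')
    refine desA_eq_of_lt_iff (by rw [hi, hi', h1']) fun p hp hp' => ?_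
    rw [hi] at hp'
    rw [cutA_snd_app i w _ _ (by omega) (by omega) (by omega) (by omega),
      cutA_snd_app i w' _ _ (by omega) (by omega) (by omega) (by omega)]
    have := lt_iff_of_desA_eq h1 h2 (p := i + p) (by omega) (by omega)
    push_cast at this
    rw [add_assoc] at this
    exact this
  exchange {u u' v v'} hu hu' hv hv' := by
    obtain ⟨m, u⟩ := u
    obtain ⟨m', u'⟩ := u'
    obtain ⟨n, v⟩ := v
    obtain ⟨n', v'⟩ := v'
    obtain rfl : m = m' := hu
    obtain rfl : n = n' := hv
    refine ⟨leftMulA (timesA u' v' * (timesA u v)⁻¹), leftMulA_injective _, ?_⟩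
    rintro ⟨k, w⟩ (rfl : k = m + n) h1 h2
    have h1' : SameA m (ofPerm w⁻¹).app (ofPerm u⁻¹).app := cutA_fst_eq_iff.mp h1
    have h2' : SameA n (fun x => (ofPerm w⁻¹).app (m + x)) (ofPerm v⁻¹).app :=
      cutA_snd_eq_iff.mp h2
    -- All letters are positive, so equal patterns of type A are equal patterns of type D and the
    -- signed argument applies.
    have h1D : SameD m (ofPerm w⁻¹).app (ofPerm u⁻¹).app := by
      refine (h1'.sameB (fun a ha ha' => app_ofPerm_pos _ ha (by omega))
        (fun a ha ha' => app_ofPerm_pos _ ha (by omega))).sameD (app_neg _) (app_neg _)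
        (fun a b _ _ _ _ hab h => ?_) (fun a b _ _ _ _ hab h => ?_)
        (fun a _ _ => (natAbs_app _ (by omega) (by omega)).1)
        (fun a _ _ => (natAbs_app _ (by omega) (by omega)).1)
      · have := natAbs_app_injective _ (by omega) (by omega) h
        omega
      · have := natAbs_app_injective _ (by omega) (by omega) h
        omega
    have hz := isMinRep_mul_times h1D h2'
    set z := ofPerm w⁻¹ * (times (ofPerm u⁻¹) v⁻¹)⁻¹ with hz'
    have hw : ofPerm w = times (ofPerm u) v * z⁻¹ := by
      rw [hz', mul_inv_rev, inv_inv, ofPerm_inv, ofPerm_inv, ← times_inv, inv_inv,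
        mul_inv_cancel_left]
    have hg : ofPerm (timesA u' v' * (timesA u v)⁻¹ * w) = times (ofPerm u') v' * z⁻¹ := by
      rw [ofPerm_mul, ofPerm_mul, ofPerm_inv, ofPerm_timesA, ofPerm_timesA, hw,
        mul_assoc, inv_mul_cancel_left]
    have hg' : ofPerm (timesA u' v' * (timesA u v)⁻¹ * w)⁻¹
        = z * times (ofPerm u'⁻¹) v'⁻¹ := by
      rw [ofPerm_inv, hg, mul_inv_rev, inv_inv, times_inv, ofPerm_inv]
    obtain ⟨k1, k2⟩ := hz.mul_times (ofPerm u'⁻¹) v'⁻¹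
    rw [← hg'] at k1 k2
    rw [leftMulA_apply]
    refine ⟨rfl, cutA_fst_eq_iff.mpr k1.sameA, cutA_snd_eq_iff.mpr k2, ?_⟩
    refine desA_eq_of_lt_iff rfl fun p hp hp' => ?_
    change (ofPerm _).app _ < (ofPerm _).app _ ↔ (ofPerm _).app _ < (ofPerm _).app _
    rw [hg, hw]
    refine (hz.adjacent (fun a ha ha' => ?_) (fun hm => ?_) hv' hp hp').symm
    · have := lt_iff_of_desA_eq (w := ⟨m, u⟩) (w' := ⟨m, u'⟩) rfl hu' (p := a.toNat) (by omega)
        (by simp only; omega)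
      have ea : ((a.toNat : ℕ) : ℤ) = a := by omega
      rw [ea] at this
      exact this
    -- Letters are positive, so neither `u` nor `u'` has a descent at zero.
    · have e1 := app_ofPerm_pos u (a := 1) (by omega) (by omega)
      have e2 := app_ofPerm_pos u (a := 2) (by omega) (by omega)
      have e3 := app_ofPerm_pos u' (a := 1) (by omega) (by omega)
      have e4 := app_ofPerm_pos u' (a := 2) (by omega) (by omega)
      omega

theorem isCutUnit_cutA : IsCutUnit cutA ⟨0, 1⟩ where
  deg_unit := rfl
  eq_unit v hv := by
    obtain ⟨n, v⟩ := v
    obtain rfl : n = 0 := hv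
    rw [Subsingleton.elim v 1]
  snd_zero v := by
    refine PermA.ext_of_sameA (cutA_snd_deg.trans (Nat.sub_zero _)) ?_
    have h := cutA_snd_app 0 v
    rw [← cutA_snd_deg (i := 0) (w := v)] at h
    exact h.congr_right fun a _ _ => by simp
  invt_unit := rfl

end CutA

/-! ### Cuts in type D. -/

section CutD

/-- The odd function of an element of a group of type D. -/
def PermD.app (s : PermD) : ℤ → ℤ := s.1.2.app

theorem PermD.ext_of_sameD {s t : PermD} (h : s.1.1 = t.1.1) (h' : SameD s.1.1 s.app t.app) :
    s = t := by
  obtain ⟨⟨n, s⟩, hs⟩ := s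
  obtain ⟨⟨m, t⟩, ht⟩ := t
  obtain rfl : n = m := h
  obtain rfl : s = t := SameD.eq hs.2 ht.2 h'
  rfl

/-- Cutting elements of the groups of type D in two. -/
def cutD : Cut PermA PermD where
  lo := 2
  -- For `2 ≤ i ≤ deg w` the condition holds by `leftStD_take`; the default `w` only makes the
  -- function total.
  fst i w := open Classical in
    if h : 2 ≤ (leftStD (w.1.2.window.take i)).1 ∧
      (leftStD (w.1.2.window.take i)).2 ∈ groupD (leftStD (w.1.2.window.take i)).1
    then ⟨leftStD (w.1.2.window.take i), h⟩ else w
  snd i w := st (w.1.2.window.drop i)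

theorem cutD_fst {i : ℕ} {w : PermD} (h2 : 2 ≤ i) (h : i ≤ w.1.1) :
    (cutD.fst i w).1 = leftStD (w.1.2.window.take i) := by
  obtain ⟨e1, e2, e3⟩ := leftStD_take w.1.2 (by omega) h
  exact congrArg Subtype.val (dif_pos ⟨by omega, e2⟩)

theorem cutD_fst_deg {i : ℕ} {w : PermD} (h2 : 2 ≤ i) (h : i ≤ w.1.1) :
    (cutD.fst i w).1.1 = i := by
  rw [cutD_fst h2 h, (leftStD_take w.1.2 (by omega) h).1]

theorem cutD_snd_deg {i : ℕ} {w : PermD} : (cutD.snd i w).1 = w.1.1 - i :=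
  length_drop_window w.1.2

theorem cutD_fst_app {i : ℕ} {w : PermD} (h2 : 2 ≤ i) (h : i ≤ w.1.1) :
    SameD i (cutD.fst i w).app w.app := by
  have := (leftStD_take w.1.2 (by omega) h).2.2
  rw [← cutD_fst h2 h] at this
  exact this

theorem cutD_snd_app (i : ℕ) (w : PermD) :
    SameA (w.1.1 - i) (cutD.snd i w).app (fun x => w.app (i + x)) :=
  sameA_st_drop w.1.2

theorem cutD_fst_eq_iff {m n : ℕ} {w : SignedPerm (m + n)} {hw} {u : SignedPerm m} {hu}
    (hm : 2 ≤ m) :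
    cutD.fst m ⟨⟨m + n, w⟩, hw⟩ = ⟨⟨m, u⟩, hu⟩ ↔ SameD m w.app u.app := by
  rw [Subtype.ext_iff, cutD_fst hm (Nat.le_add_right m n),
    leftStD_take_eq_iff w (by omega) (Nat.le_add_right m n) hu.2]

theorem cutD_snd_eq_iff {m n : ℕ} {w : SignedPerm (m + n)} {hw} {v : Equiv.Perm (Fin n)} :
    cutD.snd m ⟨⟨m + n, w⟩, hw⟩ = ⟨n, v⟩ ↔
      SameA n (fun x => w.app (m + x)) (ofPerm v).app :=
  st_drop_eq_iff w

/-- The descents of type D, in terms of inversions. -/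
theorem lt_iff_of_desD_eq {w w' : PermD} (h1 : w.1.1 = w'.1.1) (h2 : w.1.2.desD = w'.1.2.desD) :
    (w.app 1 < -w.app 2 ↔ w'.app 1 < -w'.app 2) ∧ ∀ p : ℕ, 1 ≤ p → p < w.1.1 →
      (w.app (p + 1) < w.app p ↔ w'.app (p + 1) < w'.app p) := by
  have hw := w.2.1
  constructor
  · have := Finset.ext_iff.mp h2 0
    rw [mem_desD, mem_desD] at this
    have h0 : 0 < w.1.1 := by omega
    have h0' : 0 < w'.1.1 := by omega
    simp [h0, h0'] at this
    exact this
  · intro p hp hp'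
    have := Finset.ext_iff.mp h2 p
    rw [mem_desD, mem_desD] at this
    have h0 : p ≠ 0 := by omega
    have hp'' : p < w'.1.1 := by omega
    simp [hp, hp', hp'', h0] at this
    exact this

theorem desD_eq_of_lt_iff {w w' : PermD} (h1 : w.1.1 = w'.1.1)
    (h0 : w.app 1 < -w.app 2 ↔ w'.app 1 < -w'.app 2)
    (h : ∀ p : ℕ, 1 ≤ p → p < w.1.1 → (w.app (p + 1) < w.app p ↔ w'.app (p + 1) < w'.app p)) :
    w.1.2.desD = w'.1.2.desD := by
  ext p
  rw [mem_desD, mem_desD]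
  have e : p < w.1.1 ↔ p < w'.1.1 := by omega
  refine ⟨fun k => ⟨e.mp k.1, k.2.imp (fun k' => ⟨k'.1, h0.mp k'.2⟩)
    fun k' => ⟨k'.1, (h p k'.1 k.1).mp k'.2⟩⟩, fun k => ⟨e.mpr k.1, k.2.imp
      (fun k' => ⟨k'.1, h0.mpr k'.2⟩) fun k' => ⟨k'.1, (h p k'.1 (e.mpr k.1)).mpr k'.2⟩⟩⟩

/-- Left multiplication in one degree. -/
def leftMulD {k : ℕ} (y : groupD k) (w : PermD) : PermD :=
  ⟨⟨w.1.1, (if h : w.1.1 = k then h ▸ y else (1 : groupD w.1.1)).1 * w.1.2⟩, w.2.1,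
    mul_mem (Subtype.property _) w.2.2⟩

theorem leftMulD_injective {k : ℕ} (y : groupD k) : Function.Injective (leftMulD y) := by
  rintro ⟨⟨a, x⟩, hx⟩ ⟨⟨b, x'⟩, hx'⟩ h
  have h' := congrArg Subtype.val h
  obtain rfl : a = b := congrArg Sigma.fst h'
  obtain rfl : x = x' := mul_left_cancel (eq_of_heq (Sigma.mk.inj h').2)
  rfl

theorem leftMulD_apply {k : ℕ} (y : groupD k) (w : SignedPerm k) (hw) :
    leftMulD y ⟨⟨k, w⟩, hw⟩ = ⟨⟨k, y.1 * w⟩, hw.1, mul_mem y.2 hw.2⟩ := by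
  simp only [leftMulD, dite_true]

/-- As in type A, with type D patterns in the left part. The exchange multiplies by an element of
the group of type D, so the parity is kept. -/
theorem isCut_cutD : IsCut cutA cutD where
  base_lo := rfl
  lo_le w := w.2.1
  deg_fst h h' := cutD_fst_deg h h'
  deg_snd _ _ := cutD_snd_deg
  fst_fst {i j w} h0 h1 h2 := by
    have h0' : 2 ≤ i := h0
    have hj := cutD_fst_deg (w := w) (h0'.trans h1) h2
    have hi := cutD_fst_deg (i := i) (w := cutD.fst j w) h0' (by omega)
    refine PermD.ext_of_sameD (hi.trans (cutD_fst_deg h0 (h1.trans h2)).symm) ?_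
    rw [hi]
    exact ((cutD_fst_app h0' (by omega)).trans ((cutD_fst_app (h0'.trans h1) h2).mono h1)).trans
      (cutD_fst_app h0' (h1.trans h2)).symm
  snd_fst {i j w} h0 h1 h2 := by
    have h0' : 2 ≤ i := h0
    have h2' : j ≤ w.1.1 := h2
    have hj := cutD_fst_deg (w := w) (h0'.trans h1) h2
    have hi := cutD_snd_deg (i := i) (w := cutD.fst j w)
    have hi' := cutD_snd_deg (i := i) (w := w)
    have hk := cutA_fst_deg (i := j - i) (w := cutD.snd i w) (by omega)
    refine PermA.ext_of_sameA (by omega) ?_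
    have e1 := cutD_snd_app i (cutD.fst j w)
    have e2 := (cutD_fst_app (h0'.trans h1) h2).sameA.shift (k := i) (l := j - i) (by omega)
    have e3 := (cutD_snd_app i w).mono (k := j - i) (by omega)
    have e4 := cutA_fst_app (i := j - i) (w := cutD.snd i w) (by omega)
    rw [hj] at e1
    rw [hi, hj]
    exact (e1.trans e2).trans (e4.trans e3).symm
  snd_snd {i j w} h0 h1 h2 := by
    have h2' : j ≤ w.1.1 := h2
    have hi := cutD_snd_deg (i := i) (w := w)
    have hj := cutD_snd_deg (i := j) (w := w)
    have hk := cutA_snd_deg (i := j - i) (w := cutD.snd i w)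
    refine PermA.ext_of_sameA (by omega) ?_
    have e1 := cutA_snd_app (j - i) (cutD.snd i w)
    have e2 := (cutD_snd_app i w).shift (k := j - i) (l := w.1.1 - j) (by omega)
    have e3 := cutD_snd_app j w
    have hd : (cutD.snd i w).1 - (j - i) = w.1.1 - j := by omega
    rw [hd] at e1
    rw [hk, hd]
    refine (e1.trans (e2.congr_right fun a _ _ => ?_)).trans e3.symm
    congr 1
    push_cast [h1]
    ring
  fst_deg w := by
    have h : w.1.1 ≤ w.1.1 := le_rfl
    refine PermD.ext_of_sameD (cutD_fst_deg w.2.1 h) ?_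
    change SameD (cutD.fst w.1.1 w).1.1 _ _
    rw [cutD_fst_deg w.2.1 h]
    exact cutD_fst_app w.2.1 h
  invt_invt w := by
    refine Subtype.ext ?_
    change (⟨w.1.1, w.1.2⁻¹⁻¹⟩ : PermB) = w.1
    rw [inv_inv]
  deg_invt _ := rfl
  des_fst {i w w'} h1 h2 h0 h3 := by
    have h0' : 2 ≤ i := h0
    have h1' : w.1.1 = w'.1.1 := h1
    have h3' : i ≤ w.1.1 := h3
    have hi := cutD_fst_deg (w := w) h0 h3
    have hi' := cutD_fst_deg (i := i) (w := w') h0 (by omega)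
    have e := cutD_fst_app (w := w) h0 h3
    have e' := cutD_fst_app (w := w') h0 (by omega)
    obtain ⟨k0, k⟩ := lt_iff_of_desD_eq h1 h2
    refine desD_eq_of_lt_iff (hi.trans hi'.symm) ?_ fun p hp hp' => ?_
    -- The descent at zero compares the letters at the positions `1` and `-2`, which type D patterns
    -- see.
    · have a1 := e 1 (-2) (by omega) (by omega) (by omega) (by omega) (by omega)
      have a2 := e' 1 (-2) (by omega) (by omega) (by omega) (by omega) (by omega)
      simp only [PermD.app, app_neg] at a1 a2 k0 ⊢
      rw [a1, a2, k0]
    · rw [hi] at hp'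
      rw [e _ _ (by omega) (by omega) (by omega) (by omega) (by omega),
        e' _ _ (by omega) (by omega) (by omega) (by omega) (by omega)]
      exact k p hp (by omega)
  des_snd {i w w'} h1 h2 h0 h3 := by
    have h0' : 2 ≤ i := h0
    have h1' : w.1.1 = w'.1.1 := h1
    have h3' : i ≤ w.1.1 := h3
    have hi := cutD_snd_deg (i := i) (w := w)
    have hi' := cutD_snd_deg (i := i) (w := w')
    refine desA_eq_of_lt_iff (by rw [hi, hi', h1']) fun p hp hp' => ?_
    rw [hi] at hp'
    rw [cutD_snd_app i w _ _ (by omega) (by omega) (by omega) (by omega),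
      cutD_snd_app i w' _ _ (by omega) (by omega) (by omega) (by omega)]
    have := (lt_iff_of_desD_eq h1 h2).2 (i + p) (by omega) (by omega)
    push_cast at this
    rw [add_assoc] at this
    exact this
  exchange {u u' v v'} hu hu' hv hv' := by
    obtain ⟨⟨m, u⟩, hm, hU⟩ := u
    obtain ⟨⟨m', u'⟩, hm', hU'⟩ := u'
    obtain ⟨n, v⟩ := v
    obtain ⟨n', v'⟩ := v'
    obtain rfl : m = m' := hu
    obtain rfl : n = n' := hv
    simp only at hm hU hU' hm'
    have hy : times u' v' * (times u v)⁻¹ ∈ groupD (m + n) :=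
      mul_mem (times_mem_groupD hU' v') (inv_mem (times_mem_groupD hU v))
    refine ⟨leftMulD ⟨_, hy⟩, leftMulD_injective _, ?_⟩
    rintro ⟨⟨k, w⟩, hw⟩ (rfl : k = m + n) h1 h2
    have h1' : SameD m w⁻¹.app u⁻¹.app := (cutD_fst_eq_iff hm).mp h1
    have h2' : SameA n (fun x => w⁻¹.app (m + x)) (ofPerm v⁻¹).app := cutD_snd_eq_iff.mp h2
    have hz := isMinRep_mul_times h1' h2'
    set z := w⁻¹ * (times u⁻¹ v⁻¹)⁻¹ with hz'
    have hw' : w = times u v * z⁻¹ := by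
      rw [hz', mul_inv_rev, inv_inv, ← times_inv, inv_inv, mul_inv_cancel_left]
    have hg : times u' v' * (times u v)⁻¹ * w = times u' v' * z⁻¹ := by
      rw [hw', mul_assoc, inv_mul_cancel_left]
    have hg' : (times u' v' * (times u v)⁻¹ * w)⁻¹ = z * times u'⁻¹ v'⁻¹ := by
      rw [hg, mul_inv_rev, inv_inv, times_inv]
    obtain ⟨k1, k2⟩ := hz.mul_times u'⁻¹ v'⁻¹
    rw [← hg'] at k1 k2
    obtain ⟨d0, d⟩ := lt_iff_of_desD_eq (w := ⟨⟨m, u⟩, hm, hU⟩) (w' := ⟨⟨m, u'⟩, hm', hU'⟩) rfl hu'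
    have d' : ∀ a : ℤ, 1 ≤ a → a < m → (u.app (a + 1) < u.app a ↔ u'.app (a + 1) < u'.app a) := by
      intro a ha ha'
      have := d a.toNat (by omega) (by simp only; omega)
      have ea : ((a.toNat : ℕ) : ℤ) = a := by omega
      rw [ea] at this
      exact this
    rw [leftMulD_apply]
    refine ⟨rfl, (cutD_fst_eq_iff hm).mpr k1, cutD_snd_eq_iff.mpr k2, ?_⟩
    refine desD_eq_of_lt_iff rfl ?_ fun p hp hp' => ?_
    · change (times u' v' * (times u v)⁻¹ * w).app 1 < -(times u' v' * (times u v)⁻¹ * w).app 2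
        ↔ w.app 1 < -w.app 2
      rw [hg, hw']
      exact (hz.adjacent_zero d' (fun _ => d0) hv' (by omega)).symm
    · change (times u' v' * (times u v)⁻¹ * w).app _ < (times u' v' * (times u v)⁻¹ * w).app _
        ↔ w.app _ < w.app _
      rw [hg, hw']
      exact (hz.adjacent d' (fun _ => d0) hv' hp hp').symm

end CutD

end

open scoped TensorProduct
noncomputable section

open SignedPerm

/-! ### Subwords of windows, in terms of the inverse -/

/-- Windows and their hat words are sorted by `w⁻¹`, so their subwords can be identified from the
letters and this sorting alone. -/
theorem List.eq_of_pairwise_lt {α β : Type} [LinearOrder β] {f : α → β} {l l' : List α}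
    (h : l.Pairwise fun a b => f a < f b) (h' : l'.Pairwise fun a b => f a < f b)
    (hl : ∀ a, a ∈ l ↔ a ∈ l') : l = l' := by
  have hn : ∀ {l : List α}, (l.Pairwise fun a b => f a < f b) → l.Nodup := fun h =>
    h.imp fun hab e => absurd hab (by rw [e]; exact lt_irrefl _)
  exact List.Perm.eq_of_pairwise (fun a b _ _ h1 h2 => absurd h1 h2.asymm) h h'
    ((List.perm_ext_iff_of_nodup (hn h) (hn h')).mpr hl)

section Subwords

variable {N : ℕ} (w : SignedPerm N)

theorem mem_window_iff {y : ℤ} : y ∈ w.window ↔ 1 ≤ w⁻¹.app y := by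
  rw [window, List.mem_ofFn]
  constructor
  · rintro ⟨i, rfl⟩
    rw [← app_fin, app_inv_app _ (by omega)]
    omega
  · intro h
    have hy : y.natAbs ≤ N := by
      by_contra hy
      rw [app_of_lt _ (by omega)] at h
      omega
    have h0 : y ≠ 0 := by
      rintro rfl
      rw [app_zero] at h
      omega
    have := (w⁻¹.natAbs_app h0 hy).2
    obtain ⟨i, hi⟩ := exists_fin (n := N) h (by omega)
    exact ⟨i, by rw [← app_fin, ← hi, app_app_inv _ hy]⟩

theorem window_pairwise : w.window.Pairwise fun a b => w⁻¹.app a < w⁻¹.app b := by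
  rw [window, List.pairwise_ofFn]
  intro i j hij
  rw [Fin.lt_def] at hij
  rw [← app_fin, ← app_fin, app_inv_app _ (by omega), app_inv_app _ (by omega)]
  omega

theorem mem_hat_window {y : ℤ} : y ∈ hat w.window ↔ 1 ≤ y ∧ y ≤ N := by
  have hm : ∀ y, y ∈ w.window → y ≠ 0 ∧ y.natAbs ≤ N := fun y => mem_window w
  simp only [hat, List.mem_append, List.mem_map, List.mem_reverse, List.mem_filter,
    decide_eq_true_eq]
  constructor
  · rintro (⟨z, ⟨h1, h2⟩, rfl⟩ | ⟨h1, h2⟩)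
    · have := hm _ h1
      omega
    · have := hm _ h1
      omega
  · rintro ⟨h1, h2⟩
    have h3 := w⁻¹.natAbs_app (a := y) (by omega) (by omega)
    by_cases h : 1 ≤ w⁻¹.app y
    · exact Or.inr ⟨(mem_window_iff w).mpr h, by omega⟩
    · refine Or.inl ⟨-y, ⟨(mem_window_iff w).mpr ?_, by omega⟩, neg_neg y⟩
      rw [app_neg]
      omega

/-- A negated negative letter sits at the negative of its position. Reading these first and from
right to left therefore lists `1, …, N` in the order of `w⁻¹`. -/
theorem hat_window_pairwise : (hat w.window).Pairwise fun a b => w⁻¹.app a < w⁻¹.app b := by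
  rw [hat, List.pairwise_append]
  refine ⟨?_, (window_pairwise w).filter _, ?_⟩
  · rw [List.pairwise_map, List.pairwise_reverse]
    refine ((window_pairwise w).filter _).imp fun {a b} h => ?_
    rw [app_neg, app_neg]
    omega
  · intro a ha b hb
    rw [List.mem_map] at ha
    obtain ⟨c, hc, rfl⟩ := ha
    rw [List.mem_reverse, List.mem_filter] at hc
    rw [List.mem_filter] at hb
    have h1 := (mem_window_iff w).mp hc.1
    have h2 := (mem_window_iff w).mp hb.1
    rw [app_neg]
    omega

/-- Both words consist of the letters `k + 1, …, k + r`, sorted by `w⁻¹`. -/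
theorem subword_hat_window {k r : ℕ} (h : k + r ≤ N) {σ : Equiv.Perm (Fin r)}
    (hσ : SameA r (ofPerm σ).app fun a => w⁻¹.app (k + a)) :
    subword (hat w.window) (k + 1) (k + r) = (oneLine σ⁻¹).map (fun a => (k : ℤ) + a) := by
  refine List.eq_of_pairwise_lt (f := w⁻¹.app) ((hat_window_pairwise w).filter _) ?_ fun y => ?_
  · rw [List.pairwise_map, oneLine_eq]
    refine (window_pairwise (ofPerm σ⁻¹)).imp_of_mem fun {a b} ha hb hab => ?_
    rw [← ofPerm_inv, inv_inv] at hab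
    have hp : ∀ a, a ∈ (ofPerm σ⁻¹).window → 1 ≤ a ∧ a ≤ r := fun a ha => by
      have h1 := mem_window _ ha
      rw [mem_window_iff, ← ofPerm_inv, inv_inv] at ha
      refine ⟨?_, by omega⟩
      by_contra hn
      have := app_ofPerm_pos σ (a := -a) (by omega) (by omega)
      rw [app_neg] at this
      omega
    exact (hσ a b (hp a ha).1 (hp a ha).2 (hp b hb).1 (hp b hb).2).mp hab
  · rw [subword, List.mem_filter, mem_hat_window, List.mem_map, decide_eq_true_eq]
    constructor
    · rintro ⟨⟨h1, h2⟩, h3, h4⟩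
      refine ⟨y - k, ?_, by ring⟩
      rw [oneLine_eq, mem_window_iff, ← ofPerm_inv, inv_inv]
      exact app_ofPerm_pos σ (by omega) (by omega)
    · rintro ⟨a, ha, rfl⟩
      rw [oneLine, List.mem_ofFn] at ha
      obtain ⟨i, rfl⟩ := ha
      have := (σ⁻¹ i).2
      omega

theorem st_map_oneLine {n : ℕ} (v : Equiv.Perm (Fin n)) (k : ℤ) :
    st ((oneLine v).map fun a => k + a) = ⟨n, v⟩ := by
  have hl : (oneLine v).length = n := List.length_ofFn
  rw [st_eq_iff]
  · refine ⟨by rw [List.length_map, hl], fun a b h1 h2 h3 h4 => ?_⟩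
    have e : ∀ i : Fin n, wordApp ((oneLine v).map fun a => k + a) ((i : ℕ) + 1)
        = k + (ofPerm v).app ((i : ℕ) + 1) := fun i => by
      rw [← wordApp_window, ← oneLine_eq, wordApp_succ, wordApp_succ,
        List.getD_eq_getElem _ _ (by rw [List.length_map, hl]; exact i.2),
        List.getD_eq_getElem _ _ (by rw [hl]; exact i.2), List.getElem_map]
    obtain ⟨i, rfl⟩ := exists_fin h1 h2
    obtain ⟨j, rfl⟩ := exists_fin h3 h4
    rw [e, e]
    omega
  · rw [oneLine_eq]
    exact (window_nodup _).map fun a b h => by simpa using h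

theorem st_oneLine {n : ℕ} (v : Equiv.Perm (Fin n)) : st (oneLine v) = ⟨n, v⟩ := by
  have := st_map_oneLine v 0
  simpa using this

/-- Both words are sorted by the absolute value of `w⁻¹`, the position of a letter. They have the
same letters because `τ` and `w⁻¹` have the same signs. -/
theorem subword_window {m : ℕ} (hm : m ≤ N) {τ : SignedPerm m} (hτ : SameB m τ.app w⁻¹.app) :
    subword w.window 1 m = τ⁻¹.window := by
  refine List.eq_of_pairwise_lt (f := fun a => (w⁻¹.app a).natAbs) ?_ ?_ fun y => ?_
  · refine List.Pairwise.filter _ ((window_pairwise w).imp_of_mem fun {a b} ha hb hab => ?_)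
    rw [mem_window_iff] at ha hb
    omega
  · refine (window_pairwise τ⁻¹).imp_of_mem fun {a b} ha hb hab => ?_
    have ha' := mem_window _ ha
    have hb' := mem_window _ hb
    rw [mem_window_iff] at ha hb
    rw [inv_inv] at *
    have key : ∀ a : ℤ, ∃ a' : ℤ, (a' = a ∨ a' = -a) ∧ 0 ≤ a' ∧
        (τ.app a').natAbs = (τ.app a).natAbs ∧ (w⁻¹.app a').natAbs = (w⁻¹.app a).natAbs := by
      intro a
      rcases le_total 0 a with h | h
      · exact ⟨a, Or.inl rfl, h, rfl, rfl⟩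
      · exact ⟨-a, Or.inr rfl, by omega, by rw [app_neg, Int.natAbs_neg],
          by rw [app_neg, Int.natAbs_neg]⟩
    obtain ⟨c, c1, c2, c3, c4⟩ := key a
    obtain ⟨d, d1, d2, d3, d4⟩ := key b
    have := hτ.2 c d (by omega) (by omega) (by omega) (by omega)
    omega
  · rw [subword, List.mem_filter, mem_window_iff, mem_window_iff, inv_inv, decide_eq_true_eq]
    have key : ∀ y : ℤ, 1 ≤ y → y ≤ m → (1 ≤ w⁻¹.app y ↔ 1 ≤ τ.app y) ∧
        (1 ≤ w⁻¹.app (-y) ↔ 1 ≤ τ.app (-y)) := fun y h1 h2 => by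
      have h3 := hτ.1 y h1 h2
      have h4 := (τ.natAbs_app (a := y) (by omega) (by omega)).1
      have h5 := (w⁻¹.natAbs_app (a := y) (by omega) (by omega)).1
      rw [app_neg, app_neg]
      omega
    constructor
    · rintro ⟨h1, h2, h3⟩
      rcases le_total 0 y with h | h
      · exact (key y (by omega) (by omega)).1.mp h1
      · have := (key (-y) (by omega) (by omega)).2
        rw [neg_neg] at this
        exact this.mp h1
    · intro h1
      have h2 : y.natAbs ≤ m := by
        by_contra hy
        rw [app_of_lt _ (by omega)] at h1
        omega
      have h0 : y ≠ 0 := by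
        rintro rfl
        rw [app_zero] at h1
        omega
      refine ⟨?_, by omega, h2⟩
      rcases le_total 0 y with h | h
      · exact (key y (by omega) (by omega)).1.mpr h1
      · have := (key (-y) (by omega) (by omega)).2
        rw [neg_neg] at this
        exact this.mpr h1

theorem stB_window {m : ℕ} (v : SignedPerm m) : stB v.window = ⟨m, v⟩ :=
  stB_eq (window_natAbs_nodup v) (window_length v)
    ⟨fun a _ _ => by rw [wordApp_window], fun a b _ _ _ _ => by rw [wordApp_window, wordApp_window]⟩

/-- The inverse of a signed permutation of any degree. -/
def PermB.inv (b : PermB) : PermB := ⟨b.1, b.2⁻¹⟩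

theorem PermB.inv_inv (b : PermB) : b.inv.inv = b := by
  change (⟨b.1, b.2⁻¹⁻¹⟩ : PermB) = b
  rw [_root_.inv_inv]

theorem PermB.inv_eq_iff {b c : PermB} : b.inv = c ↔ b = c.inv :=
  ⟨fun h => by rw [← h, b.inv_inv], fun h => by rw [h, c.inv_inv]⟩

/-- The letters of `w` up to `m` correspond to the first `m` positions of `w⁻¹`. Inversion preserves
the parity and turns right into left multiplication by the involution `s0B`, so the two corrections
occur together. -/
theorem rightStD_subword_window {m : ℕ} (hm : m ≤ N) :
    rightStD (subword w.window 1 m) = (leftStD (w⁻¹.window.take m)).inv := by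
  have h := sameB_stB (take_window_natAbs_nodup w⁻¹ (i := m))
  have hl : (stB (w⁻¹.window.take m)).1 = m := length_take_window w⁻¹ hm
  rw [length_take_window w⁻¹ hm] at h
  generalize hs : stB (w⁻¹.window.take m) = s at h hl
  obtain ⟨k, τ⟩ := s
  obtain rfl : k = m := hl
  have hτ : SameB k τ.app w⁻¹.app := by
    have e : ∀ a : ℤ, 1 ≤ a → a ≤ k → wordApp (w⁻¹.window.take k) a = w⁻¹.app a := fun a h1 h2 =>
      wordApp_take_window w⁻¹ (by omega) (by omega)
    refine ⟨fun a h1 h2 => ?_, fun a b h1 h2 h3 h4 => ?_⟩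
    · rw [← e a h1 h2]; exact h.1 a h1 h2
    · rw [← e a h1 h2, ← e b h3 h4]; exact h.2 a b h1 h2 h3 h4
  rw [subword_window w hm hτ, rightStD, leftStD, stB_window, hs]
  by_cases hd : τ ∈ groupD k
  · rw [if_pos (inv_mem hd), if_pos hd]
    rfl
  · rw [if_neg (fun h' => hd (inv_mem_iff.mp h')), if_neg hd]
    have : (s0B k)⁻¹ = s0B k := inv_eq_of_mul_eq_one_left (s0B_mul_self k)
    change (⟨k, τ⁻¹ * s0B k⟩ : PermB) = ⟨k, (s0B k * τ)⁻¹⟩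
    rw [mul_inv_rev, this]

theorem st_subword_hat {k r : ℕ} (h : k + r = N) :
    st (subword (hat w.window) (k + 1) N)
      = ⟨(st (w⁻¹.window.drop k)).1, (st (w⁻¹.window.drop k)).2⁻¹⟩ := by
  have hσ := sameA_st_drop w⁻¹ (i := k)
  have hl : (st (w⁻¹.window.drop k)).1 = N - k := length_drop_window w⁻¹
  generalize st (w⁻¹.window.drop k) = s at *
  obtain ⟨r', σ⟩ := s
  obtain rfl : r' = N - k := hl
  have h' : k + (N - k) = N := by omega
  have := subword_hat_window w h'.le hσ
  rw [h'] at this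
  rw [this, st_map_oneLine]

end Subwords

/-! ### Subwords of permutations without signs. -/

section TypeA

variable {N : ℕ} (w : Equiv.Perm (Fin N))

theorem hat_oneLine : hat (oneLine w) = oneLine w := by
  have h : ∀ x ∈ oneLine w, 1 ≤ x := fun x hx => by
    rw [oneLine, List.mem_ofFn] at hx
    obtain ⟨i, rfl⟩ := hx
    omega
  rw [hat, List.filter_eq_nil_iff.mpr, List.filter_eq_self.mpr]
  · rfl
  · intro x hx
    have := h x hx
    simp only [decide_eq_true_eq]
    omega
  · intro x hx
    have := h x hx
    simp only [decide_eq_true_eq]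
    omega

theorem subword_oneLine_fst {m : ℕ} (hm : m ≤ N) :
    subword (oneLine w) 1 m = oneLine (cutA.fst m ⟨N, w⁻¹⟩).2⁻¹ := by
  have hl := cutA_fst_deg (i := m) (w := ⟨N, w⁻¹⟩) hm
  have hσ := cutA_fst_app (i := m) (w := ⟨N, w⁻¹⟩) hm
  generalize cutA.fst m ⟨N, w⁻¹⟩ = s at *
  obtain ⟨r, σ⟩ := s
  obtain rfl : r = m := hl
  have := subword_hat_window (ofPerm w) (k := 0) (r := r) (by omega) (σ := σ)
    (hσ.congr_right fun a _ _ => by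
      rw [Nat.cast_zero, zero_add]
      rfl)
  rw [← oneLine_eq, hat_oneLine] at this
  simpa using this

theorem st_subword_oneLine_snd {m : ℕ} (hm : m ≤ N) :
    st (subword (oneLine w) (m + 1) N) = DescentFamily.invt (cutA.snd m ⟨N, w⁻¹⟩) := by
  have := st_subword_hat (ofPerm w) (k := m) (r := N - m) (by omega)
  rw [← oneLine_eq, hat_oneLine, ← ofPerm_inv, ← oneLine_eq] at this
  exact this

end TypeA

/-! ### The parabolic embedding -/

theorem lt_of_lt_succ {f : ℤ → ℤ} {lo hi : ℤ} (h : ∀ a, lo ≤ a → a < hi → f a < f (a + 1))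
    {a b : ℤ} (ha : lo ≤ a) (hab : a < b) (hb : b ≤ hi) : f a < f b := by
  have key : ∀ c, a + 1 ≤ c → c ≤ hi → f a < f c := by
    intro c hc
    induction c, hc using Int.leInduction with
    | base => exact fun h' => h a ha (by omega)
    | succ c hc ih => exact fun h' => (ih (by omega)).trans (h c (by omega) (by omega))
  exact key b hab hb

/-- No descents at `0, …, m - 1` means `-z(2) < z(1) < z(2) < ⋯ < z(m)`. Then the sum of two
different letters of the left part is at least `z(1) + z(2) > 0`, which settles the comparisons
between positions of opposite signs. -/
theorem isMinRep_iff {m n : ℕ} (hm : 2 ≤ m) {z : SignedPerm (m + n)} :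
    IsMinRep m n z ↔ z.desD ⊆ {m} := by
  constructor
  · intro h p hp
    rw [mem_desD] at hp
    rw [Finset.mem_singleton]
    rcases hp with ⟨h1, ⟨rfl, h2⟩ | ⟨h2, h3⟩⟩
    · have := h.left (-2) 1 (by omega) (by omega) (by omega) (by omega) (by omega)
      rw [app_neg] at this
      simp only [id_eq] at this
      omega
    · by_contra hne
      rcases lt_or_gt_of_ne hne with h4 | h4
      · have := h.left (p : ℤ) (p + 1) (by omega) (by omega) (by omega) (by omega) (by omega)
        simp only [id_eq] at this
        omega
      · have := h.right ((p : ℤ) - m) (p - m + 1) (by omega) (by omega) (by omega) (by omega)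
        simp only [id_eq] at this
        rw [show (m : ℤ) + (p - m) = p by ring, show (m : ℤ) + (p - m + 1) = p + 1 by ring] at this
        omega
  · intro h
    have hinj : ∀ a b : ℤ, a.natAbs ≤ m + n → b.natAbs ≤ m + n → z.app a = z.app b → a = b :=
      fun a b ha hb => z.app_injective ha hb
    have h0 : 0 < z.app 1 + z.app 2 := by
      have h1 : ¬ z.app 1 < -z.app 2 := fun h' => by
        have := h (mem_desD.mpr ⟨by omega, Or.inl ⟨rfl, h'⟩⟩)
        rw [Finset.mem_singleton] at this
        omega
      have h2 : z.app 1 ≠ z.app (-2) := fun h' => by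
        have := hinj _ _ (by omega) (by omega) h'
        omega
      rw [app_neg] at h2
      omega
    have hs : ∀ a : ℤ, 1 ≤ a → a < m + n → a ≠ m → z.app a < z.app (a + 1) := by
      intro a h1 h2 h3
      have h4 : ¬ z.app (a + 1) < z.app a := fun h' => by
        have ea : ((a.toNat : ℕ) : ℤ) = a := by omega
        have := h (mem_desD.mpr ⟨by omega, Or.inr ⟨by omega, by rwa [ea]⟩⟩ : a.toNat ∈ z.desD)
        rw [Finset.mem_singleton] at this
        omega
      have h5 : z.app a ≠ z.app (a + 1) := fun h' => by
        have := hinj _ _ (by omega) (by omega) h'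
        omega
      omega
    have hl : ∀ a b : ℤ, 1 ≤ a → a < b → b ≤ m → z.app a < z.app b := fun a b =>
      lt_of_lt_succ fun a h1 h2 => hs a h1 (by omega) (by omega)
    have hr : ∀ a b : ℤ, (m : ℤ) + 1 ≤ a → a < b → b ≤ m + n → z.app a < z.app b := fun a b =>
      lt_of_lt_succ fun a h1 h2 => hs a (by omega) (by omega) (by omega)
    have hpos : ∀ a b : ℤ, 1 ≤ a → a < b → b ≤ m → 0 < z.app a + z.app b := by
      intro a b h1 h2 h3
      have k1 : z.app 1 ≤ z.app a := by
        rcases eq_or_lt_of_le h1 with rfl | h4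
        · exact le_rfl
        · exact (hl 1 a le_rfl h4 (by omega)).le
      have k2 : z.app 2 ≤ z.app b := by
        rcases eq_or_lt_of_le (show 2 ≤ b by omega) with rfl | h4
        · exact le_rfl
        · exact (hl 2 b (by omega) h4 h3).le
      omega
    have hlt : ∀ a b : ℤ, a ≠ 0 → a.natAbs ≤ m → b ≠ 0 → b.natAbs ≤ m → a.natAbs ≠ b.natAbs →
        a < b → z.app a < z.app b := by
      intro a b h1 h2 h3 h4 h5 h6
      have ea := z.app_neg a
      have eb := z.app_neg b
      rcases lt_or_gt_of_ne h1 with h7 | h7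
      · rcases lt_or_gt_of_ne h3 with h8 | h8
        · have := hl (-b) (-a) (by omega) (by omega) (by omega)
          omega
        · rcases lt_or_gt_of_ne h5 with h9 | h9
          · have := hpos (-a) b (by omega) (by omega) (by omega)
            omega
          · have := hpos b (-a) (by omega) (by omega) (by omega)
            omega
      · exact hl a b (by omega) h6 (by omega)
    refine ⟨fun a b h1 h2 h3 h4 h5 => ⟨fun h6 => ?_, hlt a b h1 h2 h3 h4 h5⟩,
      fun a b h1 h2 h3 h4 => ⟨fun h6 => ?_, fun h6 => ?_⟩⟩
    · simp only [id_eq]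
      by_contra h7
      have := hlt b a h3 h4 h1 h2 h5.symm (by omega)
      omega
    · simp only [id_eq] at h6 ⊢
      by_contra h7
      rcases eq_or_lt_of_le (not_lt.mp h7) with rfl | h8
      · omega
      · have := hr (m + b) (m + a) (by omega) (by omega) (by omega)
        omega
    · exact hr (m + a) (m + b) (by omega) (by simp only [id_eq] at h6; omega) (by omega)

theorem parabolic_left {m n : ℕ} (hm : 2 ≤ m) {u : SignedPerm m} (hu : u ∈ groupD m)
    (v : Equiv.Perm (Fin n)) {w : SignedPerm (m + n)} (hw : w ∈ groupD (m + n)) :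
    (leftStD (w.window.take m) = ⟨m, u⟩ ∧ st (w.window.drop m) = ⟨n, v⟩) ↔
      ∃ z ∈ groupD (m + n), z.desD ⊆ {m} ∧ w = z * times u v := by
  rw [leftStD_take_eq_iff w (by omega) (by omega) hu, st_drop_eq_iff]
  constructor
  · rintro ⟨h1, h2⟩
    exact ⟨w * (times u v)⁻¹, mul_mem hw (inv_mem (times_mem_groupD hu v)),
      (isMinRep_iff hm).mp (isMinRep_mul_times h1 h2), by rw [inv_mul_cancel_right]⟩
  · rintro ⟨z, _, hz, rfl⟩
    exact ((isMinRep_iff hm).mpr hz).mul_times u v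

/-- Cutting the values of `w` is cutting the positions of `w⁻¹`, and `(z (u⁻¹ × v⁻¹))⁻¹ = (u × v)
z⁻¹`. So `parabolic_left` applies to the inverse. -/
theorem parabolic_right {m n : ℕ} (hm : 2 ≤ m) {u : SignedPerm m} (hu : u ∈ groupD m)
    (v : Equiv.Perm (Fin n)) {w : SignedPerm (m + n)} (hw : w ∈ groupD (m + n)) :
    (rightStD (subword w.window 1 m) = ⟨m, u⟩ ∧
        st (subword (hat w.window) (m + 1) (m + n)) = ⟨n, v⟩) ↔
      ∃ z ∈ groupD (m + n), z.desD ⊆ {m} ∧ w = times u v * z⁻¹ := by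
  have h1 : rightStD (subword w.window 1 m) = ⟨m, u⟩ ↔
      leftStD (w⁻¹.window.take m) = ⟨m, u⁻¹⟩ := by
    rw [rightStD_subword_window w (Nat.le_add_right m n), PermB.inv_eq_iff]
    rfl
  have h2 : st (subword (hat w.window) (m + 1) (m + n)) = ⟨n, v⟩ ↔
      st (w⁻¹.window.drop m) = ⟨n, v⁻¹⟩ := by
    rw [st_subword_hat w rfl]
    constructor
    · intro h
      have := congrArg (DescentFamily.invt (X := PermA)) h
      rwa [← isCut_cutA.invt_invt (st (w⁻¹.window.drop m))]
    · intro h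
      rw [h, inv_inv]
  rw [h1, h2, parabolic_left hm (inv_mem hu) v⁻¹ (inv_mem hw)]
  refine exists_congr fun z => and_congr_right fun _ => and_congr_right fun _ => ?_
  rw [← times_inv, inv_eq_iff_eq_inv, mul_inv_rev, inv_inv]

end

open scoped TensorProduct
noncomputable section

attribute [local instance 2000] TensorProduct.instModule

open SignedPerm DescentFamily

/-! ### The operations in terms of cuts -/

theorem sum_perm_eq {M : Type} [AddCommMonoid M] (n : ℕ) (p : Equiv.Perm (Fin n) → Prop)
    (q : PermA → Prop) {_ : DecidablePred p} {_ : DecidablePred q} (f : PermA → M)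
    (h : ∀ w, p w ↔ q ⟨n, w⟩) :
    ∑ w : Equiv.Perm (Fin n) with p w, f ⟨n, w⟩
      = ∑ w ∈ (finite_deg (X := PermA) n).toFinset with q w, f w := by
  refine Finset.sum_bij (fun w _ => ⟨n, w⟩) (fun w hw => ?_) (fun w _ w' _ h => ?_)
    (fun w hw => ?_) (fun w _ => rfl)
  · rw [Finset.mem_filter] at hw ⊢
    exact ⟨(Set.Finite.mem_toFinset _).mpr rfl, (h w).mp hw.2⟩
  · exact eq_of_heq (Sigma.mk.inj h).2
  · rw [Finset.mem_filter, Set.Finite.mem_toFinset] at hw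
    obtain ⟨k, w⟩ := w
    obtain rfl : k = n := hw.1
    exact ⟨w, Finset.mem_filter.mpr ⟨Finset.mem_univ w, (h w).mpr hw.2⟩, rfl⟩

theorem basisD_eq (w : PermD) : basisD w.1 = Finsupp.single w 1 := dif_pos w.2

theorem sum_signedPerm_eq (n : ℕ) (hn : 2 ≤ n) (p : SignedPerm n → Prop)
    (q : PermD → Prop) {_ : DecidablePred p} {_ : DecidablePred q} (f : PermD → ZD)
    (g : PermB → ZD) (hp : ∀ w, p w → w ∈ groupD n) (hfg : ∀ w : PermD, g w.1 = f w)
    (h : ∀ w hw, p w ↔ q ⟨⟨n, w⟩, hn, hw⟩) :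
    ∑ w : SignedPerm n with p w, g ⟨n, w⟩
      = ∑ w ∈ (finite_deg (X := PermD) n).toFinset with q w, f w := by
  refine Finset.sum_bij (fun w hw => ⟨⟨n, w⟩, hn, hp w (Finset.mem_filter.mp hw).2⟩)
    (fun w hw => ?_) (fun w _ w' _ h => ?_) (fun w hw => ?_) (fun w hw => hfg ⟨⟨n, w⟩, _⟩)
  · rw [Finset.mem_filter] at hw ⊢
    exact ⟨(Set.Finite.mem_toFinset _).mpr rfl, (h w (hp w hw.2)).mp hw.2⟩
  · exact eq_of_heq (Sigma.mk.inj (Subtype.ext_iff.mp h)).2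
  · rw [Finset.mem_filter, Set.Finite.mem_toFinset] at hw
    obtain ⟨⟨k, w⟩, hk, hw'⟩ := w
    obtain rfl : k = n := hw.1
    exact ⟨w, Finset.mem_filter.mpr ⟨Finset.mem_univ w, (h w hw').mpr hw.2⟩, rfl⟩

section Invt

variable {P X : Type} [DescentFamily P] [DescentFamily X] {B : Cut P P} {C : Cut P X}

theorem IsCut.invt_eq_iff (h : IsCut B C) {x y : X} : invt x = y ↔ x = invt y :=
  ⟨fun e => by rw [← e, h.invt_invt], fun e => by rw [e, h.invt_invt]⟩

theorem Cut.shuffle_act_single (hB : IsCut B B) (h : IsCut B C) (u : X) (v : P) :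
    C.shuffle.act (Finsupp.single u 1) (Finsupp.single v 1) = open Classical in
      ∑ w ∈ (finite_deg (X := X) (deg u + deg v)).toFinset with
        invt (C.fst (deg u) (invt w)) = u ∧ invt (C.snd (deg u) (invt w)) = v,
        Finsupp.single w 1 := by
  classical
  change invLin X (C.glue (invLin X (Finsupp.single u 1)) (invLin P (Finsupp.single v 1))) = _
  rw [IsCut.invLin_single, IsCut.invLin_single, Cut.glue, bilin_single, one_mul, one_smul, map_sum]
  refine Finset.sum_bij' (fun w _ => invt w) (fun w _ => invt w) (fun w hw => ?_) (fun w hw => ?_)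
    (fun w _ => h.invt_invt w) (fun w _ => h.invt_invt w)
    (fun w _ => IsCut.invLin_single w 1)
  · rw [Finset.mem_filter, Set.Finite.mem_toFinset, Set.mem_ofPred_eq] at hw ⊢
    rw [h.deg_invt, hB.deg_invt] at hw
    rw [h.deg_invt, h.invt_invt, h.invt_eq_iff, hB.invt_eq_iff]
    exact hw
  · rw [Finset.mem_filter, Set.Finite.mem_toFinset, Set.mem_ofPred_eq] at hw ⊢
    rw [h.deg_invt, h.deg_invt, hB.deg_invt, ← h.invt_eq_iff, ← hB.invt_eq_iff]
    exact hw

theorem Cut.cup_coact_single (h : IsCut B C) (w : X) :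
    C.cup.coact (Finsupp.single w 1) = ∑ i ∈ Finset.Icc C.lo (deg w),
      Finsupp.single (invt (C.fst i (invt w))) 1 ⊗ₜ[ℤ]
        Finsupp.single (invt (C.snd i (invt w))) 1 := by
  change TensorProduct.map _ _ (C.split (invLin X (Finsupp.single w 1))) = _
  rw [IsCut.invLin_single, C.split_single, one_smul, map_sum, h.deg_invt]
  refine Finset.sum_congr rfl fun i _ => ?_
  rw [TensorProduct.map_tmul, IsCut.invLin_single, IsCut.invLin_single]

end Invt

theorem bilin_unique {α β M : Type} [AddCommGroup M] [inst : Module ℤ M] {f : α → β → M}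
    {φ : (α →₀ ℤ) →ₗ[ℤ] (β →₀ ℤ) →ₗ[ℤ] M}
    (h : ∀ a b, f a b = φ (Finsupp.single a 1) (Finsupp.single b 1)) : bilin f = φ := by
  refine Finsupp.lhom_ext' fun a => LinearMap.ext_ring (Finsupp.lhom_ext' fun b =>
    LinearMap.ext_ring ?_)
  simp only [LinearMap.comp_apply, Finsupp.lsingle_apply]
  rw [bilin, Finsupp.linearCombination_single, one_smul, Finsupp.linearCombination_single]
  exact (inst.toMulAction.one_smul _).trans (h a b)

theorem linearCombination_unique {α M : Type} [AddCommGroup M] [inst : Module ℤ M] {f : α → M}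
    {φ : (α →₀ ℤ) →ₗ[ℤ] M} (h : ∀ a, f a = φ (Finsupp.single a 1)) :
    Finsupp.linearCombination ℤ f = φ := by
  refine Finsupp.lhom_ext' fun a => LinearMap.ext_ring ?_
  simp only [LinearMap.comp_apply, Finsupp.lsingle_apply]
  rw [Finsupp.linearCombination_single]
  exact (inst.toMulAction.one_smul _).trans (h a)

theorem oneLine_eq_iff {n : ℕ} {s : PermA} {u : Equiv.Perm (Fin n)} :
    oneLine s.2 = oneLine u ↔ s = ⟨n, u⟩ := by
  constructor
  · intro h
    rw [← st_oneLine u, ← h, st_oneLine]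
  · rintro rfl
    rfl

/-- The product is gluing by definition. For the coproduct, the standardized subwords of `u` are the
inverses of the parts of `u⁻¹`. -/
theorem hopfCup_eq : hopfCup = cutA.cupHopf ⟨0, 1⟩ := by
  classical
  have h1 : bilin cupA = cutA.cup.act := bilin_unique fun u v => by
    change _ = cutA.glue _ _
    rw [Cut.glue, bilin_single, one_mul, one_smul]
    exact sum_perm_eq _ _ _ basisA fun w => Iff.rfl
  have h2 : Finsupp.linearCombination ℤ capA = cutA.cup.coact := linearCombination_unique fun u => by
    rw [Cut.cup_coact_single isCut_cutA]
    change ∑ i ∈ _, _ = _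
    rw [Nat.range_succ_eq_Icc_zero]
    refine Finset.sum_congr rfl fun i hi => ?_
    have hi' : i ≤ u.1 := (Finset.mem_Icc.mp hi).2
    rw [subword_oneLine_fst u.2 hi', st_oneLine, st_subword_oneLine_snd u.2 hi']
    rfl
  change HopfOps.mk _ _ _ _ = HopfOps.mk _ _ _ _
  rw [h1, h2]
  rfl

theorem hopfShuffle_eq : hopfShuffle = cutA.shuffleHopf ⟨0, 1⟩ := by
  classical
  have h1 : bilin shuffleA = cutA.shuffle.act := bilin_unique fun u v => by
    rw [Cut.shuffle_act_single isCut_cutA isCut_cutA]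
    refine sum_perm_eq _ _ _ basisA fun w => ?_
    rw [subword_oneLine_fst w (Nat.le_add_right _ _), oneLine_eq_iff (s := ⟨_, _⟩),
      st_subword_oneLine_snd w (Nat.le_add_right _ _)]
    rfl
  have h2 : Finsupp.linearCombination ℤ unshuffleA = cutA.shuffle.coact :=
    linearCombination_unique fun u => by
      change _ = cutA.split _
      rw [Cut.split_single, one_smul]
      change ∑ i ∈ _, _ = _
      rw [Nat.range_succ_eq_Icc_zero]
      rfl
  change HopfOps.mk _ _ _ _ = HopfOps.mk _ _ _ _
  rw [h1, h2]
  rfl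

theorem cutD_fst_inv (w : PermD) {i : ℕ} (h2 : 2 ≤ i) (h : i ≤ w.1.1) :
    rightStD (subword w.1.2.window 1 i) = (invt (cutD.fst i (invt w))).1 := by
  rw [rightStD_subword_window w.1.2 h]
  have := cutD_fst (w := invt w) h2 h
  exact (congrArg PermB.inv this).symm

theorem cutD_snd_inv (w : PermD) {i : ℕ} (h : i ≤ w.1.1) :
    st (subword (hat w.1.2.window) (i + 1) w.1.1) = invt (cutD.snd i (invt w)) :=
  st_subword_hat w.1.2 (r := w.1.1 - i) (by omega)

theorem modCup_eq : modCup = cutD.cup := by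
  classical
  have h1 : bilin cupD = cutD.cup.act := bilin_unique fun u v => by
    change _ = cutD.glue _ _
    rw [Cut.glue, bilin_single, one_mul, one_smul]
    refine sum_signedPerm_eq _ (u.2.1.trans (Nat.le_add_right _ _)) _ _ _ basisD
      (fun w hw => hw.1) basisD_eq fun w hw => ?_
    rw [Subtype.ext_iff]
    change _ ↔ (cutD.fst u.1.1 ⟨⟨_, w⟩, _⟩).1 = _ ∧ _
    rw [cutD_fst u.2.1 (Nat.le_add_right _ _)]
    exact and_iff_right hw
  have h2 : Finsupp.linearCombination ℤ capD = cutD.cup.coact := linearCombination_unique fun u => by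
    rw [Cut.cup_coact_single isCut_cutD]
    refine Finset.sum_congr rfl fun i hi => ?_
    obtain ⟨hi2, hi⟩ := Finset.mem_Icc.mp hi
    rw [cutD_fst_inv u hi2 hi, cutD_snd_inv u hi, basisD_eq]
    rfl
  change ModComodOps.mk _ _ = ModComodOps.mk cutD.cup.act cutD.cup.coact
  rw [h1, h2]

theorem modShuffle_eq : modShuffle = cutD.shuffle := by
  classical
  have h1 : bilin shuffleD = cutD.shuffle.act := bilin_unique fun u v => by
    rw [Cut.shuffle_act_single isCut_cutA isCut_cutD]
    refine sum_signedPerm_eq _ (u.2.1.trans (Nat.le_add_right _ _)) _ _ _ basisD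
      (fun w hw => hw.1) basisD_eq fun w hw => ?_
    rw [Subtype.ext_iff]
    have e1 := cutD_fst_inv ⟨⟨_, w⟩, u.2.1.trans (Nat.le_add_right _ _), hw⟩ (i := u.1.1) u.2.1
      (Nat.le_add_right _ _)
    have e2 := cutD_snd_inv ⟨⟨_, w⟩, u.2.1.trans (Nat.le_add_right _ _), hw⟩ (i := u.1.1)
      (Nat.le_add_right _ _)
    simp only at e1 e2
    rw [e1, e2]
    exact and_iff_right hw
  have h2 : Finsupp.linearCombination ℤ unshuffleD = cutD.shuffle.coact :=
    linearCombination_unique fun u => by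
      change _ = cutD.split _
      rw [Cut.split_single, one_smul]
      refine Finset.sum_congr rfl fun i hi => ?_
      obtain ⟨hi2, hi⟩ := Finset.mem_Icc.mp hi
      rw [← cutD_fst hi2 hi, basisD_eq]
      rfl
  change ModComodOps.mk _ _ = ModComodOps.mk cutD.shuffle.act cutD.shuffle.coact
  rw [h1, h2]

end

open scoped TensorProduct
noncomputable section

attribute [local instance 2000] TensorProduct.instModule

open SignedPerm DescentFamily

/-! ### Shuffles of words -/

/-- The list of all shuffles of two words. -/
def shuffles : List ℤ → List ℤ → List (List ℤ)
  | [], b => [b]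
  | x :: a, [] => [x :: a]
  | x :: a, y :: b =>
    (shuffles a (y :: b)).map (fun c => x :: c) ++ (shuffles (x :: a) b).map (fun c => y :: c)
  termination_by a b => a.length + b.length

theorem shuffles_nil_left (b : List ℤ) : shuffles [] b = [b] := by rw [shuffles]

theorem shuffles_nil_right (a : List ℤ) : shuffles a [] = [a] := by
  cases a <;> rw [shuffles]

theorem shuffles_cons_cons (x y : ℤ) (a b : List ℤ) : shuffles (x :: a) (y :: b) =
    (shuffles a (y :: b)).map (fun c => x :: c) ++ (shuffles (x :: a) b).map (fun c => y :: c) := by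
  rw [shuffles]

theorem cons_mem_shuffles_left {z : ℤ} {a b c : List ℤ} (h : c ∈ shuffles a b) :
    z :: c ∈ shuffles (z :: a) b := by
  cases b with
  | nil =>
    rw [shuffles_nil_right, List.mem_singleton] at *
    rw [h]
  | cons y b =>
    rw [shuffles_cons_cons, List.mem_append]
    exact Or.inl (List.mem_map_of_mem h)

theorem cons_mem_shuffles_right {z : ℤ} {a b c : List ℤ} (h : c ∈ shuffles a b) :
    z :: c ∈ shuffles a (z :: b) := by
  cases a with
  | nil =>
    rw [shuffles_nil_left, List.mem_singleton] at *
    rw [h]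
  | cons y a =>
    rw [shuffles_cons_cons, List.mem_append]
    exact Or.inr (List.mem_map_of_mem h)

section Separated

variable {p : ℤ → Bool}

theorem mem_shuffles_filter (c : List ℤ) :
    c ∈ shuffles (c.filter p) (c.filter fun x => !p x) := by
  induction c with
  | nil => simp [shuffles_nil_left]
  | cons z c ih =>
    by_cases hz : p z
    · rw [List.filter_cons_of_pos hz, List.filter_cons_of_neg (by simp [hz])]
      exact cons_mem_shuffles_left ih
    · rw [List.filter_cons_of_neg hz, List.filter_cons_of_pos (by simp [hz])]
      exact cons_mem_shuffles_right ih

theorem filter_of_mem_shuffles {a b : List ℤ} (ha : ∀ x ∈ a, p x = true)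
    (hb : ∀ y ∈ b, p y = false) {c : List ℤ} (hc : c ∈ shuffles a b) :
    c.filter p = a ∧ (c.filter fun x => !p x) = b := by
  induction a, b using shuffles.induct generalizing c with
  | case1 b =>
    rw [shuffles_nil_left, List.mem_singleton] at hc
    subst hc
    exact ⟨List.filter_eq_nil_iff.mpr fun x hx => by simp [hb x hx],
      List.filter_eq_self.mpr fun x hx => by simp [hb x hx]⟩
  | case2 x a =>
    rw [shuffles_nil_right, List.mem_singleton] at hc
    subst hc
    exact ⟨List.filter_eq_self.mpr ha, List.filter_eq_nil_iff.mpr fun x hx => by simp [ha x hx]⟩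
  | case3 x a y b ih1 ih2 =>
    have hx : p x = true := ha x List.mem_cons_self
    have hy : p y = false := hb y List.mem_cons_self
    rw [shuffles_cons_cons, List.mem_append, List.mem_map, List.mem_map] at hc
    rcases hc with ⟨c, hc, rfl⟩ | ⟨c, hc, rfl⟩
    · obtain ⟨h1, h2⟩ := ih1 (fun z hz => ha z (List.mem_cons_of_mem _ hz)) hb hc
      rw [List.filter_cons_of_pos hx, List.filter_cons_of_neg (by simp [hx]), h1, h2]
      exact ⟨rfl, rfl⟩
    · obtain ⟨h1, h2⟩ := ih2 ha (fun z hz => hb z (List.mem_cons_of_mem _ hz)) hc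
      rw [List.filter_cons_of_neg (by simp [hy]), List.filter_cons_of_pos (by simp [hy]), h1, h2]
      exact ⟨rfl, rfl⟩

/-- When `p` tells the letters of the two words apart, filtering undoes a shuffle. This links the
recursive list to the description of products by subwords. -/
theorem mem_shuffles_iff {a b : List ℤ} (ha : ∀ x ∈ a, p x = true)
    (hb : ∀ y ∈ b, p y = false) {c : List ℤ} :
    c ∈ shuffles a b ↔ c.filter p = a ∧ (c.filter fun x => !p x) = b :=
  ⟨filter_of_mem_shuffles ha hb, fun ⟨h1, h2⟩ => by
    have := mem_shuffles_filter (p := p) c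
    rwa [h1, h2] at this⟩

theorem shuffles_nodup {a b : List ℤ} (ha : ∀ x ∈ a, p x = true) (hb : ∀ y ∈ b, p y = false) :
    (shuffles a b).Nodup := by
  induction a, b using shuffles.induct with
  | case1 b => rw [shuffles_nil_left]; exact List.nodup_singleton _
  | case2 x a => rw [shuffles_nil_right]; exact List.nodup_singleton _
  | case3 x a y b ih1 ih2 =>
    rw [shuffles_cons_cons, List.nodup_append]
    refine ⟨(ih1 (fun z hz => ha z (List.mem_cons_of_mem _ hz)) hb).map
      fun _ _ h => (List.cons.inj h).2, (ih2 ha fun z hz => hb z (List.mem_cons_of_mem _ hz)).map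
      fun _ _ h => (List.cons.inj h).2, ?_⟩
    intro c hc d hd hcd
    rw [List.mem_map] at hc hd
    obtain ⟨c, -, rfl⟩ := hc
    obtain ⟨d, -, rfl⟩ := hd
    have h1 := ha x List.mem_cons_self
    rw [(List.cons.inj hcd).1, hb y List.mem_cons_self] at h1
    exact Bool.false_ne_true h1

end Separated

theorem shuffles_perm {a b c : List ℤ} (hc : c ∈ shuffles a b) : c.Perm (a ++ b) := by
  induction a, b using shuffles.induct generalizing c with
  | case1 b =>
    rw [shuffles_nil_left, List.mem_singleton] at hc
    rw [hc]
    exact List.Perm.refl _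
  | case2 x a =>
    rw [shuffles_nil_right, List.mem_singleton] at hc
    rw [hc, List.append_nil]
  | case3 x a y b ih1 ih2 =>
    rw [shuffles_cons_cons, List.mem_append, List.mem_map, List.mem_map] at hc
    rcases hc with ⟨c, hc, rfl⟩ | ⟨c, hc, rfl⟩
    · exact (ih1 hc).cons x
    · exact ((ih2 hc).cons y).trans List.perm_middle.symm

theorem shuffles_map (f : ℤ → ℤ) (a b : List ℤ) :
    shuffles (a.map f) (b.map f) = (shuffles a b).map (List.map f) := by
  induction a, b using shuffles.induct with
  | case1 b => simp [shuffles_nil_left]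
  | case2 x a => simp [shuffles_nil_right]
  | case3 x a y b ih1 ih2 =>
    rw [List.map_cons] at ih1 ih2
    rw [List.map_cons, List.map_cons, shuffles_cons_cons, shuffles_cons_cons, ih1, ih2]
    simp [Function.comp_def]

section Sums

variable {M : Type} [AddCommMonoid M]

/-- The sum over all shuffles of two words. -/
def shuffleSum (a b : List ℤ) (F : List ℤ → M) : M := ((shuffles a b).map F).sum

/-- The sum over all ways to cut a word in two. -/
def cutSum (c : List ℤ) (G : List ℤ → List ℤ → M) : M :=
  ∑ i ∈ Finset.range (c.length + 1), G (c.take i) (c.drop i)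

theorem shuffleSum_nil_left (b : List ℤ) (F : List ℤ → M) : shuffleSum [] b F = F b := by
  simp [shuffleSum, shuffles_nil_left]

theorem shuffleSum_nil_right (a : List ℤ) (F : List ℤ → M) : shuffleSum a [] F = F a := by
  simp [shuffleSum, shuffles_nil_right]

theorem shuffleSum_cons_cons (x y : ℤ) (a b : List ℤ) (F : List ℤ → M) :
    shuffleSum (x :: a) (y :: b) F =
      shuffleSum a (y :: b) (fun c => F (x :: c)) + shuffleSum (x :: a) b fun c => F (y :: c) := by
  simp [shuffleSum, shuffles_cons_cons, Function.comp_def]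

theorem shuffleSum_add (a b : List ℤ) (F F' : List ℤ → M) :
    (shuffleSum a b fun c => F c + F' c) = shuffleSum a b F + shuffleSum a b F' :=
  List.sum_map_add

theorem shuffleSum_congr {a b : List ℤ} {F F' : List ℤ → M}
    (h : ∀ c ∈ shuffles a b, F c = F' c) : shuffleSum a b F = shuffleSum a b F' :=
  congrArg List.sum (List.map_congr_left h)

theorem map_shuffleSum {M' Φ : Type} [AddCommMonoid M'] [FunLike Φ M M'] [AddMonoidHomClass Φ M M']
    (φ : Φ) (a b : List ℤ) (F : List ℤ → M) :
    φ (shuffleSum a b F) = shuffleSum a b fun c => φ (F c) := by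
  rw [shuffleSum, map_list_sum, List.map_map]
  rfl

theorem cutSum_nil (G : List ℤ → List ℤ → M) : cutSum [] G = G [] [] := by
  simp [cutSum]

theorem cutSum_cons (z : ℤ) (c : List ℤ) (G : List ℤ → List ℤ → M) :
    cutSum (z :: c) G = (cutSum c fun c1 c2 => G (z :: c1) c2) + G [] (z :: c) := by
  rw [cutSum, List.length_cons, Finset.sum_range_succ']
  rfl

theorem cutSum_add (c : List ℤ) (G G' : List ℤ → List ℤ → M) :
    (cutSum c fun c1 c2 => G c1 c2 + G' c1 c2) = cutSum c G + cutSum c G' :=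
  Finset.sum_add_distrib

/-- Cutting shuffles is the same as shuffling cuts. -/
theorem shuffleSum_cutSum (a b : List ℤ) (G : List ℤ → List ℤ → M) :
    (shuffleSum a b fun c => cutSum c G) = cutSum a fun a1 a2 => cutSum b fun b1 b2 =>
      shuffleSum a1 b1 fun c1 => shuffleSum a2 b2 fun c2 => G c1 c2 := by
  induction a, b using shuffles.induct generalizing G with
  | case1 b => simp only [shuffleSum_nil_left, cutSum_nil]
  | case2 x a => simp only [shuffleSum_nil_right, cutSum_nil]
  | case3 x a y b ih1 ih2 =>
    rw [shuffleSum_cons_cons]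
    -- A cut either lies in front of the first letter or keeps it in the left part. The induction
    -- hypotheses handle the second case; the cuts in front contribute the sum over uncut shuffles.
    simp only [cutSum_cons x, cutSum_cons y _ G, shuffleSum_add] at ih1 ih2 ⊢
    simp only [ih1, ih2]
    simp only [cutSum_cons, cutSum_add, shuffleSum_cons_cons, shuffleSum_nil_left,
      shuffleSum_nil_right]
    abel

end Sums

/-! ### The product of permutations as a sum over shuffles -/

theorem exists_oneLine_eq {l : List ℤ} (hl : l.Nodup) (h : ∀ x ∈ l, 1 ≤ x ∧ x ≤ l.length) :
    ∃ σ : Equiv.Perm (Fin l.length), oneLine σ = l := by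
  have h' : ∀ i : Fin l.length, 1 ≤ l.get i ∧ l.get i ≤ l.length := fun i => h _ (l.get_mem i)
  let f : Fin l.length → Fin l.length := fun i => ⟨(l.get i - 1).toNat, by have := h' i; omega⟩
  have hf : Function.Injective f := fun i j hij => by
    have h1 := h' i
    have h2 := h' j
    have h3 := congrArg Fin.val hij
    refine List.nodup_iff_injective_get.mp hl ?_
    simp only [f] at h3
    omega
  refine ⟨Equiv.ofBijective f (Finite.injective_iff_bijective.mp hf), ?_⟩
  refine (List.ofFn_congr rfl _).trans ((congrArg List.ofFn (funext fun i => ?_)).trans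
    (List.ofFn_get l))
  have := h' i
  change (((l.get i - 1).toNat : ℕ) : ℤ) + 1 = l.get i
  omega

theorem length_oneLine {n : ℕ} (v : Equiv.Perm (Fin n)) : (oneLine v).length = n :=
  List.length_ofFn

theorem oneLine_nodup {n : ℕ} (v : Equiv.Perm (Fin n)) : (oneLine v).Nodup := by
  rw [oneLine_eq]
  exact window_nodup _

theorem mem_oneLine {n : ℕ} {v : Equiv.Perm (Fin n)} {x : ℤ} (hx : x ∈ oneLine v) :
    1 ≤ x ∧ x ≤ n := by
  rw [oneLine, List.mem_ofFn] at hx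
  obtain ⟨i, rfl⟩ := hx
  have := (v i).2
  omega

theorem st_map {f : ℤ → ℤ} {c : List ℤ} (hc : c.Nodup)
    (hf : ∀ x ∈ c, ∀ y ∈ c, x < y → f x < f y) : st (c.map f) = st c := by
  have hf' : ∀ x ∈ c, ∀ y ∈ c, f x < f y ↔ x < y := fun x hx y hy =>
    ⟨fun h => by
      by_contra hn
      rcases eq_or_lt_of_le (not_lt.mp hn) with rfl | h'
      · exact lt_irrefl _ h
      · exact lt_asymm h (hf y hy x hx h'), hf x hx y hy⟩
  have hn : (c.map f).Nodup := List.Nodup.map_on (fun x hx y hy h => by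
    rcases lt_trichotomy x y with h' | h' | h'
    · exact absurd (hf x hx y hy h') (by rw [h]; exact lt_irrefl _)
    · exact h'
    · exact absurd (hf y hy x hx h') (by rw [h]; exact lt_irrefl _)) hc
  refine (st_eq_iff hn (st c).2).mpr ⟨List.length_map _, fun a b h1 h2 h3 h4 => ?_⟩
  refine Iff.trans ?_ (sameA_st hc a b h1 h2 h3 h4).symm
  obtain ⟨i, rfl⟩ := exists_fin h1 h2
  obtain ⟨j, rfl⟩ := exists_fin h3 h4
  have e : ∀ i : Fin c.length, wordApp (c.map f) ((i : ℕ) + 1) = f (c.get i) ∧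
      wordApp c ((i : ℕ) + 1) = c.get i := fun i => by
    rw [wordApp_succ, wordApp_succ, List.getD_eq_getElem _ _ (by rw [List.length_map]; exact i.2),
      List.getD_eq_getElem _ _ i.2, List.getElem_map]
    exact ⟨rfl, rfl⟩
  rw [(e i).1, (e j).1, (e i).2, (e j).2]
  exact hf' _ (c.get_mem i) _ (c.get_mem j)

theorem subword_oneLine_snd_eq_iff {m n : ℕ} {w : Equiv.Perm (Fin (m + n))}
    {v : Equiv.Perm (Fin n)} : st (subword (oneLine w) (m + 1) (m + n)) = ⟨n, v⟩ ↔
      subword (oneLine w) (m + 1) (m + n) = (oneLine v).map fun a => (m : ℤ) + a := by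
  have hσ := cutA_snd_app m ⟨m + n, w⁻¹⟩
  have hl := cutA_snd_deg (i := m) (w := ⟨m + n, w⁻¹⟩)
  generalize cutA.snd m ⟨m + n, w⁻¹⟩ = s at *
  obtain ⟨r, σ⟩ := s
  simp only [Nat.add_sub_cancel_left] at hl hσ
  subst hl
  have := subword_hat_window (ofPerm w) le_rfl (σ := σ) hσ
  rw [← oneLine_eq, hat_oneLine] at this
  rw [this]
  constructor
  · intro h
    rw [st_map_oneLine] at h
    obtain rfl : σ⁻¹ = v := eq_of_heq (Sigma.mk.inj h).2
    rfl
  · intro h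
    rw [h, st_map_oneLine]

/-- The letters of `u` and the shifted letters of `v` are separated by `m`, so the permutations in
the product are the shuffles of the two words. These are already standard. -/
theorem shuffleA_eq {m n : ℕ} (u : Equiv.Perm (Fin m)) (v : Equiv.Perm (Fin n)) :
    shuffleA ⟨m, u⟩ ⟨n, v⟩ = shuffleSum (oneLine u) ((oneLine v).map fun a => (m : ℤ) + a)
      fun c => basisA (st c) := by
  classical
  have ha : ∀ x ∈ oneLine u, decide (x ≤ (m : ℤ)) = true := fun x hx =>
    decide_eq_true (mem_oneLine hx).2
  have hb : ∀ x ∈ (oneLine v).map fun a => (m : ℤ) + a, decide (x ≤ (m : ℤ)) = false := by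
    intro x hx
    rw [List.mem_map] at hx
    obtain ⟨y, hy, rfl⟩ := hx
    have := mem_oneLine hy
    exact decide_eq_false (by omega)
  have hmem : ∀ w : Equiv.Perm (Fin (m + n)),
      (subword (oneLine w) 1 m = oneLine u ∧ st (subword (oneLine w) (m + 1) (m + n)) = ⟨n, v⟩) ↔
      oneLine w ∈ shuffles (oneLine u) ((oneLine v).map fun a => (m : ℤ) + a) := by
    intro w
    rw [subword_oneLine_snd_eq_iff, mem_shuffles_iff ha hb]
    have e1 : subword (oneLine w) 1 m = (oneLine w).filter fun x => decide (x ≤ (m : ℤ)) :=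
      List.filter_congr fun x hx => by
        have := mem_oneLine hx
        exact decide_eq_decide.mpr (by omega)
    have e2 : subword (oneLine w) (m + 1) (m + n)
        = (oneLine w).filter fun x => !decide (x ≤ (m : ℤ)) :=
      List.filter_congr fun x hx => by
        have := mem_oneLine hx
        rw [← decide_not]
        exact decide_eq_decide.mpr (by omega)
    rw [e1, e2]
  rw [shuffleSum, ← List.sum_toFinset _ (shuffles_nodup ha hb)]
  refine Finset.sum_bij (fun w _ => oneLine w) (fun w hw => ?_) (fun w _ w' _ h => ?_)
    (fun c hc => ?_) (fun w _ => by rw [st_oneLine])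
  · rw [Finset.mem_filter] at hw
    rw [List.mem_toFinset]
    exact (hmem w).mp hw.2
  · have := oneLine_eq_iff (s := ⟨m + n, w⟩).mp h
    exact eq_of_heq (Sigma.mk.inj this).2
  · rw [List.mem_toFinset] at hc
    have hp := shuffles_perm hc
    have hl : c.length = m + n := by
      rw [hp.length_eq, List.length_append, List.length_map, length_oneLine, length_oneLine]
    have hn : c.Nodup := by
      rw [hp.nodup_iff, List.nodup_append]
      refine ⟨oneLine_nodup u, (oneLine_nodup v).map fun _ _ h => by simpa using h, ?_⟩
      intro x hx y hy hxy
      have h1 := ha x hx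
      rw [hxy, hb y hy] at h1
      exact Bool.false_ne_true h1
    have hr : ∀ x ∈ c, 1 ≤ x ∧ x ≤ c.length := by
      intro x hx
      rw [hp.mem_iff, List.mem_append, List.mem_map] at hx
      rcases hx with hx | ⟨y, hy, rfl⟩
      · have := mem_oneLine hx
        omega
      · have := mem_oneLine hy
        omega
    obtain ⟨σ, hσ⟩ := exists_oneLine_eq hn hr
    generalize c.length = k at *
    subst hl
    exact ⟨σ, Finset.mem_filter.mpr ⟨Finset.mem_univ σ, (hmem σ).mpr (by rwa [hσ])⟩, hσ⟩

theorem oneLine_st_of_mem_shuffles {m n : ℕ} {u : Equiv.Perm (Fin m)} {v : Equiv.Perm (Fin n)}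
    {c : List ℤ} (hc : c ∈ shuffles (oneLine u) ((oneLine v).map fun a => (m : ℤ) + a)) :
    oneLine (st c).2 = c := by
  have hp := shuffles_perm hc
  have hl : c.length = m + n := by
    rw [hp.length_eq, List.length_append, List.length_map, length_oneLine, length_oneLine]
  have hn : c.Nodup := by
    rw [hp.nodup_iff, List.nodup_append]
    refine ⟨oneLine_nodup u, (oneLine_nodup v).map fun _ _ h => by simpa using h, ?_⟩
    intro x hx y hy hxy
    rw [List.mem_map] at hy
    obtain ⟨z, hz, rfl⟩ := hy
    have h1 := mem_oneLine hx
    have h2 := mem_oneLine hz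
    omega
  have hr : ∀ x ∈ c, 1 ≤ x ∧ x ≤ c.length := by
    intro x hx
    rw [hp.mem_iff, List.mem_append, List.mem_map] at hx
    rcases hx with hx | ⟨y, hy, rfl⟩
    · have := mem_oneLine hx
      omega
    · have := mem_oneLine hy
      omega
  obtain ⟨σ, hσ⟩ := exists_oneLine_eq hn hr
  rw [← hσ, st_oneLine]

/-- Shuffling commutes with standardization, if the letters of the first word are smaller. -/
theorem shuffleA_st {a b : List ℤ} (ha : a.Nodup) (hb : b.Nodup)
    (hab : ∀ x ∈ a, ∀ y ∈ b, x < y) :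
    shuffleA (st a) (st b) = shuffleSum a b fun c => basisA (st c) := by
  -- The rank of `x` in `a ++ b`. As the letters of `a` are smaller, their ranks are `1, …,
  -- a.length`. So relabelling by `f` turns `a` into the word of `st a` and `b` into the shifted
  -- word of `st b`.
  let f : ℤ → ℤ := fun x => (((a ++ b).filter fun y => decide (y < x)).length : ℤ) + 1
  have hf : ∀ x ∈ a ++ b, ∀ y ∈ a ++ b, x < y → f x < f y := by
    intro x hx y hy hxy
    have h1 : (((a ++ b).filter fun z => decide (z < x)).length) <
        ((a ++ b).filter fun z => decide (z < y)).length := by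
      have hs : ((a ++ b).filter fun z => decide (z < x)).Sublist
          ((a ++ b).filter fun z => decide (z < y)) :=
        List.monotone_filter_right _ fun z hz => by
          simp only [decide_eq_true_eq] at hz ⊢
          exact hz.trans hxy
      refine lt_of_le_of_ne hs.length_le fun he => ?_
      have h2 := hs.eq_of_length he
      have h3 : x ∈ (a ++ b).filter fun z => decide (z < y) :=
        List.mem_filter.mpr ⟨hx, by simpa using hxy⟩
      rw [← h2, List.mem_filter] at h3
      simp at h3
    simp only [f]
    omega
  have hn : ∀ {l : List ℤ} (g : ℤ → ℤ), l.Nodup → (∀ x ∈ l, ∀ y ∈ l, x < y → g x < g y) →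
      (l.map g).Nodup := fun {l} g hl hg => List.Nodup.map_on (fun x hx y hy h => by
    rcases lt_trichotomy x y with h' | h' | h'
    · exact absurd (hg x hx y hy h') (by rw [h]; exact lt_irrefl _)
    · exact h'
    · exact absurd (hg y hy x hx h') (by rw [h]; exact lt_irrefl _)) hl
  have hlt : ∀ {l : List ℤ} {x : ℤ}, x ∈ l → (l.filter fun y => decide (y < x)).length < l.length :=
    fun {l x} hx => by
      refine lt_of_le_of_ne (List.length_filter_le _ _) fun h => ?_
      have := List.length_filter_eq_length_iff.mp h x hx
      simp at this
  have hfa : ∀ x ∈ a, ∀ y ∈ a, x < y → f x < f y := fun x hx y hy =>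
    hf x (List.mem_append_left _ hx) y (List.mem_append_left _ hy)
  have hfb : ∀ x ∈ b, ∀ y ∈ b, x < y → f x < f y := fun x hx y hy =>
    hf x (List.mem_append_right _ hx) y (List.mem_append_right _ hy)
  have hra : ∀ x ∈ a, 1 ≤ f x ∧ f x ≤ a.length := by
    intro x hx
    have h1 : (b.filter fun y => decide (y < x)) = [] := List.filter_eq_nil_iff.mpr fun y hy => by
      have := hab x hx y hy
      simp only [decide_eq_true_eq]
      omega
    have h2 := hlt hx
    simp only [f, List.filter_append, h1, List.append_nil]
    omega
  have hrb : ∀ x ∈ b, 1 ≤ f x - a.length ∧ f x - a.length ≤ b.length := by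
    intro x hx
    have h1 : (a.filter fun y => decide (y < x)) = a := List.filter_eq_self.mpr fun y hy => by
      have := hab y hy x hx
      simpa using this
    have h2 := hlt hx
    simp only [f, List.filter_append, h1, List.length_append]
    omega
  obtain ⟨u, hu⟩ := exists_oneLine_eq (hn f ha hfa) (by
    intro x hx
    rw [List.mem_map] at hx
    obtain ⟨y, hy, rfl⟩ := hx
    rw [List.length_map]
    exact hra y hy)
  obtain ⟨v, hv⟩ := exists_oneLine_eq (hn (fun x => f x - a.length) hb fun x hx y hy h => by
      have := hfb x hx y hy h
      omega) (by
    intro x hx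
    rw [List.mem_map] at hx
    obtain ⟨y, hy, rfl⟩ := hx
    rw [List.length_map]
    exact hrb y hy)
  have eu : st a = ⟨_, u⟩ := (st_map ha hfa).symm.trans ((congrArg st hu).symm.trans (st_oneLine u))
  have ev : st b = ⟨_, v⟩ :=
    (st_map hb (f := fun x => f x - a.length) fun x hx y hy h => by
      have := hfb x hx y hy h
      omega).symm.trans ((congrArg st hv).symm.trans (st_oneLine v))
  have eb : ((oneLine v).map fun x => (((a.map f).length : ℕ) : ℤ) + x) = b.map f := by
    rw [hv, List.map_map, List.length_map]
    refine List.map_congr_left fun x _ => ?_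
    simp
  rw [eu, ev, shuffleA_eq, eb, hu, shuffleSum, shuffles_map, List.map_map]
  refine congrArg List.sum (List.map_congr_left fun c hc => ?_)
  have hp := shuffles_perm hc
  have hnd : c.Nodup := by
    rw [hp.nodup_iff, List.nodup_append]
    exact ⟨ha, hb, fun x hx y hy h => absurd (hab x hx y hy) (by rw [h]; exact lt_irrefl _)⟩
  simp only [Function.comp_apply]
  rw [st_map hnd fun x hx y hy => hf x (hp.mem_iff.mp hx) y (hp.mem_iff.mp hy)]

/-! ### Compatibility of product and coproduct -/

theorem unshuffleA_eq (u : PermA) : unshuffleA u = cutSum (oneLine u.2) fun a1 a2 =>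
    basisA (st a1) ⊗ₜ[ℤ] basisA (st a2) := by
  rw [cutSum, length_oneLine]
  rfl

/-- Standardization ignores the shift, which keeps the letters of the second factor above those of
the first. -/
theorem unshuffleA_eq_shift (u : PermA) (m : ℤ) :
    unshuffleA u = cutSum ((oneLine u.2).map fun a => m + a) fun a1 a2 =>
      basisA (st a1) ⊗ₜ[ℤ] basisA (st a2) := by
  rw [unshuffleA_eq, cutSum, cutSum, List.length_map]
  refine Finset.sum_congr rfl fun i _ => ?_
  have h : ∀ x y : ℤ, x < y → m + x < m + y := fun x y h => by omega
  rw [← List.map_take, ← List.map_drop,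
    st_map ((oneLine_nodup _).sublist (List.take_sublist _ _)) fun x _ y _ => h x y,
    st_map ((oneLine_nodup _).sublist (List.drop_sublist _ _)) fun x _ y _ => h x y]

/-- Products are sums over shuffles and coproducts are sums over cuts. `shuffleSum_cutSum`
interchanges them, and `shuffleA_st` recognizes the shuffles of the pieces as products of their
standardizations. -/
theorem comul_shuffleA (u v : PermA) :
    hopfShuffle.comul (shuffleA u v)
      = TensorProduct.map₂ hopfShuffle.mul hopfShuffle.mul (unshuffleA u) (unshuffleA v) := by
  obtain ⟨m, u⟩ := u
  obtain ⟨n, v⟩ := v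
  have hmul : ∀ s t : PermA, hopfShuffle.mul (basisA s) (basisA t) = shuffleA s t := fun s t => by
    change bilin shuffleA (Finsupp.single s 1) (Finsupp.single t 1) = _
    rw [bilin_single, one_mul, one_smul]
  have hcomul : ∀ s : PermA, hopfShuffle.comul (basisA s) = unshuffleA s := fun s => by
    change Finsupp.linearCombination ℤ unshuffleA (Finsupp.single s 1) = _
    rw [Finsupp.linearCombination_single, one_smul]
  have hr : ∀ (x : ZA ⊗[ℤ] ZA) (b : List ℤ) (G : List ℤ → List ℤ → ZA ⊗[ℤ] ZA),
      TensorProduct.map₂ hopfShuffle.mul hopfShuffle.mul x (cutSum b G) = cutSum b fun b1 b2 =>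
        TensorProduct.map₂ hopfShuffle.mul hopfShuffle.mul x (G b1 b2) := fun x b G =>
    map_sum _ _ _
  have hl : ∀ (y : ZA ⊗[ℤ] ZA) (a : List ℤ) (G : List ℤ → List ℤ → ZA ⊗[ℤ] ZA),
      TensorProduct.map₂ hopfShuffle.mul hopfShuffle.mul (cutSum a G) y = cutSum a fun a1 a2 =>
        TensorProduct.map₂ hopfShuffle.mul hopfShuffle.mul (G a1 a2) y := fun y a G => by
    rw [cutSum, map_sum, LinearMap.sum_apply]
    rfl
  have hta : ∀ (x : ZA) (a b : List ℤ) (F : List ℤ → ZA),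
      (x ⊗ₜ[ℤ] shuffleSum a b F) = shuffleSum a b fun c => x ⊗ₜ[ℤ] F c := fun x a b F =>
    map_shuffleSum (TensorProduct.mk ℤ ZA ZA x) a b F
  have htb : ∀ (x : ZA) (a b : List ℤ) (F : List ℤ → ZA),
      (shuffleSum a b F ⊗ₜ[ℤ] x) = shuffleSum a b fun c => F c ⊗ₜ[ℤ] x := fun x a b F =>
    map_shuffleSum ((TensorProduct.mk ℤ ZA ZA).flip x) a b F
  rw [shuffleA_eq, map_shuffleSum]
  rw [shuffleSum_congr (F' := fun c => cutSum c fun c1 c2 =>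
    basisA (st c1) ⊗ₜ[ℤ] basisA (st c2)) fun c hc => by
      rw [hcomul, unshuffleA_eq, oneLine_st_of_mem_shuffles hc]]
  rw [shuffleSum_cutSum, unshuffleA_eq, unshuffleA_eq_shift _ m, hl]
  simp only [hr]
  refine Finset.sum_congr rfl fun i _ => Finset.sum_congr rfl fun j _ => ?_
  dsimp only
  have ha := oneLine_nodup u
  have hb : ((oneLine v).map fun a => (m : ℤ) + a).Nodup :=
    (oneLine_nodup v).map fun _ _ h => by simpa using h
  have hab : ∀ x ∈ oneLine u, ∀ y ∈ (oneLine v).map fun a => (m : ℤ) + a, x < y := by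
    intro x hx y hy
    rw [List.mem_map] at hy
    obtain ⟨z, hz, rfl⟩ := hy
    have h1 := mem_oneLine hx
    have h2 := mem_oneLine hz
    omega
  rw [TensorProduct.map₂_apply_tmul, TensorProduct.map_tmul, hmul, hmul,
    shuffleA_st (ha.sublist (List.take_sublist _ _)) (hb.sublist (List.take_sublist _ _))
      fun x hx y hy => hab x (List.mem_of_mem_take hx) y (List.mem_of_mem_take hy),
    shuffleA_st (ha.sublist (List.drop_sublist _ _)) (hb.sublist (List.drop_sublist _ _))
      fun x hx y hy => hab x (List.mem_of_mem_drop hx) y (List.mem_of_mem_drop hy), htb]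
  simp only [hta]

theorem comul_mul_shuffle (a b : ZA) :
    hopfShuffle.comul (hopfShuffle.mul a b)
      = TensorProduct.map₂ hopfShuffle.mul hopfShuffle.mul (hopfShuffle.comul a)
        (hopfShuffle.comul b) := by
  induction a using Finsupp.induction_linear with
  | zero => simp only [map_zero, LinearMap.zero_apply]
  | add a a' ha ha' => simp only [map_add, LinearMap.add_apply, ha, ha']
  | single u c =>
    induction b using Finsupp.induction_linear with
    | zero => simp only [map_zero]
    | add b b' hb hb' => simp only [map_add, hb, hb']
    | single v d =>
      have h1 : hopfShuffle.mul (Finsupp.single u c) (Finsupp.single v d)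
          = (c * d) • shuffleA u v := bilin_single shuffleA u v c d
      have h2 : ∀ (s : PermA) (c : ℤ), hopfShuffle.comul (Finsupp.single s c) = c • unshuffleA s :=
        fun s c => Finsupp.linearCombination_single ℤ c s
      rw [h1, h2, h2, map_smul, comul_shuffleA, map_smul, map_smul, LinearMap.smul_apply,
        ← mul_smul, mul_comm]

end

open scoped TensorProduct
noncomputable section

/-! ### The main theorem -/

theorem isConnectedBialgebra_hopfShuffle :
    IsConnectedBialgebra (freeGr PermA) (cutA.shuffleHopf ⟨0, 1⟩) :=
  IsCut.shuffle_isConnectedBialgebra isCut_cutA isCutUnit_cutA (by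
    rw [← hopfShuffle_eq]
    exact comul_mul_shuffle)

theorem isConnectedBialgebra_hopfCup :
    IsConnectedBialgebra (freeGr PermA) (cutA.cupHopf ⟨0, 1⟩) :=
  IsCut.cup_isConnectedBialgebra isCut_cutA isCutUnit_cutA isConnectedBialgebra_hopfShuffle

end

theorem mainTheorem11 :
    -- the four operations of type D through the parabolic embedding `(u, v) ↦ u × v`
    (∀ (m n : ℕ), 2 ≤ m → ∀ u ∈ groupD m, ∀ (v : Equiv.Perm (Fin n)), ∀ w ∈ groupD (m + n),
      ((leftStD (w.window.take m) = ⟨m, u⟩ ∧ st (w.window.drop m) = ⟨n, v⟩) ↔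
        ∃ z ∈ groupD (m + n), z.desD ⊆ {m} ∧ w = z * SignedPerm.times u v) ∧
      ((rightStD (subword w.window 1 m) = ⟨m, u⟩ ∧
          st (subword (hat w.window) (m + 1) (m + n)) = ⟨n, v⟩) ↔
        ∃ z ∈ groupD (m + n), z.desD ⊆ {m} ∧ w = SignedPerm.times u v * z⁻¹)) ∧
    -- the two structures
    IsGradedHopf (freeGr PermA) hopfShuffle ∧
    IsGradedHopf (freeGr PermA) hopfCup ∧
    IsGradedModComod (freeGr PermA) (freeGr PermD) hopfShuffle modShuffle ∧
    IsGradedModComod (freeGr PermA) (freeGr PermD) hopfCup modCup ∧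
    -- they are dual to each other
    IsHopfDual (freeGr PermA) (freeGr PermA) (kron PermA) hopfShuffle hopfCup ∧
    IsModComodDual (freeGr PermD) (freeGr PermD) (kron PermD) (kron PermA) modShuffle modCup ∧
    -- they are isomorphic via inversion
    Function.Bijective (invLin PermA) ∧
    Function.Bijective (invLin PermD) ∧
    IsHopfHom (freeGr PermA) (freeGr PermA) hopfShuffle hopfCup (invLin PermA) ∧
    IsModComodHom (freeGr PermD) (freeGr PermD) modShuffle modCup
      (invLin PermA) (invLin PermD) ∧
    -- the diamond
    ∃ (HS : HopfOps ℤ (DesAlg PermA)) (HT : HopfOps ℤ (DesDual PermA)) (HL : HopfOps ℤ (Lam PermA))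
      (XS : ModComodOps ℤ (DesAlg PermA) (DesAlg PermD))
      (XT : ModComodOps ℤ (DesDual PermA) (DesDual PermD))
      (XL : ModComodOps ℤ (Lam PermA) (Lam PermD))
      (bA : Lam PermA →ₗ[ℤ] Lam PermA →ₗ[ℤ] ℤ) (bD : Lam PermD →ₗ[ℤ] Lam PermD →ₗ[ℤ] ℤ),
      -- type A: graded Hopf algebras and their homomorphisms
      IsGradedHopf (desGr PermA) HS ∧
      IsGradedHopf (dualGr PermA) HT ∧
      IsGradedHopf (lamGr PermA) HL ∧
      IsHopfHom (desGr PermA) (freeGr PermA) HS hopfCup (DesAlg PermA).subtype ∧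
      IsHopfHom (freeGr PermA) (dualGr PermA) hopfCup HT (chi' PermA) ∧
      IsHopfHom (desGr PermA) (lamGr PermA) HS HL (chiLam PermA) ∧
      IsHopfHom (lamGr PermA) (dualGr PermA) HL HT (Lam PermA).subtype ∧
      -- type D: graded right modules and comodules and their homomorphisms
      IsGradedModComod (desGr PermA) (desGr PermD) HS XS ∧
      IsGradedModComod (dualGr PermA) (dualGr PermD) HT XT ∧
      IsGradedModComod (lamGr PermA) (lamGr PermD) HL XL ∧
      IsModComodHom (desGr PermD) (freeGr PermD) XS modCup
        (DesAlg PermA).subtype (DesAlg PermD).subtype ∧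
      IsModComodHom (freeGr PermD) (dualGr PermD) modCup XT (chi' PermA) (chi' PermD) ∧
      IsModComodHom (desGr PermD) (lamGr PermD) XS XL (chiLam PermA) (chiLam PermD) ∧
      IsModComodHom (lamGr PermD) (dualGr PermD) XL XT
        (Lam PermA).subtype (Lam PermD).subtype ∧
      -- the diagram commutes, with injections and surjections as drawn
      (chi' PermD).comp (DesAlg PermD).subtype = (Lam PermD).subtype.comp (chiLam PermD) ∧
      Function.Injective (DesAlg PermD).subtype ∧
      Function.Surjective (chi' PermD) ∧
      Function.Surjective (chiLam PermD) ∧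
      Function.Injective (Lam PermD).subtype ∧
      -- the reflected diagram is the dual diagram: the entries ...
      IsLamForm PermA bA ∧
      IsLamForm PermD bD ∧
      IsHopfDual (desGr PermA) (dualGr PermA) (evalPairing PermA) HS HT ∧
      IsHopfDual (freeGr PermA) (freeGr PermA) (kronInv PermA) hopfCup hopfCup ∧
      IsHopfDual (lamGr PermA) (lamGr PermA) bA HL HL ∧
      IsModComodDual (desGr PermD) (dualGr PermD) (evalPairing PermD) (evalPairing PermA) XS XT ∧
      IsModComodDual (freeGr PermD) (freeGr PermD) (kronInv PermD) (kronInv PermA)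
        modCup modCup ∧
      IsModComodDual (lamGr PermD) (lamGr PermD) bD bA XL XL ∧
      -- ... and the maps
      (∀ (x : DesAlg PermD) (f : ZD),
        kronInv PermD ((DesAlg PermD).subtype x) f = evalPairing PermD x (chi' PermD f)) ∧
      (∀ (x : DesAlg PermD) (y : Lam PermD),
        bD (chiLam PermD x) y = evalPairing PermD x ((Lam PermD).subtype y)) := by
  refine ⟨fun m n hm u hu v w hw => ⟨parabolic_left hm hu v hw, parabolic_right hm hu v hw⟩, ?_⟩
  have h1 := isConnectedBialgebra_hopfShuffle.isGradedHopf
  have h2 := isConnectedBialgebra_hopfCup.isGradedHopf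
  have h3 := IsCut.shuffle_isGradedModComod isCut_cutA isCut_cutD isCutUnit_cutA
  have h4 := IsCut.cup_isGradedModComod isCut_cutA isCut_cutD isCutUnit_cutA
  have h5 := IsCut.shuffle_hopfDual_cup (e := ⟨0, 1⟩) isCut_cutA
  have h6 := IsCut.shuffle_dual_cup isCut_cutA isCut_cutD
  have h7 := IsCut.invLin_hopfHom isCut_cutA isCutUnit_cutA
  have h8 := IsCut.invLin_hom isCut_cutD
  have h9 := IsCut.exists_diamond isCut_cutA isCut_cutD isCutUnit_cutA isConnectedBialgebra_hopfCup
  rw [← hopfShuffle_eq] at h1 h3 h5 h7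
  rw [← hopfCup_eq] at h2 h4 h5 h7 h9
  rw [← modShuffle_eq] at h3 h6 h8
  rw [← modCup_eq] at h4 h6 h8 h9
  exact ⟨h1, h2, h3, h4, h5, h6, isCut_cutA.invLin_bijective, isCut_cutD.invLin_bijective, h7, h8, h9⟩
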